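/- **Setting.** Let $A,B:\mathbb R\to\mathbb R^{n\times n}$ be continuous and $1$-periodic, and let $\tau\in[0,1)$. For $N\ge 1$ let $M_N$ be the time-$1$ map on $C([-\tau-N,0];\mathbb C^n)$ of $\dot x(t)=A(t)x(t)+B(t)x(t-\tau-N)$. A number $\mu\in\mathbb C$ is a Floquet exponent of $M_N$ if $e^\mu$ is an eigenvalue of $M_N$. The number $\gamma+i\omega$ ($\gamma,\omega\in\mathbb R$) is a scaled Floquet exponent of $M_N$ if $\frac{\gamma}{N+\tau}+i\omega$ is a Floquet exponent of $M_N$; it is algebraically simple if the generalized eigenspace of $M_N$ for the eigenvalue $\exp(\frac{\gamma}{N+\tau}+i\omega)$ has dimension $1$. **Characteristic function.** Fix $R>0$ and an integer $K>\max\{\|A\|_\infty+R,\ \|B\|_\infty e^{1+R}\}$, where $\|A\|_\infty=\max_{t\in[-1,0]}\|A(t)\|_\infty$ (the matrix norm induced by the maximum norm), and put $t_j=-1+j/K$. For $\operatorname{Re}\mu\ge -R$, $|z|\le e^R$ and $v=(v_0,\dots,v_{K-1})\in(\mathbb C^n)^K$ let $y$ be the unique function on $[-1,0]$ that is continuous on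 each $[t_j,t_{j+1})$, has left limits at $t_1,\dots,t_K=0$, equals its left limit at $0$, and solves $$\dot y(t)=[A(t)-\mu I]y(t)+zB(t)\,y\big((t-\tau)_{\mathrm{mod}[-1,0)}\big)\ \text{ on each }[t_j,t_{j+1}),\qquad y(t_j)=v_j\quad(0\le j<K)$$ in the integrated sense. Let $\Delta(\mu,z)$ be the matrix with $$\Delta(\mu,z)v=\big(v_0-y(0),\,v_1-\lim_{t\nearrow t_1}y(t),\dots,v_{K-1}-\lim_{t\nearrow t_{K-1}}y(t)\big),$$ and let $h(\mu,z)=\det\Delta(\mu,z)$. **Statement.** Let $\omega_*,\gamma_*,\varphi_*\in\mathbb R$ with $\gamma_*>-R$ satisfy $$h(i\omega_*,e^{-\gamma_*-i\varphi_*})=0,\qquad \partial_2h(i\omega_*,e^{-\gamma_*-i\varphi_*})\ne0 .$$ Then there are $\delta_0,\varepsilon_0,\rho>0$, a constant $C$, and functions $\tilde\mu=\tilde\gamma+i\tilde\varphi$ on $J=(\omega_*-2\delta_0,\omega_*+2\delta_0)$ and $g:J\times[0,\varepsilon_0)\to\mathbb C$, all independent of $N$, such that the following holds. 1. $\tilde\mu$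 is smooth, $\tilde\mu(\omega_*)=\gamma_*+i\varphi_*$, and for each $\omega\in J$ the number $\tilde\mu(\omega)$ is the only $m$ with $|m-\gamma_*-i\varphi_*|<\rho$ and $h(i\omega,e^{-m})=0$; moreover $\partial_2h(i\omega,e^{-\tilde\mu(\omega)})\neq0$. 2. $g$ is smooth and $|g|\le C$. Put $$\tilde\gamma_N(\omega)=\Big[1+\tfrac1{N+\tau}\operatorname{Re}g\big(\omega,\tfrac1{N+\tau}\big)\Big]\tilde\gamma(\omega),\qquad \tilde\varphi_N(\omega)=\tilde\varphi(\omega)+\tfrac1{N+\tau}\operatorname{Im}g\big(\omega,\tfrac1{N+\tau}\big)\,\tilde\gamma(\omega).$$ In particular $\tilde\gamma_N=[1+O(1/N)]\tilde\gamma$. 3. For every $\delta\in(0,\delta_0]$ there are $r>0$ and $N_0\ge1$ such that $\frac1{N+\tau}<\varepsilon_0$ and (a)--(d) hold for all $N\ge N_0$. (a) For every integer $k$ with $\frac{2k\pi}{N+\tau}\in(\omega_*-\delta,\omega_*+\delta)$ the fixed point problem $$\omega=\frac{\tilde\varphi_N(\omega)}{N+\tau}+\frac{2k\pi}{N+\tau}$$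 has exactly one solution $\omega_k$ in $(\omega_*-2\delta,\omega_*+2\delta)$; the number $\tilde\gamma_N(\omega_k)+i\omega_k$ is an algebraically simple scaled Floquet exponent of $M_N$; and $\big|\omega_k-\frac{2k\pi}{N+\tau}-\frac1{N+\tau}\tilde\varphi\big(\frac{2k\pi}{N+\tau}\big)\big|\le\frac{C}{(N+\tau)^2}$. (b) If $k$ and $k+1$ are both as in (a), then $\big|\omega_{k+1}-\omega_k-\frac{2\pi}{N+\tau}\big|\le\frac{C}{(N+\tau)^2}$. (c) Let $\gamma+i\omega$ be a scaled Floquet exponent of $M_N$ with $|\gamma-\gamma_*|<r$ and $|\omega-\omega_*|<r$ whose phase is close to $\varphi_*$, that is, $|(N+\tau)\omega-2k\pi-\varphi_*|<r$ for some integer $k$. Then it is algebraically simple, $k$ is as in (a), $\omega=\omega_k$ and $\gamma=\tilde\gamma_N(\omega_k)$. (d) If $\varphi_*$ is, modulo $2\pi$, the only $\varphi\in\mathbb R$ with $h(i\omega_*,e^{-\gamma_*-i\varphi})=0$, then every scaled Floquet exponent $\gamma+i\omega$ of $M_N$ with $|\gamma-\gamma_*|<r$ and $|\omega-\omega_*|<r$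 is algebraically simple and equals $\tilde\gamma_N(\omega_k)+i\omega_k$ for some integer $k$ as in (a). 4. For every $\eta>0$ and all sufficiently large $N$ there is a scaled Floquet exponent $\gamma+i\omega$ of $M_N$ with $|\gamma-\gamma_*|<\eta$, $|\omega-\omega_*|<\eta$ and $|(N+\tau)\omega-2k\pi-\varphi_*|<\eta$ for some integer $k$. -/

import Mathlib

open Set Filter Topology
open scoped Matrix

noncomputable section

/-- The data of a linear periodic delay differential equation
`x'(t) = A(t) x(t) + B(t) x(t - τ - N)`: real `n × n` coefficient matrices that are continuous and
periodic in time with period `1`, and the delay `τ ∈ [0,1)`. The integer part `N` of the delay is a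
separate parameter. -/
structure PeriodicDDE (n : ℕ) where
  A : ℝ → Matrix (Fin n) (Fin n) ℝ
  B : ℝ → Matrix (Fin n) (Fin n) ℝ
  τ : ℝ
  continuous_A : Continuous A
  continuous_B : Continuous B
  periodic_A : Function.Periodic A 1
  periodic_B : Function.Periodic B 1
  τ_mem : τ ∈ Ico (0 : ℝ) 1

namespace PeriodicDDE

variable {n : ℕ}

/-- The coefficient matrix `A(t)`, acting on `ℂⁿ`. -/
def Ac (S : PeriodicDDE n) (t : ℝ) : Matrix (Fin n) (Fin n) ℂ := (S.A t).map Complex.ofReal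

/-- The coefficient matrix `B(t)`, acting on `ℂⁿ`. -/
def Bc (S : PeriodicDDE n) (t : ℝ) : Matrix (Fin n) (Fin n) ℂ := (S.B t).map Complex.ofReal

/-! ### The initial value problem and the time-1 map -/

/-- The phase space `C([-r,0]; ℂⁿ)`. -/
abbrev State (n : ℕ) (r : ℝ) : Type := C(Icc (-r) (0 : ℝ), Fin n → ℂ)

/-- `x` solves `x'(t) = A(t) x(t) + B(t) x(t - r)` for `t ∈ [0,1]` with initial history `φ` on
`[-r,0]`. -/
def IsSolution (S : PeriodicDDE n) (r : ℝ) (φ : State n r) (x : ℝ → Fin n → ℂ) : Prop :=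
  ContinuousOn x (Icc (-r) 1) ∧ (∀ s : Icc (-r) (0 : ℝ), x s = φ s) ∧
    ∀ t ∈ Icc (0 : ℝ) 1,
      HasDerivWithinAt x (S.Ac t *ᵥ x t + S.Bc t *ᵥ x (t - r)) (Icc 0 1) t

/-- Volterra operators on `C([0,1]; E)` have exactly one fixed point. -/
theorem existsUnique_volterra {E : Type*} [NormedAddCommGroup E] [CompleteSpace E]
    (K : C(Icc (0 : ℝ) 1, E) → C(Icc (0 : ℝ) 1, E)) (L : ℝ) (hL : 0 ≤ L)
    (hK : ∀ (u v : C(Icc (0 : ℝ) 1, E)) (c : ℝ) (m : ℕ), 0 ≤ c →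
      (∀ s, ‖u s - v s‖ ≤ c * (s : ℝ) ^ m) →
      ∀ t, ‖K u t - K v t‖ ≤ L * c * (t : ℝ) ^ (m + 1) / (m + 1)) :
    ∃! u, K u = u := by
  have key : ∀ (u v : C(Icc (0 : ℝ) 1, E)) (m : ℕ) (t : Icc (0 : ℝ) 1),
      ‖K^[m] u t - K^[m] v t‖ ≤ (L ^ m / m.factorial * dist u v) * (t : ℝ) ^ m := by
    intro u v m
    induction m with
    | zero =>
      intro t
      simpa [dist_eq_norm] using (u - v).norm_coe_le_norm t
    | succ m ih =>
      intro t
      rw [Function.iterate_succ_apply', Function.iterate_succ_apply']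
      refine (hK _ _ _ m (by positivity) ih t).trans (le_of_eq ?_)
      rw [Nat.factorial_succ]
      push_cast
      field_simp
      ring
  obtain ⟨m, hm⟩ := ((FloorSemiring.tendsto_pow_div_factorial_atTop L).eventually
    (gt_mem_nhds (show (0 : ℝ) < 1 / 2 by norm_num))).exists
  have hc : ContractingWith (1 / 2 : NNReal) (K^[m]) := by
    refine ⟨by rw [← NNReal.coe_lt_coe]; norm_num, LipschitzWith.of_dist_le_mul fun u v => ?_⟩
    rw [ContinuousMap.dist_le (by positivity)]
    intro t
    rw [dist_eq_norm]
    refine (key u v m t).trans ?_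
    have h1 : (t : ℝ) ^ m ≤ 1 := pow_le_one₀ t.2.1 t.2.2
    have h2 : (0 : ℝ) ≤ L ^ m / m.factorial * dist u v := by positivity
    calc _ ≤ L ^ m / m.factorial * dist u v * 1 := by gcongr
      _ ≤ _ := by
        rw [mul_one]
        push_cast
        gcongr
  refine ⟨_, hc.isFixedPt_fixedPoint_iterate, fun v hv => ?_⟩
  exact hc.fixedPoint_unique (Function.IsFixedPt.iterate hv m)

theorem continuous_Ac (S : PeriodicDDE n) : Continuous S.Ac :=
  S.continuous_A.matrix_map Complex.continuous_ofReal

theorem continuous_Bc (S : PeriodicDDE n) : Continuous S.Bc :=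
  S.continuous_B.matrix_map Complex.continuous_ofReal

/-- The right-hand side of the delay equation, for the history `φ` extended by the constant `φ(0)`
to the right and corrected by `u` on `[0,1]`. -/
def rhs (S : PeriodicDDE n) {r : ℝ} (hr : 0 ≤ r) (φ : State n r)
    (u : C(Icc (0 : ℝ) 1, Fin n → ℂ)) (t : ℝ) : Fin n → ℂ :=
  S.Ac t *ᵥ (IccExtend (neg_nonpos.2 hr) φ t + IccExtend zero_le_one u t) +
    S.Bc t *ᵥ (IccExtend (neg_nonpos.2 hr) φ (t - r) + IccExtend zero_le_one u (t - r))

theorem continuous_rhs (S : PeriodicDDE n) {r : ℝ} (hr : 0 ≤ r) (φ : State n r)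
    (u : C(Icc (0 : ℝ) 1, Fin n → ℂ)) : Continuous (S.rhs hr φ u) := by
  have h1 : Continuous (IccExtend (neg_nonpos.2 hr) φ) := φ.continuous.Icc_extend'
  have h2 : Continuous (IccExtend (zero_le_one (α := ℝ)) u) := u.continuous.Icc_extend'
  have hs : Continuous fun t : ℝ => t - r := continuous_id.sub continuous_const
  exact (S.continuous_Ac.matrix_mulVec (h1.add h2)).add
    (S.continuous_Bc.matrix_mulVec ((h1.comp hs).add (h2.comp hs)))

/-- The integrated right-hand side as a continuous function on `[0,1]`. -/
def picard (S : PeriodicDDE n) {r : ℝ} (hr : 0 ≤ r) (φ : State n r)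
    (u : C(Icc (0 : ℝ) 1, Fin n → ℂ)) : C(Icc (0 : ℝ) 1, Fin n → ℂ) where
  toFun t := ∫ s in (0 : ℝ)..t, S.rhs hr φ u s
  continuous_toFun := (intervalIntegral.continuous_primitive
    (fun a b => (S.continuous_rhs hr φ u).intervalIntegrable a b) 0).comp continuous_subtype_val

theorem exists_mulVec_bound (M : ℝ → Matrix (Fin n) (Fin n) ℂ) (hM : Continuous M) :
    ∃ a : ℝ, 0 ≤ a ∧ ∀ t ∈ Icc (0 : ℝ) 1, ∀ v, ‖M t *ᵥ v‖ ≤ a * ‖v‖ := by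
  have hc : Continuous fun t => ∑ i, ∑ j, ‖M t i j‖ :=
    continuous_finsetSum _ fun i _ => continuous_finsetSum _ fun j _ =>
      (hM.matrix_elem i j).norm
  obtain ⟨a, ha⟩ := (isCompact_Icc (a := (0 : ℝ)) (b := 1)).bddAbove_image hc.continuousOn
  refine ⟨max a 0, le_max_right _ _, fun t ht v => ?_⟩
  have hta : ∑ i, ∑ j, ‖M t i j‖ ≤ max a 0 :=
    (ha (mem_image_of_mem _ ht)).trans (le_max_left _ _)
  refine le_trans ?_ (mul_le_mul_of_nonneg_right hta (norm_nonneg v))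
  refine (pi_norm_le_iff_of_nonneg (by positivity)).2 fun i => ?_
  rw [Matrix.mulVec, dotProduct]
  calc ‖∑ j, M t i j * v j‖ ≤ ∑ j, ‖M t i j‖ * ‖v‖ := by
        refine (norm_sum_le _ _).trans (Finset.sum_le_sum fun j _ => ?_)
        rw [norm_mul]
        gcongr
        exact norm_le_pi_norm v j
    _ = (∑ j, ‖M t i j‖) * ‖v‖ := by rw [Finset.sum_mul]
    _ ≤ _ := by
        refine mul_le_mul_of_nonneg_right ?_ (norm_nonneg v)
        exact Finset.single_le_sum (f := fun i => ∑ j, ‖M t i j‖)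
          (fun i _ => by positivity) (Finset.mem_univ i)

theorem existsUnique_picard (S : PeriodicDDE n) {r : ℝ} (hr : 0 ≤ r) (φ : State n r) :
    ∃! u, S.picard hr φ u = u := by
  obtain ⟨a, ha0, ha⟩ := exists_mulVec_bound S.Ac S.continuous_Ac
  obtain ⟨b, hb0, hb⟩ := exists_mulVec_bound S.Bc S.continuous_Bc
  refine existsUnique_volterra _ (a + b) (by positivity) fun u v c m hc huv t => ?_
  have hext : ∀ s ∈ Icc (0 : ℝ) 1, ∀ s' ≤ s,
      ‖IccExtend zero_le_one u s' - IccExtend zero_le_one v s'‖ ≤ c * s ^ m := by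
    intro s hs s' hs'
    refine (huv (projIcc 0 1 zero_le_one s')).trans ?_
    gcongr
    · exact (projIcc 0 1 zero_le_one s').2.1
    · rw [coe_projIcc]
      exact max_le hs.1 ((min_le_right _ _).trans hs')
  have hint : ∀ s ∈ Icc (0 : ℝ) 1, ‖S.rhs hr φ u s - S.rhs hr φ v s‖ ≤ (a + b) * c * s ^ m := by
    intro s hs
    have e : S.rhs hr φ u s - S.rhs hr φ v s =
        S.Ac s *ᵥ (IccExtend zero_le_one u s - IccExtend zero_le_one v s) +
        S.Bc s *ᵥ (IccExtend zero_le_one u (s - r) - IccExtend zero_le_one v (s - r)) := by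
      simp only [rhs, Matrix.mulVec_add, Matrix.mulVec_sub]
      abel
    rw [e]
    calc _ ≤ a * (c * s ^ m) + b * (c * s ^ m) := by
          refine (norm_add_le _ _).trans (add_le_add ?_ ?_)
          · exact (ha s hs _).trans (by gcongr; exact hext s hs s le_rfl)
          · exact (hb s hs _).trans (by gcongr; exact hext s hs (s - r) (by linarith))
      _ = _ := by ring
  have e : S.picard hr φ u t - S.picard hr φ v t =
      ∫ s in (0 : ℝ)..t, (S.rhs hr φ u s - S.rhs hr φ v s) :=
    (intervalIntegral.integral_sub ((S.continuous_rhs hr φ u).intervalIntegrable _ _)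
      ((S.continuous_rhs hr φ v).intervalIntegrable _ _)).symm
  rw [e]
  calc _ ≤ ∫ s in (0 : ℝ)..t, (a + b) * c * s ^ m := by
        refine intervalIntegral.norm_integral_le_of_norm_le t.2.1 ?_
          (Continuous.intervalIntegrable (by fun_prop) _ _)
        exact Filter.Eventually.of_forall fun s hs => hint s ⟨hs.1.le, hs.2.trans t.2.2⟩
    _ = _ := by
        rw [intervalIntegral.integral_const_mul, integral_pow]
        simp
        ring

/-- The initial value problem has a solution. -/
theorem exists_isSolution (S : PeriodicDDE n) {r : ℝ} (hr : 0 ≤ r) (φ : State n r) :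
    ∃ x, S.IsSolution r φ x := by
  obtain ⟨u, hu, -⟩ := S.existsUnique_picard hr φ
  have h1 : Continuous (IccExtend (neg_nonpos.2 hr) φ) := φ.continuous.Icc_extend'
  have h2 : Continuous (IccExtend (zero_le_one (α := ℝ)) u) := u.continuous.Icc_extend'
  have hval : ∀ t : Icc (0 : ℝ) 1, u t = ∫ s in (0 : ℝ)..t, S.rhs hr φ u s := fun t => by
    conv_lhs => rw [← hu]
    rfl
  have hu0 : u ⟨0, left_mem_Icc.2 zero_le_one⟩ = 0 := by rw [hval]; simp
  refine ⟨fun t => IccExtend (neg_nonpos.2 hr) φ t + IccExtend zero_le_one u t,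
    (h1.add h2).continuousOn, fun s => ?_, fun t ht => ?_⟩
  · simp only [IccExtend_of_le_left zero_le_one u s.2.2, hu0, add_zero]
    exact IccExtend_val _ _ s
  · have hd : HasDerivAt
        (fun t => φ ⟨0, right_mem_Icc.2 (neg_nonpos.2 hr)⟩ + ∫ s in (0 : ℝ)..t, S.rhs hr φ u s)
        (S.rhs hr φ u t) t :=
      ((S.continuous_rhs hr φ u).integral_hasStrictDerivAt 0 t).hasDerivAt.const_add _
    refine hd.hasDerivWithinAt.congr_of_mem (fun s hs => ?_) ht
    rw [IccExtend_of_right_le (neg_nonpos.2 hr) φ hs.1, IccExtend_of_mem zero_le_one u hs, hval]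

/-- The solution of the initial value problem is unique. -/
theorem IsSolution.eqOn {S : PeriodicDDE n} {r : ℝ} (hr : 0 ≤ r) {φ : State n r}
    {x y : ℝ → Fin n → ℂ} (hx : S.IsSolution r φ x) (hy : S.IsSolution r φ y) :
    EqOn x y (Icc (-r) 1) := by
  have hfix : ∀ z, S.IsSolution r φ z → ∃ u : C(Icc (0 : ℝ) 1, Fin n → ℂ),
      S.picard hr φ u = u ∧
        ∀ t ∈ Icc (-r) 1, z t = IccExtend (neg_nonpos.2 hr) φ t + IccExtend zero_le_one u t := by
    intro z hz
    have hz0 : z 0 = φ ⟨0, right_mem_Icc.2 (neg_nonpos.2 hr)⟩ :=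
      hz.2.1 ⟨0, right_mem_Icc.2 (neg_nonpos.2 hr)⟩
    have hzc : ContinuousOn z (Icc 0 1) := hz.1.mono (Icc_subset_Icc (by linarith) le_rfl)
    let u : C(Icc (0 : ℝ) 1, Fin n → ℂ) :=
      ⟨fun t => z t - z 0, (continuousOn_iff_continuous_domRestrict.1 hzc).sub continuous_const⟩
    have hrep : ∀ t ∈ Icc (-r) 1,
        z t = IccExtend (neg_nonpos.2 hr) φ t + IccExtend zero_le_one u t := by
      intro t ht
      rcases le_total t 0 with h | h
      · rw [IccExtend_of_le_left zero_le_one u h, IccExtend_of_mem _ φ ⟨ht.1, h⟩]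
        change _ = _ + (z 0 - z 0)
        rw [sub_self, add_zero]
        exact hz.2.1 ⟨t, ht.1, h⟩
      · rw [IccExtend_of_right_le (neg_nonpos.2 hr) φ h, IccExtend_of_mem zero_le_one u ⟨h, ht.2⟩,
          ← hz0]
        change _ = _ + (z t - z 0)
        abel
    refine ⟨u, ?_, hrep⟩
    ext1 t
    have hftc : ∫ s in (0 : ℝ)..t, S.rhs hr φ u s = z t - z 0 := by
      refine intervalIntegral.integral_eq_sub_of_hasDerivAt_of_le t.2.1
        (hzc.mono (Icc_subset_Icc le_rfl t.2.2)) (fun s hs => ?_)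
        ((S.continuous_rhs hr φ u).intervalIntegrable _ _)
      have hs1 : s < 1 := hs.2.trans_le t.2.2
      have h := (hz.2.2 s ⟨hs.1.le, hs1.le⟩).hasDerivAt (Icc_mem_nhds hs.1 hs1)
      have e : S.rhs hr φ u s = S.Ac s *ᵥ z s + S.Bc s *ᵥ z (s - r) := by
        rw [rhs, ← hrep s ⟨by linarith [hs.1], hs1.le⟩,
          ← hrep (s - r) ⟨by linarith [hs.1], by linarith⟩]
      rw [e]
      exact h
    exact hftc
  obtain ⟨u, hu, hxu⟩ := hfix x hx
  obtain ⟨v, hv, hyv⟩ := hfix y hy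
  have huv : u = v := (S.existsUnique_picard hr φ).unique hu hv
  intro t ht
  rw [hxu t ht, hyv t ht, huv]

theorem IsSolution.add {S : PeriodicDDE n} {r : ℝ} {φ ψ : State n r} {x y : ℝ → Fin n → ℂ}
    (hx : S.IsSolution r φ x) (hy : S.IsSolution r ψ y) : S.IsSolution r (φ + ψ) (x + y) := by
  refine ⟨hx.1.add hy.1, fun s => ?_, fun t ht => ?_⟩
  · simp [hx.2.1 s, hy.2.1 s]
  · have e : S.Ac t *ᵥ (x + y) t + S.Bc t *ᵥ (x + y) (t - r) =
        (S.Ac t *ᵥ x t + S.Bc t *ᵥ x (t - r)) + (S.Ac t *ᵥ y t + S.Bc t *ᵥ y (t - r)) := by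
      rw [Pi.add_apply, Pi.add_apply, Matrix.mulVec_add, Matrix.mulVec_add]
      abel
    rw [e]
    exact (hx.2.2 t ht).add (hy.2.2 t ht)

theorem IsSolution.smul {S : PeriodicDDE n} {r : ℝ} {φ : State n r} {x : ℝ → Fin n → ℂ} (c : ℂ)
    (hx : S.IsSolution r φ x) : S.IsSolution r (c • φ) (c • x) := by
  refine ⟨hx.1.const_smul c, fun s => ?_, fun t ht => ?_⟩
  · simp [hx.2.1 s]
  · have e : S.Ac t *ᵥ (c • x) t + S.Bc t *ᵥ (c • x) (t - r) =
        c • (S.Ac t *ᵥ x t + S.Bc t *ᵥ x (t - r)) := by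
      rw [Pi.smul_apply, Pi.smul_apply, Matrix.mulVec_smul, Matrix.mulVec_smul, smul_add]
    rw [e]
    exact (hx.2.2 t ht).const_smul c

/-- The total delay `N + τ`. -/
def delay (S : PeriodicDDE n) (N : ℕ) : ℝ := N + S.τ

theorem delay_nonneg (S : PeriodicDDE n) (N : ℕ) : 0 ≤ S.delay N :=
  add_nonneg N.cast_nonneg S.τ_mem.1

/-- The solution of the initial value problem with delay `N + τ`. -/
def sol (S : PeriodicDDE n) (N : ℕ) (φ : State n (S.delay N)) : ℝ → Fin n → ℂ :=
  (S.exists_isSolution (S.delay_nonneg N) φ).choose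

theorem sol_spec (S : PeriodicDDE n) (N : ℕ) (φ : State n (S.delay N)) :
    S.IsSolution (S.delay N) φ (S.sol N φ) :=
  (S.exists_isSolution (S.delay_nonneg N) φ).choose_spec

theorem shift_mem (S : PeriodicDDE n) (N : ℕ) (s : Icc (-S.delay N) (0 : ℝ)) :
    (s : ℝ) + 1 ∈ Icc (-S.delay N) 1 :=
  ⟨by linarith [s.2.1], by linarith [s.2.2]⟩

/-- The time-1 map `M_N` on `C([-τ-N,0]; ℂⁿ)`: the initial history `φ` is mapped to
`s ↦ x(s+1)`, where `x` is the solution with history `φ`. -/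
def timeOneMap (S : PeriodicDDE n) (N : ℕ) : Module.End ℂ (State n (S.delay N)) where
  toFun φ := ⟨fun s => S.sol N φ (s + 1), by
    refine (S.sol_spec N φ).1.comp_continuous (by fun_prop) (S.shift_mem N)⟩
  map_add' φ ψ := by
    ext1 s
    exact (S.sol_spec N (φ + ψ)).eqOn (S.delay_nonneg N)
      ((S.sol_spec N φ).add (S.sol_spec N ψ)) (S.shift_mem N s)
  map_smul' c φ := by
    ext1 s
    exact (S.sol_spec N (c • φ)).eqOn (S.delay_nonneg N)
      ((S.sol_spec N φ).smul c) (S.shift_mem N s)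

/-! ### Floquet exponents -/

/-- `μ` is a Floquet exponent of `M_N` if `exp μ` is an eigenvalue of `M_N`. -/
def IsFloquetExponent (S : PeriodicDDE n) (N : ℕ) (μ : ℂ) : Prop :=
  (S.timeOneMap N).HasEigenvalue (Complex.exp μ)

/-- The unscaled exponent `γ/(N+τ) + iω` that belongs to the scaled exponent `γ + iω`. -/
def unscale (S : PeriodicDDE n) (N : ℕ) (γ ω : ℝ) : ℂ :=
  ((γ / S.delay N : ℝ) : ℂ) + ω * Complex.I

/-- `γ + iω` is a scaled Floquet exponent of `M_N`. -/
def IsScaledFloquetExponent (S : PeriodicDDE n) (N : ℕ) (γ ω : ℝ) : Prop :=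
  S.IsFloquetExponent N (S.unscale N γ ω)

/-- `γ + iω` is an algebraically simple scaled Floquet exponent of `M_N`: it is a scaled Floquet
exponent and the generalized eigenspace of the corresponding eigenvalue of `M_N` has
dimension one. -/
def IsSimpleScaledFloquetExponent (S : PeriodicDDE n) (N : ℕ) (γ ω : ℝ) : Prop :=
  S.IsScaledFloquetExponent N γ ω ∧
    Module.finrank ℂ
      ((S.timeOneMap N).maxGenEigenspace (Complex.exp (S.unscale N γ ω))) = 1

/-! ### The characteristic function -/

/-- The representative of `t` modulo `1` in `[-1,0)`. -/
def modPeriod (t : ℝ) : ℝ := Int.fract t - 1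

/-- The mesh points `t_j = -1 + j/k` of the partition of `[-1,0]` into `k` intervals. -/
def mesh (k j : ℕ) : ℝ := -1 + (j : ℝ) / k

/-- The space `C_k` of functions on `[-1,0]` that are continuous on each `[t_j, t_{j+1})` and have
a limit from the left at each `t_{j+1}`, for `j = 0, …, k-1`. -/
def PiecewiseCont (k : ℕ) (y : ℝ → Fin n → ℂ) : Prop :=
  ∀ j < k, ContinuousOn y (Ico (mesh k j) (mesh k (j + 1))) ∧
    ∃ l, Tendsto y (𝓝[<] mesh k (j + 1)) (𝓝 l)

/-- `y ∈ C_k` solves the multiple initial value problem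
`y'(t) = (A(t) - μ I) y(t) + z B(t) y((t - τ) mod [-1,0])`, `y(t_j) = v_j` for `j = 0, …, k-1`,
with restart at each `t_j`, written as an integral equation on each `[t_j, t_{j+1})`. -/
def IsMIVPSolution (S : PeriodicDDE n) (k : ℕ) (μ z : ℂ) (v : Fin k × Fin n → ℂ)
    (y : ℝ → Fin n → ℂ) : Prop :=
  PiecewiseCont k y ∧
    ∀ j : Fin k, ∀ t ∈ Ico (mesh k j) (mesh k (j + 1)),
      y t = (fun a => v (j, a)) + ∫ s in (mesh k j)..t,
        ((S.Ac s *ᵥ y s - μ • y s) + z • (S.Bc s *ᵥ y (modPeriod (s - S.τ))))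

open Classical in
/-- The solution of the multiple initial value problem. It exists and is unique on `[-1,0)` when
`Re μ ≥ -R`, `|z| ≤ exp R` and `k > C(R)`, see `charBound`; the value `0` is used if there is no
solution. -/
def mivpSol (S : PeriodicDDE n) (k : ℕ) (μ z : ℂ) (v : Fin k × Fin n → ℂ) : ℝ → Fin n → ℂ :=
  if h : ∃ y, S.IsMIVPSolution k μ z v y then h.choose else 0

/-- The characteristic matrix `Δ(μ,z)`, given by its columns: it maps `v` to the tuple with first
block `v_0 - y(0)` and with blocks `v_j - lim_{t ↗ t_j} y(t)` for `j = 1, …, k-1`, where `y` solves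
the multiple initial value problem with initial values `v`. Here `y(0)` is the limit of `y` from
the left at `0`. -/
def charMatrix (S : PeriodicDDE n) (k : ℕ) (μ z : ℂ) :
    Matrix (Fin k × Fin n) (Fin k × Fin n) ℂ :=
  Matrix.of fun p q => (Pi.single q (1 : ℂ) : Fin k × Fin n → ℂ) p -
    Function.leftLim (S.mivpSol k μ z (Pi.single q 1))
      (if p.1.val = 0 then 0 else mesh k p.1) p.2

/-- The characteristic function `h(μ,z) = det Δ(μ,z)`. -/
def charFun (S : PeriodicDDE n) (k : ℕ) (μ z : ℂ) : ℂ := (S.charMatrix k μ z).det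

/-- The partial derivative `∂₂h(μ,z)`. -/
def charFunDeriv₂ (S : PeriodicDDE n) (k : ℕ) (μ z : ℂ) : ℂ := deriv (fun w => S.charFun k μ w) z

/-- The maximum over `t ∈ [-1,0]` of the operator norm of `M(t)` that belongs to the maximum norm
(the largest absolute row sum). -/
def matrixSupNorm (M : ℝ → Matrix (Fin n) (Fin n) ℝ) : ℝ :=
  ⨆ t : Icc (-1 : ℝ) 0, ⨆ i : Fin n, ∑ j, |M t i j|

/-- The bound `C(R) = max {‖A‖ + R, ‖B‖ exp(1+R)}` for the number of subintervals. -/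
def charBound (S : PeriodicDDE n) (R : ℝ) : ℝ :=
  max (matrixSupNorm S.A + R) (matrixSupNorm S.B * Real.exp (1 + R))

/-! ### Perturbed curves -/

/-- The real part `[1 + ε Re g(ω,ε)] γ̃(ω)` of the perturbed curve, where `γ̃ = Re μ̃`. -/
def pertRe (μt : ℝ → ℂ) (g : ℝ → ℝ → ℂ) (ε ω : ℝ) : ℝ :=
  (1 + ε * (g ω ε).re) * (μt ω).re

/-- The phase `φ̃(ω) + ε Im g(ω,ε) γ̃(ω)` of the perturbed curve, where `φ̃ = Im μ̃`. -/
def pertIm (μt : ℝ → ℂ) (g : ℝ → ℝ → ℂ) (ε ω : ℝ) : ℝ :=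
  (μt ω).im + ε * (g ω ε).im * (μt ω).re

/-- The frequency `2jπ/(N+τ)`. -/
def freq (S : PeriodicDDE n) (N : ℕ) (j : ℤ) : ℝ := 2 * j * Real.pi / S.delay N

/-- `ω` solves the fixed point problem `ω = φ̃_N(ω)/(N+τ) + 2jπ/(N+τ)`, where `φ̃_N` is the phase of
the perturbed curve for `ε = 1/(N+τ)`. -/
def SolvesPhaseEq (S : PeriodicDDE n) (N : ℕ) (μt : ℝ → ℂ) (g : ℝ → ℝ → ℂ) (j : ℤ) (ω : ℝ) :
    Prop :=
  ω = pertIm μt g (1 / S.delay N) ω / S.delay N + S.freq N j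

end PeriodicDDE

end

open Set Filter Topology
open scoped Matrix

noncomputable section

namespace PeriodicDDE

variable {n : ℕ}

/-! ### Piecewise continuous functions as a Banach space -/

/-! Substituting x(t) = e^{μt} y(t) turns an eigenfunction of the time-1 map for e^μ into a
1-periodic solution y of y' = (A - μ)y + zB y(t - τ) with z = e^{-(N+τ)μ}. Because y is periodic,
the integer part of the delay survives only inside z. For `charBound` below `k` the multiple initial
value problem is an equation (1 - T(μ,z))u = v in a Banach space, with T affine in (μ,z) and 1 - T
invertible (`isUnit_one_sub_mivpOp`). Hence h is analytic, and the Floquet exponents are the zeros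
of s ↦ h(s, e^{-(N+τ)s}) (`isFloquetExponent_iff`). A Jordan chain of length two gives a periodic
solution of the equation differentiated along this curve, so the derivative of the characteristic
matrix sends a kernel vector into the range and the determinant has a multiple zero
(`exists_pieces_of_chain`, `deriv_det_eq_zero`). Simple zeros are therefore algebraically simple
exponents.

Put ε = 1/(N+τ) and m = γ + i((N+τ)ω - 2jπ). The exponent belonging to γ + iω is iω + ε Re m, and z
= e^{-m}; the characteristic equation becomes h(iω + ε Re m, e^{-m}) = 0, in which N occurs only
through ε, and ε = 0 is a regular limit. Since ∂₂h ≠ 0, the solutions are m = l(iω + ε Re m) with l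
holomorphic. A smooth divided difference of l (`exists_contDiffAt_slope`) allows the solution to be
written as μ̃ + ε g γ̃ with smooth g (`exists_pert`, `exists_perturbed_curve`). The real part of
this identity is the formula for γ. The imaginary part is the fixed point problem for ω, which is
contractive for large N because the phase is Lipschitz and is divided by N + τ.

Simplicity also comes from large N: the derivative of h along the curve is ∂₁h - (N+τ) z ∂₂h, and
the second term dominates uniformly near the base point (`exists_eventually_isRegular`). If only one
phase lies over the base point, compactness of the circle of phases excludes all others nearby
(`exists_phase_close`). -/

/-- The residue of an integer modulo `k`, as an element of `Fin k`. -/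
def residue (k : ℕ) [NeZero k] (m : ℤ) : Fin k :=
  ⟨(m % k).toNat, by
    have hk : (0 : ℤ) < k := by exact_mod_cast NeZero.pos k
    have h1 := Int.emod_nonneg m hk.ne'
    have h2 := Int.emod_lt_of_pos m hk
    omega⟩

theorem residue_add_self (k : ℕ) [NeZero k] (m : ℤ) : residue k (m + k) = residue k m := by
  simp [residue]

theorem residue_natCast {k : ℕ} [NeZero k] {j : ℕ} (hj : j < k) : residue k j = ⟨j, hj⟩ := by
  ext
  simp only [residue]
  rw [Int.emod_eq_of_lt (by positivity) (by exact_mod_cast hj)]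
  simp

/-- Functions with `k` continuous pieces, each on a copy of `[0,1]`. -/
def Pieces (k n : ℕ) : Type := C(Icc (0 : ℝ) 1, Fin k × Fin n → ℂ)

namespace Pieces

instance (k n : ℕ) : NormedAddCommGroup (Pieces k n) :=
  inferInstanceAs (NormedAddCommGroup C(Icc (0 : ℝ) 1, Fin k × Fin n → ℂ))

instance (k n : ℕ) : NormedSpace ℂ (Pieces k n) :=
  inferInstanceAs (NormedSpace ℂ C(Icc (0 : ℝ) 1, Fin k × Fin n → ℂ))

instance (k n : ℕ) : CompleteSpace (Pieces k n) :=
  inferInstanceAs (CompleteSpace C(Icc (0 : ℝ) 1, Fin k × Fin n → ℂ))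

instance (k n : ℕ) : FunLike (Pieces k n) (Icc (0 : ℝ) 1) (Fin k × Fin n → ℂ) :=
  inferInstanceAs (FunLike C(Icc (0 : ℝ) 1, Fin k × Fin n → ℂ) _ _)

variable {k : ℕ}

/-- The element of `Pieces k n` that belongs to a continuous function. -/
def mk (f : Icc (0 : ℝ) 1 → Fin k × Fin n → ℂ) (hf : Continuous f) : Pieces k n :=
  (⟨f, hf⟩ : C(Icc (0 : ℝ) 1, Fin k × Fin n → ℂ))

@[simp] theorem mk_apply (f : Icc (0 : ℝ) 1 → Fin k × Fin n → ℂ) (hf : Continuous f)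
    (t : Icc (0 : ℝ) 1) : mk f hf t = f t := rfl

theorem continuous (u : Pieces k n) : Continuous u := ContinuousMap.continuous _

theorem ext {u v : Pieces k n} (h : ∀ t, u t = v t) : u = v := DFunLike.ext _ _ h

@[simp] theorem add_apply (u v : Pieces k n) (t : Icc (0 : ℝ) 1) : (u + v) t = u t + v t := rfl

@[simp] theorem sub_apply (u v : Pieces k n) (t : Icc (0 : ℝ) 1) : (u - v) t = u t - v t := rfl

@[simp] theorem smul_apply (c : ℂ) (u : Pieces k n) (t : Icc (0 : ℝ) 1) :
    (c • u) t = c • u t := rfl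

theorem norm_apply_le (u : Pieces k n) (t : Icc (0 : ℝ) 1) : ‖u t‖ ≤ ‖u‖ :=
  ContinuousMap.norm_coe_le_norm _ _

theorem norm_le (u : Pieces k n) {c : ℝ} (hc : 0 ≤ c) (h : ∀ t, ‖u t‖ ≤ c) : ‖u‖ ≤ c :=
  (ContinuousMap.norm_le _ hc).2 h

/-- Volterra operators have exactly one fixed point. -/
theorem existsUnique_volterra (K : Pieces k n → Pieces k n) (L : ℝ) (hL : 0 ≤ L)
    (hK : ∀ (u v : Pieces k n) (c : ℝ) (m : ℕ), 0 ≤ c → (∀ s, ‖u s - v s‖ ≤ c * (s : ℝ) ^ m) →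
      ∀ t, ‖K u t - K v t‖ ≤ L * c * (t : ℝ) ^ (m + 1) / (m + 1)) :
    ∃! u, K u = u :=
  PeriodicDDE.existsUnique_volterra (E := Fin k × Fin n → ℂ) K L hL hK

/-- Evaluation at the right end of all pieces. -/
def endpoint (k n : ℕ) : Pieces k n →L[ℂ] (Fin k × Fin n → ℂ) :=
  LinearMap.mkContinuous
    { toFun := fun u => u ⟨1, right_mem_Icc.2 zero_le_one⟩
      map_add' := fun _ _ => rfl
      map_smul' := fun _ _ => rfl } 1 fun u => by
    rw [one_mul]
    exact u.norm_apply_le _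

end Pieces

variable {k : ℕ} [NeZero k]

/-- The `1`-periodic function on `ℝ` whose restriction to `[j/k, (j+1)/k)` is the piece with
number `j` modulo `k`. -/
def glue (u : Pieces k n) (t : ℝ) : Fin n → ℂ :=
  fun a => IccExtend zero_le_one u (Int.fract (k * t)) (residue k ⌊k * t⌋, a)

theorem glue_periodic (u : Pieces k n) : Function.Periodic (glue u) 1 := by
  intro t
  ext a
  have h : (k : ℝ) * (t + 1) = k * t + (k : ℤ) := by push_cast; ring
  rw [glue, glue, h, Int.fract_add_intCast, Int.floor_add_intCast, residue_add_self]

theorem norm_IccExtend_le {k : ℕ} (u : Pieces k n) (s : ℝ) : ‖IccExtend zero_le_one u s‖ ≤ ‖u‖ :=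
  u.norm_apply_le _

theorem norm_glue_le (u : Pieces k n) (t : ℝ) : ‖glue u t‖ ≤ ‖u‖ :=
  (pi_norm_le_iff_of_nonneg (norm_nonneg u)).2 fun _ =>
    (norm_le_pi_norm (IccExtend zero_le_one u _) _).trans (norm_IccExtend_le u _)

theorem glue_add (u v : Pieces k n) (t : ℝ) : glue (u + v) t = glue u t + glue v t := rfl

theorem glue_smul (c : ℂ) (u : Pieces k n) (t : ℝ) : glue (c • u) t = c • glue u t := rfl

/-- The glued function may jump at mesh points, so integrability cannot come from continuity. It is
a function of the position within a piece and of the piece number; the latter takes finitely many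
values, and both are measurable in t. -/
theorem measurable_glue (u : Pieces k n) : Measurable (glue u) := by
  refine measurable_pi_lambda _ fun a => ?_
  have h : Measurable fun p : ℝ × Fin k => IccExtend zero_le_one u p.1 (p.2, a) :=
    measurable_from_prod_countable_left fun j =>
      ((continuous_apply (j, a)).comp u.continuous.Icc_extend').measurable
  have hk : Measurable fun t : ℝ => (k : ℝ) * t := measurable_const_mul _
  refine h.comp (Measurable.prodMk (measurable_fract.comp hk) ?_)
  exact (measurable_of_countable (residue k)).comp (Int.measurable_floor.comp hk)

/-- The floor function is constant just to the right of every point. Right continuity is what yields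
right derivatives of the integrals in the a priori bound. -/
theorem continuousWithinAt_glue (u : Pieces k n) (t : ℝ) :
    ContinuousWithinAt (glue u) (Ici t) t := by
  have hk : (0 : ℝ) < k := by exact_mod_cast NeZero.pos k
  have h0 : Tendsto (fun s : ℝ => (k : ℝ) * s) (𝓝[≥] t) (𝓝[≥] (k * t)) :=
    tendsto_nhdsWithin_of_tendsto_nhds_of_eventually_within _
      ((continuous_const_mul (k : ℝ)).continuousAt.tendsto.mono_left nhdsWithin_le_nhds)
      (eventually_nhdsWithin_of_forall fun s hs => mul_le_mul_of_nonneg_left hs hk.le)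
  have hfl : ∀ᶠ s in 𝓝[≥] t, ⌊(k : ℝ) * s⌋ = ⌊(k : ℝ) * t⌋ :=
    tendsto_pure.1 ((tendsto_floor_right_pure_floor ((k : ℝ) * t)).comp h0)
  refine tendsto_pi_nhds.2 fun a => ?_
  have hc : Continuous fun s : ℝ =>
      IccExtend zero_le_one u (k * s - ⌊(k : ℝ) * t⌋) (residue k ⌊(k : ℝ) * t⌋, a) :=
    (continuous_apply _).comp (u.continuous.Icc_extend'.comp (by fun_prop))
  refine (hc.continuousAt.tendsto.mono_left nhdsWithin_le_nhds).congr' ?_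
  filter_upwards [hfl] with s hs
  rw [glue, Int.fract, hs]

theorem mul_mesh_add (j : ℕ) (s : ℝ) : (k : ℝ) * (mesh k j + s / k) = s + ((j - k : ℤ) : ℝ) := by
  have hk : (k : ℝ) ≠ 0 := NeZero.ne _
  rw [mesh]
  field_simp
  push_cast
  ring

theorem residue_sub_self (j : Fin k) : residue k ((j : ℤ) - k) = j := by
  rw [← residue_add_self, sub_add_cancel, residue_natCast j.2]

/-- On its `j`th subinterval the glued function is the piece number `j`. -/
theorem glue_mesh_add (u : Pieces k n) (j : Fin k) {s : ℝ} (hs : s ∈ Ico (0 : ℝ) 1) :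
    glue u (mesh k j + s / k) = fun a => IccExtend zero_le_one u s (j, a) := by
  have hf : ⌊s⌋ = 0 := Int.floor_eq_zero_iff.2 hs
  ext a
  rw [glue, mul_mesh_add, Int.fract_add_intCast, Int.floor_add_intCast, Int.fract_eq_self.2 hs, hf,
    zero_add, residue_sub_self]

/-! ### Integral operators restarted at the mesh points -/

/-- The coefficient `M(t)` applied to `y(t - d)`, on all pieces at once. -/
def lagged (M : ℝ → Matrix (Fin n) (Fin n) ℂ) (d : ℝ) (u : Pieces k n) (s : ℝ) :
    Fin k × Fin n → ℂ :=
  fun p => (M (mesh k p.1 + s / k) *ᵥ glue u (mesh k p.1 + s / k - d)) p.2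

theorem mesh_add_mem (j : Fin k) {s : ℝ} (hs : s ∈ Icc (0 : ℝ) 1) :
    mesh k j + s / k ∈ Icc (-1 : ℝ) 0 := by
  have hk : (0 : ℝ) < k := by exact_mod_cast NeZero.pos k
  have hj : (j : ℝ) + 1 ≤ k := by exact_mod_cast j.2
  have e : mesh k j + s / k = -1 + (j + s) / k := by rw [mesh]; ring
  rw [e]
  constructor
  · have : 0 ≤ ((j : ℝ) + s) / k := div_nonneg (add_nonneg (by positivity) hs.1) hk.le
    linarith
  · have : ((j : ℝ) + s) / k ≤ 1 := (div_le_one hk).2 (by linarith [hs.2])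
    linarith

/-- `b` bounds the norm of `M(t)` for `t ∈ [-1,0]`. -/
def MulVecBound (M : ℝ → Matrix (Fin n) (Fin n) ℂ) (b : ℝ) : Prop :=
  0 ≤ b ∧ ∀ t ∈ Icc (-1 : ℝ) 0, ∀ v, ‖M t *ᵥ v‖ ≤ b * ‖v‖

theorem exists_mulVecBound {M : ℝ → Matrix (Fin n) (Fin n) ℂ} (hM : Continuous M) :
    ∃ b, MulVecBound M b := by
  obtain ⟨b, hb0, hb⟩ := exists_mulVec_bound (fun t => M (t - 1)) (hM.comp (by fun_prop))
  refine ⟨b, hb0, fun t ht v => ?_⟩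
  simpa using hb (t + 1) ⟨by linarith [ht.1], by linarith [ht.2]⟩ v

theorem norm_lagged_le {M : ℝ → Matrix (Fin n) (Fin n) ℂ} {b : ℝ} (hb : MulVecBound M b) (d : ℝ)
    (u : Pieces k n) {s : ℝ} (hs : s ∈ Icc (0 : ℝ) 1) : ‖lagged M d u s‖ ≤ b * ‖u‖ := by
  refine (pi_norm_le_iff_of_nonneg (mul_nonneg hb.1 (norm_nonneg u))).2 fun p => ?_
  exact ((norm_le_pi_norm _ p.2).trans (hb.2 _ (mesh_add_mem p.1 hs) _)).trans
    (mul_le_mul_of_nonneg_left (norm_glue_le u _) hb.1)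

/-- Without delay, only the values of the pieces at the same s enter, and this pointwise bound makes
the operator Volterra; a delayed term admits only the bound by the supremum. The point s = 1 is
excluded because the glued function there already takes its value from the next piece. -/
theorem norm_lagged_zero_le {M : ℝ → Matrix (Fin n) (Fin n) ℂ} {b : ℝ} (hb : MulVecBound M b)
    (u : Pieces k n) {s : ℝ} (hs : s ∈ Ico (0 : ℝ) 1) :
    ‖lagged M 0 u s‖ ≤ b * ‖IccExtend zero_le_one u s‖ := by
  refine (pi_norm_le_iff_of_nonneg (mul_nonneg hb.1 (norm_nonneg _))).2 fun p => ?_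
  refine ((norm_le_pi_norm _ p.2).trans (hb.2 _ (mesh_add_mem p.1 ⟨hs.1, hs.2.le⟩) _)).trans
    (mul_le_mul_of_nonneg_left ?_ hb.1)
  rw [sub_zero, glue_mesh_add u p.1 hs]
  exact (pi_norm_le_iff_of_nonneg (norm_nonneg _)).2 fun a => norm_le_pi_norm _ _

theorem lagged_add (M : ℝ → Matrix (Fin n) (Fin n) ℂ) (d : ℝ) (u v : Pieces k n) (s : ℝ) :
    lagged M d (u + v) s = lagged M d u s + lagged M d v s := by
  ext p
  simp [lagged, glue_add, Matrix.mulVec_add]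

theorem lagged_smul (M : ℝ → Matrix (Fin n) (Fin n) ℂ) (d : ℝ) (c : ℂ) (u : Pieces k n) (s : ℝ) :
    lagged M d (c • u) s = c • lagged M d u s := by
  ext p
  simp [lagged, glue_smul, Matrix.mulVec_smul]

theorem measurable_lagged {M : ℝ → Matrix (Fin n) (Fin n) ℂ} (hM : Continuous M) (d : ℝ)
    (u : Pieces k n) : Measurable (lagged M d u) := by
  refine measurable_pi_lambda _ fun p => ?_
  simp only [lagged, Matrix.mulVec, dotProduct]
  refine Finset.measurable_fun_sum _ fun j _ => ?_
  have h : Measurable fun s : ℝ => mesh k p.1 + s / k := by fun_prop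
  refine Measurable.mul ?_ ?_
  · exact (hM.matrix_elem p.2 j).measurable.comp h
  · exact (measurable_pi_apply j).comp ((measurable_glue u).comp (h.sub_const d))

theorem intervalIntegrable_lagged {M : ℝ → Matrix (Fin n) (Fin n) ℂ} (hM : Continuous M) (d : ℝ)
    (u : Pieces k n) {a b : ℝ} (ha : a ∈ Icc (0 : ℝ) 1) (hb : b ∈ Icc (0 : ℝ) 1) :
    IntervalIntegrable (lagged M d u) MeasureTheory.volume a b := by
  obtain ⟨c, hc⟩ := exists_mulVecBound hM
  refine (intervalIntegrable_const (c := c * ‖u‖)).mono_fun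
    (measurable_lagged hM d u).aestronglyMeasurable ?_
  refine (MeasureTheory.ae_restrict_iff' measurableSet_uIoc).2 (.of_forall fun s hs => ?_)
  refine (norm_lagged_le hc d u ?_).trans (le_abs_self _)
  have hs' := uIoc_subset_uIcc hs
  exact ⟨(le_min ha.1 hb.1).trans hs'.1, hs'.2.trans (max_le ha.2 hb.2)⟩

theorem norm_integral_lagged_sub_le {M : ℝ → Matrix (Fin n) (Fin n) ℂ} {c : ℝ}
    (hc : MulVecBound M c) (d : ℝ) (u : Pieces k n) {a b : ℝ} (ha : a ∈ Icc (0 : ℝ) 1)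
    (hb : b ∈ Icc (0 : ℝ) 1) : ‖∫ s in a..b, lagged M d u s‖ ≤ c * ‖u‖ * |b - a| := by
  refine intervalIntegral.norm_integral_le_of_norm_le_const fun s hs => norm_lagged_le hc d u ?_
  have hs' := uIoc_subset_uIcc hs
  exact ⟨(le_min ha.1 hb.1).trans hs'.1, hs'.2.trans (max_le ha.2 hb.2)⟩

/-- The integral operator `y ↦ ∫ M(s) y(s - d) ds`, restarted at each mesh point. -/
def pieceIntegral {M : ℝ → Matrix (Fin n) (Fin n) ℂ} (hM : Continuous M) (d : ℝ) :
    Pieces k n →L[ℂ] Pieces k n :=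
  LinearMap.mkContinuousOfExistsBound
    { toFun := fun u => Pieces.mk (fun t => (k : ℂ)⁻¹ • ∫ s in (0 : ℝ)..t, lagged M d u s) <| by
        have h : ContinuousOn (fun t : ℝ => ∫ s in (0 : ℝ)..t, lagged M d u s) (Icc 0 1) := by
          have := intervalIntegral.continuousOn_primitive_interval
            (μ := MeasureTheory.volume) (f := lagged M d u) (a := 0) (b := 1)
          rw [uIcc_of_le zero_le_one] at this
          refine this ?_
          rw [← intervalIntegrable_iff_integrableOn_Icc_of_le zero_le_one]
          exact intervalIntegrable_lagged hM d u (by simp) (by simp)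
        exact (continuousOn_iff_continuous_domRestrict.1 h).const_smul (k : ℂ)⁻¹
      map_add' := fun u v => by
        refine Pieces.ext fun t => ?_
        simp only [lagged_add, Pieces.mk_apply, Pieces.add_apply]
        rw [intervalIntegral.integral_add (intervalIntegrable_lagged hM d u (by simp) t.2)
          (intervalIntegrable_lagged hM d v (by simp) t.2), smul_add]
        rfl
      map_smul' := fun c u => by
        refine Pieces.ext fun t => ?_
        simp only [lagged_smul, Pieces.mk_apply, Pieces.smul_apply, RingHom.id_apply]
        rw [intervalIntegral.integral_smul, smul_comm]
        rfl }
    (by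
      obtain ⟨c, hc⟩ := exists_mulVecBound hM
      refine ⟨‖(k : ℂ)⁻¹‖ * c, fun u => ?_⟩
      refine Pieces.norm_le _
        (mul_nonneg (mul_nonneg (norm_nonneg _) hc.1) (norm_nonneg _)) fun t => ?_
      refine (norm_smul_le _ _).trans ?_
      rw [mul_assoc]
      refine mul_le_mul_of_nonneg_left ?_ (norm_nonneg _)
      refine (norm_integral_lagged_sub_le hc d u (by simp) t.2).trans ?_
      refine mul_le_of_le_one_right (mul_nonneg hc.1 (norm_nonneg _)) ?_
      rw [sub_zero, abs_of_nonneg t.2.1]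
      exact t.2.2)

theorem pieceIntegral_apply {M : ℝ → Matrix (Fin n) (Fin n) ℂ} (hM : Continuous M) (d : ℝ)
    (u : Pieces k n) (t : Icc (0 : ℝ) 1) :
    pieceIntegral hM d u t = (k : ℂ)⁻¹ • ∫ s in (0 : ℝ)..t, lagged M d u s := rfl

theorem mulVecBound_map_ofReal {M : ℝ → Matrix (Fin n) (Fin n) ℝ} (hM : Continuous M) :
    MulVecBound (fun t => (M t).map Complex.ofReal) (matrixSupNorm M) := by
  have hbd : ∀ t : Icc (-1 : ℝ) 0, BddAbove (range fun i : Fin n => ∑ j, |M t i j|) :=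
    fun t => (finite_range _).bddAbove
  -- Boundedness matters: for an unbounded family the real supremum in `matrixSupNorm` would be the
  -- default value 0.
  have hB : BddAbove (range fun t : Icc (-1 : ℝ) 0 => ⨆ i : Fin n, ∑ j, |M t i j|) := by
    have hc : Continuous fun t => ∑ i, ∑ j, |M t i j| :=
      continuous_finsetSum _ fun i _ => continuous_finsetSum _ fun j _ =>
        (hM.matrix_elem i j).abs
    obtain ⟨a, ha⟩ := (isCompact_Icc (a := (-1 : ℝ)) (b := 0)).bddAbove_image hc.continuousOn
    refine ⟨a, ?_⟩
    rintro _ ⟨t, rfl⟩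
    refine Real.iSup_le (fun i => ?_) ?_
    · exact (Finset.single_le_sum (f := fun i => ∑ j, |M t i j|)
        (fun i _ => by positivity) (Finset.mem_univ i)).trans (ha (mem_image_of_mem _ t.2))
    · exact le_trans (by positivity) (ha (mem_image_of_mem _ t.2))
  have h0 : 0 ≤ matrixSupNorm M :=
    Real.iSup_nonneg fun t => Real.iSup_nonneg fun i => by positivity
  refine ⟨h0, fun t ht v => (pi_norm_le_iff_of_nonneg (by positivity)).2 fun i => ?_⟩
  have h1 : ∑ j, |M t i j| ≤ matrixSupNorm M :=
    (le_ciSup (hbd ⟨t, ht⟩) i).trans (le_ciSup hB ⟨t, ht⟩)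
  rw [Matrix.mulVec, dotProduct]
  calc ‖∑ j, (M t).map Complex.ofReal i j * v j‖ ≤ ∑ j, |M t i j| * ‖v‖ := by
        refine (norm_sum_le _ _).trans (Finset.sum_le_sum fun j _ => ?_)
        rw [norm_mul, Matrix.map_apply, Complex.norm_real, Real.norm_eq_abs]
        exact mul_le_mul_of_nonneg_left (norm_le_pi_norm v j) (abs_nonneg _)
    _ = (∑ j, |M t i j|) * ‖v‖ := by rw [Finset.sum_mul]
    _ ≤ _ := mul_le_mul_of_nonneg_right h1 (norm_nonneg v)

/-- Each application gains a factor t/(m+1), which is the hypothesis of the Volterra fixed point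
theorem. -/
theorem norm_pieceIntegral_zero_apply_le {M : ℝ → Matrix (Fin n) (Fin n) ℂ} (hM : Continuous M)
    {b : ℝ} (hb : MulVecBound M b) {u : Pieces k n} {c : ℝ} {m : ℕ}
    (hu : ∀ s, ‖u s‖ ≤ c * (s : ℝ) ^ m) (t : Icc (0 : ℝ) 1) :
    ‖pieceIntegral hM 0 u t‖ ≤ b / k * c * (t : ℝ) ^ (m + 1) / (m + 1) := by
  rw [pieceIntegral_apply, norm_smul, norm_inv, Complex.norm_natCast]
  have h : ‖∫ s in (0 : ℝ)..t, lagged M 0 u s‖ ≤ ∫ s in (0 : ℝ)..t, b * c * s ^ m := by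
    refine intervalIntegral.norm_integral_le_of_norm_le t.2.1 ?_
      (Continuous.intervalIntegrable (by fun_prop) _ _)
    -- The pointwise bound fails to apply only at s = 1, a null set.
    have h1 : ∀ᵐ s : ℝ, s ≠ 1 := by simp [MeasureTheory.ae_iff]
    filter_upwards [h1] with s hs1 hs
    have hs2 : s ∈ Ico (0 : ℝ) 1 := ⟨hs.1.le, lt_of_le_of_ne (hs.2.trans t.2.2) hs1⟩
    refine (norm_lagged_zero_le hb u hs2).trans ?_
    rw [mul_assoc]
    refine mul_le_mul_of_nonneg_left ?_ hb.1
    rw [IccExtend_of_mem zero_le_one u ⟨hs2.1, hs2.2.le⟩]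
    exact hu _
  rw [intervalIntegral.integral_const_mul, integral_pow] at h
  refine (mul_le_mul_of_nonneg_left h (by positivity)).trans (le_of_eq ?_)
  simp
  ring

/-- Volterra equations without delay are uniquely solvable. -/
theorem isUnit_one_sub_pieceIntegral_zero {M : ℝ → Matrix (Fin n) (Fin n) ℂ} (hM : Continuous M) :
    IsUnit (1 - pieceIntegral hM 0 : Pieces k n →L[ℂ] Pieces k n) := by
  obtain ⟨b, hb⟩ := exists_mulVecBound hM
  have key : ∀ g : Pieces k n, ∃! u, g + pieceIntegral hM 0 u = u := fun g => by
    refine Pieces.existsUnique_volterra _ (b / k) (div_nonneg hb.1 (by positivity))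
      fun u v c m _ huv t => ?_
    have e : (g + pieceIntegral hM 0 u) t - (g + pieceIntegral hM 0 v) t =
        pieceIntegral hM 0 (u - v) t := by
      rw [map_sub]
      simp
    rw [e]
    exact norm_pieceIntegral_zero_apply_le hM hb huv t
  rw [ContinuousLinearMap.isUnit_iff_bijective]
  have h : ∀ g u : Pieces k n, (1 - pieceIntegral hM 0 : Pieces k n →L[ℂ] Pieces k n) u = g ↔
      g + pieceIntegral hM 0 u = u := fun g u => by
    rw [sub_apply, one_apply_eq_self, sub_eq_iff_eq_add, eq_comm]
  refine ⟨fun u v huv => ?_, fun g => ?_⟩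
  · exact (key _).unique ((h _ u).1 huv) ((h _ v).1 rfl)
  · obtain ⟨u, hu, -⟩ := key g
    exact ⟨u, (h g u).2 hu⟩

theorem continuousWithinAt_lagged {M : ℝ → Matrix (Fin n) (Fin n) ℂ} (hM : Continuous M) (d : ℝ)
    (u : Pieces k n) (s : ℝ) : ContinuousWithinAt (lagged M d u) (Ici s) s := by
  refine tendsto_pi_nhds.2 fun p => ?_
  have hk : (0 : ℝ) < k := by exact_mod_cast NeZero.pos k
  have hc : Continuous fun s : ℝ => mesh k p.1 + s / k := by fun_prop
  have hmaps : MapsTo (fun s : ℝ => mesh k p.1 + s / k - d) (Ici s)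
      (Ici (mesh k p.1 + s / k - d)) := fun x hx => by
    have : s / k ≤ x / k := div_le_div_of_nonneg_right hx hk.le
    simp only [mem_Ici]
    linarith
  have hc' : Continuous fun s : ℝ => mesh k p.1 + s / k - d := by fun_prop
  have h1 := (continuousWithinAt_glue u (mesh k p.1 + s / k - d)).comp
    (f := fun s : ℝ => mesh k p.1 + s / k - d) hc'.continuousWithinAt hmaps
  simp only [lagged, Matrix.mulVec, dotProduct]
  refine tendsto_finsetSum _ fun j _ => Tendsto.mul ?_ ?_
  · exact ((hM.matrix_elem p.2 j).comp hc).continuousWithinAt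
  · exact tendsto_pi_nhds.1 h1 j

theorem lagged_one_zero (u : Pieces k n) {s : ℝ} (hs : s ∈ Ico (0 : ℝ) 1) :
    lagged (fun _ => 1) 0 u s = IccExtend zero_le_one u s := by
  ext p
  rw [lagged, Matrix.one_mulVec, sub_zero, glue_mesh_add u p.1 hs]

theorem hasDerivWithinAt_integral_of_rightCont {E : Type*} [NormedAddCommGroup E]
    [NormedSpace ℝ E] [CompleteSpace E] [MeasurableSpace E] [BorelSpace E]
    [SecondCountableTopology E] {F : ℝ → E} (hm : Measurable F)
    (hc : ∀ s, ContinuousWithinAt F (Ici s) s) {s : ℝ}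
    (hi : IntervalIntegrable F MeasureTheory.volume 0 s) :
    HasDerivWithinAt (fun t => ∫ x in (0 : ℝ)..t, F x) (F s) (Ici s) s :=
  intervalIntegral.integral_hasDerivWithinAt_right hi
    (hm.stronglyMeasurable.stronglyMeasurableAtFilter) ((hc s).mono Ioi_subset_Ici_self)

/-- A priori bound for the multiple initial value problem with a given delayed term. -/
theorem norm_le_of_eq_pieceIntegral {A B : ℝ → Matrix (Fin n) (Fin n) ℂ} (hA : Continuous A)
    (hB : Continuous B) {α β R : ℝ} (hα : MulVecBound A α) (hβ : MulVecBound B β)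
    (hk : α + R ≤ k) (hR : 0 ≤ α + R) {μ : ℂ} (hμ : -R ≤ μ.re) (d : ℝ) {u f : Pieces k n}
    (hu : u = pieceIntegral hA 0 u - μ • pieceIntegral (continuous_const (y := 1)) 0 u +
      pieceIntegral hB d f) :
    ‖u‖ ≤ β * Real.exp 1 / k * ‖f‖ := by
  have hk0 : (0 : ℝ) < k := by exact_mod_cast NeZero.pos k
  set F : ℝ → Fin k × Fin n → ℂ := fun s =>
    lagged A 0 u s - μ • lagged (fun _ => 1) 0 u s + lagged B d f s with hF
  have hFm : Measurable F :=
    ((measurable_lagged hA 0 u).sub ((measurable_lagged continuous_const 0 u).const_smul μ)).add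
      (measurable_lagged hB d f)
  have hFc : ∀ s, ContinuousWithinAt F (Ici s) s := fun s =>
    ((continuousWithinAt_lagged hA 0 u s).sub
      ((continuousWithinAt_lagged continuous_const 0 u s).const_smul μ)).add
      (continuousWithinAt_lagged hB d f s)
  have hFi : ∀ s ∈ Icc (0 : ℝ) 1, IntervalIntegrable F MeasureTheory.volume 0 s := fun s hs =>
    ((intervalIntegrable_lagged hA 0 u (by simp) hs).sub
      ((intervalIntegrable_lagged continuous_const 0 u (by simp) hs).smul μ)).add
      (intervalIntegrable_lagged hB d f (by simp) hs)
  have hrep : ∀ s ∈ Icc (0 : ℝ) 1, IccExtend zero_le_one u s = (k : ℂ)⁻¹ • ∫ x in (0 : ℝ)..s, F x := by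
    intro s hs
    rw [IccExtend_of_mem zero_le_one u hs]
    conv_lhs => rw [hu]
    simp only [Pieces.add_apply, Pieces.sub_apply, Pieces.smul_apply,
      pieceIntegral_apply, hF]
    have i1 := intervalIntegrable_lagged hA 0 u (left_mem_Icc.2 zero_le_one) hs
    have i2 := (intervalIntegrable_lagged (continuous_const (y := (1 : Matrix (Fin n) (Fin n) ℂ)))
      0 u (left_mem_Icc.2 zero_le_one) hs).smul μ
    have i3 := intervalIntegrable_lagged hB d f (left_mem_Icc.2 zero_le_one) hs
    have e1 := intervalIntegral.integral_add (i1.sub i2) i3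
    have e2 := intervalIntegral.integral_sub i1 i2
    have e3 := intervalIntegral.integral_smul (μ := MeasureTheory.volume) (a := 0) (b := s) μ
      (lagged (fun _ => (1 : Matrix (Fin n) (Fin n) ℂ)) 0 u)
    simp only [Pi.smul_apply] at e1 e2
    rw [e1, e2, e3, smul_add, smul_sub, smul_comm μ]
  -- This factor cancels the term -μu, so that the derivative of E·u contains only A and the delayed
  -- term. The quotient by k reflects that each subinterval of length 1/k is stretched to [0,1].
  set E : ℝ → ℂ := fun s => Complex.exp (μ * s / k) with hE
  have hEd : ∀ s, HasDerivAt E (μ / k * E s) s := fun s => by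
    have h1 : HasDerivAt (fun s : ℝ => μ * s / k) (μ / k) s := by
      simpa using ((Complex.ofRealCLM.hasDerivAt (x := s)).const_mul μ).div_const (k : ℂ)
    simpa [hE, mul_comm] using h1.cexp
  have hEn : ∀ s, ‖E s‖ = Real.exp (μ.re * (s / k)) := fun s => by
    rw [hE, Complex.norm_exp]
    congr 1
    have : μ * s / k = μ * ((s / k : ℝ) : ℂ) := by push_cast; ring
    rw [this, Complex.re_mul_ofReal]
  set w : ℝ → Fin k × Fin n → ℂ := fun s => E s • (k : ℂ)⁻¹ • ∫ x in (0 : ℝ)..s, F x with hw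
  set w' : ℝ → Fin k × Fin n → ℂ := fun s =>
    E s • (k : ℂ)⁻¹ • (lagged A 0 u s + lagged B d f s) with hw'
  have hwc : ContinuousOn w (Icc 0 1) := by
    have h1 : ContinuousOn (IccExtend zero_le_one u) (Icc (0 : ℝ) 1) :=
      u.continuous.Icc_extend'.continuousOn
    have h2 : Continuous E := continuous_iff_continuousAt.2 fun s => (hEd s).continuousAt
    exact h2.continuousOn.smul (h1.congr fun s hs => (hrep s hs).symm)
  have hwd : ∀ s ∈ Ico (0 : ℝ) 1, HasDerivWithinAt w (w' s) (Ici s) s := by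
    intro s hs
    have hs' : s ∈ Icc (0 : ℝ) 1 := ⟨hs.1, hs.2.le⟩
    have h := (hEd s).hasDerivWithinAt.smul
      ((hasDerivWithinAt_integral_of_rightCont hFm hFc (hFi s hs')).const_smul (k : ℂ)⁻¹)
    refine h.congr_deriv ?_
    rw [Pi.smul_apply, ← hrep s hs', hF]
    simp only [lagged_one_zero u hs, hw']
    module
  -- The right-hand side is a strict supersolution: Re μ ≥ -R gives α ≤ α + R + Re μ, and b > β‖f‖
  -- gives the strict inequality where the two sides meet. At the end b decreases to β‖f‖.
  have main : ∀ b : ℝ, β * ‖f‖ < b → ∀ s ∈ Icc (0 : ℝ) 1,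
      ‖w s‖ ≤ b * (s / k) * Real.exp ((α + R + μ.re) * (s / k)) := by
    intro b hb
    have hb0 : 0 < b := lt_of_le_of_lt (mul_nonneg hβ.1 (norm_nonneg f)) hb
    refine image_norm_le_of_norm_deriv_right_lt_deriv_boundary (a := 0) (b := 1)
      (B' := fun s => (k : ℝ)⁻¹ * (b * Real.exp ((α + R + μ.re) * (s / k)) +
        (α + R + μ.re) * (b * (s / k) * Real.exp ((α + R + μ.re) * (s / k))))) hwc hwd
      (by simp [hw]) (fun s => ?_) (fun s hs hws => ?_)
    · have h1 : HasDerivAt (fun s : ℝ => s / k) ((k : ℝ)⁻¹) s := by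
        simpa using (hasDerivAt_id s).div_const (k : ℝ)
      refine ((h1.const_mul b).mul ((h1.const_mul (α + R + μ.re)).exp)).congr_deriv ?_
      ring
    · have hs' : s ∈ Icc (0 : ℝ) 1 := ⟨hs.1, hs.2.le⟩
      have hsk : 0 ≤ s / k := div_nonneg hs.1 hk0.le
      have h1 : ‖w' s‖ ≤ (k : ℝ)⁻¹ * (α * ‖w s‖ + Real.exp (μ.re * (s / k)) * (β * ‖f‖)) := by
        have e1 : ‖w s‖ = Real.exp (μ.re * (s / k)) * ‖IccExtend zero_le_one u s‖ := by
          rw [hw, norm_smul, ← hrep s hs', hEn]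
        rw [hw', norm_smul, norm_smul, norm_inv, Complex.norm_natCast, hEn, e1]
        have h2 := (norm_add_le _ _).trans
          (add_le_add (norm_lagged_zero_le hα u hs) (norm_lagged_le hβ d f hs'))
        calc _ ≤ Real.exp (μ.re * (s / k)) * ((k : ℝ)⁻¹ *
              (α * ‖IccExtend zero_le_one u s‖ + β * ‖f‖)) := by gcongr
          _ = _ := by ring
      refine h1.trans_lt ?_
      rw [hws]
      refine mul_lt_mul_of_pos_left ?_ (inv_pos.2 hk0)
      have h3 : Real.exp (μ.re * (s / k)) ≤ Real.exp ((α + R + μ.re) * (s / k)) := by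
        gcongr
        linarith
      have h4 : Real.exp (μ.re * (s / k)) * (β * ‖f‖) <
          b * Real.exp ((α + R + μ.re) * (s / k)) := by
        calc _ ≤ Real.exp ((α + R + μ.re) * (s / k)) * (β * ‖f‖) := by
              gcongr
              exact mul_nonneg hβ.1 (norm_nonneg f)
          _ < Real.exp ((α + R + μ.re) * (s / k)) * b := by gcongr
          _ = _ := mul_comm _ _
      have h5 : α * (b * (s / k) * Real.exp ((α + R + μ.re) * (s / k))) ≤
          (α + R + μ.re) * (b * (s / k) * Real.exp ((α + R + μ.re) * (s / k))) := by
        gcongr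
        linarith
      linarith
  have hfin : ∀ b : ℝ, β * ‖f‖ < b → ‖u‖ ≤ b * (Real.exp 1 / k) := by
    intro b hb
    have hb0 : 0 < b := lt_of_le_of_lt (mul_nonneg hβ.1 (norm_nonneg f)) hb
    refine Pieces.norm_le _ (by positivity) fun t => ?_
    have h1 := main b hb t t.2
    have htk : 0 ≤ (t : ℝ) / k := div_nonneg t.2.1 hk0.le
    rw [hw, norm_smul, ← hrep t t.2, hEn, IccExtend_val, add_mul, Real.exp_add,
      mul_comm (Real.exp ((α + R) * _)), ← mul_assoc, mul_comm _ (Real.exp (μ.re * _)),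
      mul_assoc] at h1
    refine (le_of_mul_le_mul_left h1 (Real.exp_pos _)).trans ?_
    have h2 : (t : ℝ) / k ≤ 1 / k := div_le_div_of_nonneg_right t.2.2 hk0.le
    -- Here k ≥ α + R is used; it reduces the exponential growth on one subinterval to the factor e.
    have h3 : (α + R) * ((t : ℝ) / k) ≤ 1 := by
      calc _ ≤ k * ((t : ℝ) / k) := by gcongr
        _ = t := by field_simp
        _ ≤ 1 := t.2.2
    calc b * ((t : ℝ) / k) * Real.exp ((α + R) * (t / k)) ≤ b * (1 / k) * Real.exp 1 := by gcongr
      _ = _ := by ring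
  have hlim : ‖u‖ ≤ β * ‖f‖ * (Real.exp 1 / k) := by
    have hpos : 0 < Real.exp 1 / k := by positivity
    rw [← div_le_iff₀ hpos]
    exact le_of_forall_gt_imp_ge_of_dense fun b hb => (div_le_iff₀ hpos).2 (hfin _ hb)
  refine hlim.trans (le_of_eq ?_)
  ring

/-! ### The multiple initial value problem as an operator equation -/

/-- The right-hand side `A(t)y(t) - μy(t) + zB(t)y(t-τ)` for a `1`-periodic function `y`. -/
def perRhs (S : PeriodicDDE n) (μ z : ℂ) (y : ℝ → Fin n → ℂ) (t : ℝ) : Fin n → ℂ :=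
  (S.Ac t *ᵥ y t - μ • y t) + z • (S.Bc t *ᵥ y (t - S.τ))

/-- The integral operator of the multiple initial value problem. -/
def mivpOp (S : PeriodicDDE n) (k : ℕ) [NeZero k] (μ z : ℂ) : Pieces k n →L[ℂ] Pieces k n :=
  pieceIntegral S.continuous_Ac 0 - μ • pieceIntegral (continuous_const (y := 1)) 0 +
    z • pieceIntegral S.continuous_Bc S.τ

/-- Absorbing μ into the coefficient matrix makes the undelayed Volterra result applicable to A - μ.
-/
theorem pieceIntegral_sub_smul_one {A : ℝ → Matrix (Fin n) (Fin n) ℂ} (hA : Continuous A) (μ : ℂ) :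
    (pieceIntegral hA 0 - μ • pieceIntegral (continuous_const (y := 1)) 0 :
      Pieces k n →L[ℂ] Pieces k n) =
    pieceIntegral (hA.sub (continuous_const (y := μ • (1 : Matrix (Fin n) (Fin n) ℂ)))) 0 := by
  ext1 u
  refine Pieces.ext fun t => ?_
  simp only [sub_apply, smul_apply, Pieces.sub_apply, Pieces.smul_apply,
    pieceIntegral_apply]
  have i1 := intervalIntegrable_lagged hA 0 u (left_mem_Icc.2 zero_le_one) t.2
  have i2 := (intervalIntegrable_lagged (continuous_const (y := (1 : Matrix (Fin n) (Fin n) ℂ)))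
    0 u (left_mem_Icc.2 zero_le_one) t.2).smul μ
  have e2 := intervalIntegral.integral_sub i1 i2
  have e3 := intervalIntegral.integral_smul (μ := MeasureTheory.volume) (a := 0) (b := (t : ℝ)) μ
    (lagged (fun _ => (1 : Matrix (Fin n) (Fin n) ℂ)) 0 u)
  simp only [Pi.smul_apply] at e2
  rw [smul_comm μ, ← e3, ← smul_sub, ← e2]
  congr 2
  ext s p
  simp [lagged, Matrix.sub_mulVec, Matrix.smul_mulVec]

/-- The operator equation is uniquely solvable for `Re μ ≥ -R` and `|z| ≤ exp R`. -/
theorem isUnit_one_sub_mivpOp (S : PeriodicDDE n) {R : ℝ} (hR : 0 ≤ R) (hk : S.charBound R < k)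
    {μ z : ℂ} (hμ : -R ≤ μ.re) (hz : ‖z‖ ≤ Real.exp R) : IsUnit (1 - S.mivpOp k μ z) := by
  have hk0 : (0 : ℝ) < k := by exact_mod_cast NeZero.pos k
  have hα : MulVecBound S.Ac (matrixSupNorm S.A) := mulVecBound_map_ofReal S.continuous_A
  have hβ : MulVecBound S.Bc (matrixSupNorm S.B) := mulVecBound_map_ofReal S.continuous_B
  have hk1 : matrixSupNorm S.A + R ≤ k := (le_max_left _ _).trans hk.le
  have hk2 : matrixSupNorm S.B * Real.exp (1 + R) < k := (le_max_right _ _).trans_lt hk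
  obtain ⟨V, hV⟩ := isUnit_one_sub_pieceIntegral_zero (k := k)
    (S.continuous_Ac.sub (continuous_const (y := μ • (1 : Matrix (Fin n) (Fin n) ℂ))))
  rw [← pieceIntegral_sub_smul_one S.continuous_Ac] at hV
  set W : Pieces k n →L[ℂ] Pieces k n := pieceIntegral S.continuous_Bc S.τ with hW
  -- The invertible undelayed part V is split off; the delayed part is then a perturbation handled
  -- by a Neumann series.
  have e : 1 - S.mivpOp k μ z = V * (1 - ↑V⁻¹ * (z • W)) := by
    rw [mul_sub, mul_one, ← mul_assoc, Units.mul_inv, one_mul, hV, mivpOp]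
    abel
  rw [e]
  refine V.isUnit.mul (isUnit_one_sub_of_norm_lt_one ?_)
  -- The a priori bound contributes ‖B‖e/k and |z| contributes at most e^R; the second entry of
  -- `charBound` is exactly what makes the product less than 1.
  set q : ℝ := matrixSupNorm S.B * Real.exp 1 / k * Real.exp R with hq
  have hq0 : 0 ≤ q := mul_nonneg (div_nonneg (mul_nonneg hβ.1 (Real.exp_pos _).le) hk0.le)
    (Real.exp_pos _).le
  have hq1 : q < 1 := by
    rw [hq, div_mul_eq_mul_div, mul_assoc, ← Real.exp_add]
    exact (div_lt_one hk0).2 hk2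
  refine (ContinuousLinearMap.opNorm_le_bound _ hq0 fun f => ?_).trans_lt hq1
  set x := (↑V⁻¹ * (z • W)) f with hx
  have hVx : (V : Pieces k n →L[ℂ] Pieces k n) x = W (z • f) := by
    rw [hx, ← mul_apply_eq_comp, ← mul_assoc, Units.mul_inv, one_mul,
      smul_apply, map_smul]
  rw [hV] at hVx
  have hxe : x = pieceIntegral S.continuous_Ac 0 x -
      μ • pieceIntegral (continuous_const (y := 1)) 0 x + W (z • f) := by
    rw [← hVx]
    simp only [sub_apply, one_apply_eq_self, smul_apply]
    abel
  refine (norm_le_of_eq_pieceIntegral S.continuous_Ac S.continuous_Bc hα hβ hk1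
    (add_nonneg hα.1 hR) hμ S.τ hxe).trans ?_
  rw [hq, norm_smul, mul_assoc _ (Real.exp R)]
  gcongr
  exact div_nonneg (mul_nonneg hβ.1 (Real.exp_pos _).le) hk0.le

/-- Constant pieces. -/
def constPieces (k n : ℕ) : (Fin k × Fin n → ℂ) →L[ℂ] Pieces k n :=
  LinearMap.toContinuousLinearMap
    { toFun := fun v => Pieces.mk (fun _ => v) continuous_const
      map_add' := fun _ _ => rfl
      map_smul' := fun _ _ => rfl }

/-- The block with number `j` of a vector. -/
def block {k : ℕ} (j : Fin k) : (Fin k × Fin n → ℂ) →L[ℂ] (Fin n → ℂ) :=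
  LinearMap.toContinuousLinearMap (LinearMap.funLeft ℂ ℂ fun a => (j, a))

@[simp] theorem block_apply {k : ℕ} (j : Fin k) (v : Fin k × Fin n → ℂ) :
    block j v = fun a => v (j, a) := rfl

theorem intervalIntegrable_mulVec_glue {M : ℝ → Matrix (Fin n) (Fin n) ℂ} (hM : Continuous M)
    (u : Pieces k n) (d a b : ℝ) :
    IntervalIntegrable (fun t => M t *ᵥ glue u (t - d)) MeasureTheory.volume a b := by
  have hg : Measurable fun t => M t *ᵥ glue u (t - d) := by
    refine measurable_pi_lambda _ fun i => ?_
    simp only [Matrix.mulVec, dotProduct]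
    refine Finset.measurable_fun_sum _ fun j _ => Measurable.mul ?_ ?_
    · exact (hM.matrix_elem i j).measurable
    · exact (measurable_pi_apply j).comp ((measurable_glue u).comp (measurable_id.sub_const d))
  have hc : Continuous fun t => ∑ i, ∑ j, ‖M t i j‖ * ‖u‖ :=
    continuous_finsetSum _ fun i _ => continuous_finsetSum _ fun j _ =>
      (hM.matrix_elem i j).norm.mul continuous_const
  refine (hc.intervalIntegrable a b).mono_fun hg.aestronglyMeasurable (.of_forall fun t => ?_)
  refine le_trans ?_ (le_abs_self _)
  refine (pi_norm_le_iff_of_nonneg (by positivity)).2 fun i => ?_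
  rw [Matrix.mulVec, dotProduct]
  calc ‖∑ j, M t i j * glue u (t - d) j‖ ≤ ∑ j, ‖M t i j‖ * ‖u‖ := by
        refine (norm_sum_le _ _).trans (Finset.sum_le_sum fun j _ => ?_)
        rw [norm_mul]
        gcongr
        exact (norm_le_pi_norm _ j).trans (norm_glue_le u _)
    _ ≤ _ := Finset.single_le_sum (f := fun i => ∑ j, ‖M t i j‖ * ‖u‖)
          (fun i _ => by positivity) (Finset.mem_univ i)

/-- The substitution x = t_j + s/k returns to the original time and accounts for the factor 1/k in
`pieceIntegral`. -/
theorem block_pieceIntegral {M : ℝ → Matrix (Fin n) (Fin n) ℂ} (hM : Continuous M) (d : ℝ)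
    (u : Pieces k n) (j : Fin k) (t : Icc (0 : ℝ) 1) :
    block j (pieceIntegral hM d u t) =
      ∫ x in mesh k j..mesh k j + t / k, M x *ᵥ glue u (x - d) := by
  have hk : (k : ℝ) ≠ 0 := NeZero.ne _
  have h := intervalIntegral.integral_comp_add_div (a := 0) (b := (t : ℝ))
    (fun x => M x *ᵥ glue u (x - d)) hk (mesh k j)
  rw [zero_div, add_zero] at h
  have hi := intervalIntegrable_lagged hM d u (left_mem_Icc.2 zero_le_one) t.2
  rw [pieceIntegral_apply, map_smul, ← ContinuousLinearMap.intervalIntegral_comp_comm _ hi]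
  have h2 : (∫ x in (0 : ℝ)..t, block j (lagged M d u x)) =
      ∫ x in (0 : ℝ)..t, M (mesh k j + x / k) *ᵥ glue u (mesh k j + x / k - d) := rfl
  rw [h2, h, ← Complex.coe_smul, smul_smul]
  simp

theorem intervalIntegrable_perRhs_glue (S : PeriodicDDE n) (μ z : ℂ) (u : Pieces k n) (a b : ℝ) :
    IntervalIntegrable (S.perRhs μ z (glue u)) MeasureTheory.volume a b := by
  have i1 := intervalIntegrable_mulVec_glue S.continuous_Ac u 0 a b
  have i2 := intervalIntegrable_mulVec_glue
    (continuous_const (y := (1 : Matrix (Fin n) (Fin n) ℂ))) u 0 a b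
  have i3 := intervalIntegrable_mulVec_glue S.continuous_Bc u S.τ a b
  simp only [sub_zero, Matrix.one_mulVec] at i1 i2
  exact (i1.sub (i2.smul μ)).add (i3.smul z)

theorem block_mivpOp (S : PeriodicDDE n) (μ z : ℂ) (u : Pieces k n) (j : Fin k)
    (t : Icc (0 : ℝ) 1) :
    block j (S.mivpOp k μ z u t) =
      ∫ x in mesh k j..mesh k j + t / k, S.perRhs μ z (glue u) x := by
  set b := mesh k j + t / k
  have i1 := intervalIntegrable_mulVec_glue S.continuous_Ac u 0 (mesh k j) b
  have i2 := intervalIntegrable_mulVec_glue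
    (continuous_const (y := (1 : Matrix (Fin n) (Fin n) ℂ))) u 0 (mesh k j) b
  have i3 := intervalIntegrable_mulVec_glue S.continuous_Bc u S.τ (mesh k j) b
  have e : S.mivpOp k μ z u t = pieceIntegral S.continuous_Ac 0 u t -
      μ • pieceIntegral (continuous_const (y := 1)) 0 u t +
      z • pieceIntegral S.continuous_Bc S.τ u t := rfl
  rw [e, map_add, map_sub, map_smul, map_smul, block_pieceIntegral, block_pieceIntegral,
    block_pieceIntegral]
  simp only [sub_zero, Matrix.one_mulVec] at i1 i2 ⊢
  have e1 := intervalIntegral.integral_add (i1.sub (i2.smul μ)) (i3.smul z)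
  have e2 := intervalIntegral.integral_sub i1 (i2.smul μ)
  simp only [Pi.smul_apply] at e1 e2
  have e0 : ∫ x in mesh k j..b, S.perRhs μ z (glue u) x = _ := e1
  rw [e0, e2, intervalIntegral.integral_smul, intervalIntegral.integral_smul]

/-- The operator equation on each piece. -/
theorem one_sub_mivpOp_apply_eq_iff (S : PeriodicDDE n) (μ z : ℂ) (u : Pieces k n)
    (v : Fin k × Fin n → ℂ) :
    (1 - S.mivpOp k μ z) u = constPieces k n v ↔ ∀ (j : Fin k) (t : Icc (0 : ℝ) 1),
      block j (u t) = block j v + ∫ x in mesh k j..mesh k j + t / k, S.perRhs μ z (glue u) x := by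
  have h : (1 - S.mivpOp k μ z) u = constPieces k n v ↔
      ∀ t, u t = v + S.mivpOp k μ z u t := by
    rw [sub_apply, one_apply_eq_self, sub_eq_iff_eq_add, DFunLike.ext_iff]
    rfl
  rw [h]
  constructor
  · intro h j t
    rw [h t, map_add, block_mivpOp]
  · intro h t
    ext ⟨j, a⟩
    have := congr_fun (h j t) a
    rw [← block_mivpOp, ← map_add] at this
    exact this

/-- The points `modPeriod (t - S.τ)` and t - τ differ by an integer, so for the periodic extension
the reduction modulo 1 can be dropped. Agreement on [-1,0) suffices because the reduced point lies
there. -/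
theorem perRhs_congr (S : PeriodicDDE n) (μ z : ℂ) {y : ℝ → Fin n → ℂ} {u : Pieces k n}
    (h : EqOn y (glue u) (Ico (-1) 0)) {t : ℝ} (ht : t ∈ Ico (-1 : ℝ) 0) :
    (S.Ac t *ᵥ y t - μ • y t) + z • (S.Bc t *ᵥ y (modPeriod (t - S.τ))) =
      S.perRhs μ z (glue u) t := by
  have h1 : modPeriod (t - S.τ) ∈ Ico (-1 : ℝ) 0 :=
    ⟨by rw [modPeriod]; linarith [Int.fract_nonneg (t - S.τ)],
      by rw [modPeriod]; linarith [Int.fract_lt_one (t - S.τ)]⟩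
  have h2 : glue u (modPeriod (t - S.τ)) = glue u (t - S.τ) := by
    have := (glue_periodic u).sub_int_mul_eq (x := t - S.τ) (⌊t - S.τ⌋ + 1)
    rw [← this, modPeriod, Int.fract]
    congr 1
    push_cast
    ring
  rw [h ht, h h1, h2, perRhs]

theorem mesh_zero (k : ℕ) : mesh k 0 = -1 := by simp [mesh]

theorem mesh_self : mesh k k = 0 := by
  have hk : (k : ℝ) ≠ 0 := NeZero.ne _
  simp [mesh, hk]

theorem mesh_succ (k j : ℕ) : mesh k (j + 1) = mesh k j + 1 / k := by
  rw [mesh, mesh]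
  push_cast
  ring

theorem mesh_mono {k i j : ℕ} (h : i ≤ j) : mesh k i ≤ mesh k j := by
  rw [mesh, mesh]
  gcongr

/-- Each point of `[-1,0)` lies in a subinterval of the mesh. -/
theorem exists_mesh_add {t : ℝ} (ht : t ∈ Ico (-1 : ℝ) 0) :
    ∃ j : Fin k, ∃ s ∈ Ico (0 : ℝ) 1, t = mesh k j + s / k := by
  have hk : (0 : ℝ) < k := by exact_mod_cast NeZero.pos k
  have h0 : 0 ≤ k * (t + 1) := mul_nonneg hk.le (by linarith [ht.1])
  have h1 : k * (t + 1) < k := by nlinarith [ht.2]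
  refine ⟨⟨⌊k * (t + 1)⌋₊, (Nat.floor_lt h0).2 h1⟩, k * (t + 1) - ⌊k * (t + 1)⌋₊,
    ⟨sub_nonneg.2 (Nat.floor_le h0), by linarith [Nat.lt_floor_add_one (k * (t + 1))]⟩, ?_⟩
  rw [mesh]
  field_simp
  ring

theorem mem_Ico_mesh_iff (j : ℕ) (t : ℝ) :
    t ∈ Ico (mesh k j) (mesh k (j + 1)) ↔ k * (t - mesh k j) ∈ Ico (0 : ℝ) 1 := by
  have hk : (0 : ℝ) < k := by exact_mod_cast NeZero.pos k
  rw [mesh_succ, mem_Ico, mem_Ico, mul_nonneg_iff_of_pos_left hk, sub_nonneg, ← sub_lt_iff_lt_add',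
    lt_div_iff₀ hk, mul_comm]

theorem glue_eq_of_mem_Ico (u : Pieces k n) (j : Fin k) {t : ℝ}
    (ht : t ∈ Ico (mesh k j) (mesh k (j + 1))) :
    glue u t = block j (IccExtend zero_le_one u (k * (t - mesh k j))) := by
  have hk : (k : ℝ) ≠ 0 := NeZero.ne _
  rw [block_apply, ← glue_mesh_add u j ((mem_Ico_mesh_iff (k := k) j t).1 ht)]
  congr 1
  field_simp
  ring

theorem tendsto_glue_left (u : Pieces k n) (j : Fin k) :
    Tendsto (glue u) (𝓝[<] mesh k (j + 1)) (𝓝 (block j (Pieces.endpoint k n u))) := by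
  have hk : (k : ℝ) ≠ 0 := NeZero.ne _
  have hk0 : (0 : ℝ) < k := by exact_mod_cast NeZero.pos k
  have hc : Continuous fun t : ℝ => block j (IccExtend zero_le_one u (k * (t - mesh k j))) :=
    (block j).continuous.comp (u.continuous.Icc_extend'.comp (by fun_prop))
  have h1 : k * (mesh k (j + 1) - mesh k j) = 1 := by
    rw [mesh_succ]
    field_simp
    ring
  have h2 := (hc.tendsto (mesh k (j + 1))).mono_left
    (nhdsWithin_le_nhds (s := Iio (mesh k (j + 1))))
  rw [h1, IccExtend_of_mem zero_le_one u (right_mem_Icc.2 zero_le_one)] at h2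
  refine h2.congr' ?_
  have hlt : mesh k j < mesh k (j + 1) := by
    rw [mesh_succ]
    have : 0 < 1 / (k : ℝ) := by positivity
    linarith
  filter_upwards [Ico_mem_nhdsLT hlt] with t ht
  rw [glue_eq_of_mem_Ico u j ht]

theorem mesh_mem_Icc (k : ℕ) [NeZero k] {j : ℕ} (hj : j ≤ k) : mesh k j ∈ Icc (-1 : ℝ) 0 :=
  ⟨by rw [← mesh_zero k]; exact mesh_mono (Nat.zero_le j),
    by rw [← mesh_self (k := k)]; exact mesh_mono hj⟩

/-- A solution of the operator equation is a solution of the multiple initial value problem. -/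
theorem isMIVPSolution_glue (S : PeriodicDDE n) {μ z : ℂ} {u : Pieces k n} {v : Fin k × Fin n → ℂ}
    (h : (1 - S.mivpOp k μ z) u = constPieces k n v) : S.IsMIVPSolution k μ z v (glue u) := by
  rw [one_sub_mivpOp_apply_eq_iff] at h
  refine ⟨fun j hj => ⟨?_, _, tendsto_glue_left u ⟨j, hj⟩⟩, fun j t ht => ?_⟩
  · have hc : Continuous fun t : ℝ =>
        block ⟨j, hj⟩ (IccExtend zero_le_one u (k * (t - mesh k j))) :=
      (block _).continuous.comp (u.continuous.Icc_extend'.comp (by fun_prop))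
    exact hc.continuousOn.congr fun t ht => glue_eq_of_mem_Ico u ⟨j, hj⟩ ht
  · have hk : (k : ℝ) ≠ 0 := NeZero.ne _
    have hs := (mem_Ico_mesh_iff (k := k) j t).1 ht
    have h1 := h j ⟨_, hs.1, hs.2.le⟩
    have h2 : mesh k j + k * (t - mesh k j) / k = t := by field_simp; ring
    rw [glue_eq_of_mem_Ico u j ht, IccExtend_of_mem zero_le_one u ⟨hs.1, hs.2.le⟩, h1]
    simp only [h2, block_apply]
    congr 1
    refine intervalIntegral.integral_congr fun x hx => ?_
    rw [uIcc_of_le ht.1] at hx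
    refine (perRhs_congr S μ z (fun _ _ => rfl) ⟨?_, ?_⟩).symm
    · exact (mesh_mem_Icc k j.2.le).1.trans hx.1
    · exact (hx.2.trans_lt ht.2).trans_le (mesh_mem_Icc k j.2).2

/-- A solution of the multiple initial value problem is a solution of the operator equation. -/
theorem IsMIVPSolution.exists_pieces {S : PeriodicDDE n} {μ z : ℂ} {v : Fin k × Fin n → ℂ}
    {y : ℝ → Fin n → ℂ} (h : S.IsMIVPSolution k μ z v y) :
    ∃ u : Pieces k n, EqOn y (glue u) (Ico (-1) 0) ∧
      (1 - S.mivpOp k μ z) u = constPieces k n v := by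
  have hk : (k : ℝ) ≠ 0 := NeZero.ne _
  have hk0 : (0 : ℝ) < k := by exact_mod_cast NeZero.pos k
  choose l hl using fun j : Fin k => (h.1 j j.2).2
  have hmem : ∀ (j : Fin k) (s : ℝ), s ∈ Ico (0 : ℝ) 1 →
      mesh k j + s / k ∈ Ico (mesh k j) (mesh k (j + 1)) := fun j s hs => by
    rw [mem_Ico_mesh_iff]
    simpa [mul_div_cancel₀, hk] using hs
  set g : ℝ → Fin k × Fin n → ℂ := fun s p => y (mesh k p.1 + s / k) p.2 with hg
  -- A piece is known on [0,1) only; its value at 1 is filled in with the left limit provided by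
  -- `PiecewiseCont`.
  have hgc : ContinuousOn (Function.update g 1 fun p => l p.1 p.2) (Icc 0 1) := by
    rw [continuousOn_update_iff, Icc_sdiff_right]
    refine ⟨continuousOn_pi.2 fun p => ?_, fun _ => tendsto_pi_nhds.2 fun p => ?_⟩
    · have h1 := (h.1 p.1 p.1.2).1.comp (f := fun s : ℝ => mesh k p.1 + s / k) (s := Ico 0 1)
        (Continuous.continuousOn (by fun_prop)) fun s hs => hmem p.1 s hs
      exact (continuous_apply p.2).comp_continuousOn h1
    · refine ((continuous_apply p.2).tendsto _).comp ((hl p.1).comp ?_)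
      refine tendsto_nhdsWithin_of_tendsto_nhds_of_eventually_within _ ?_ ?_
      · rw [mesh_succ]
        exact (Continuous.tendsto (by fun_prop : Continuous fun s : ℝ => mesh k p.1 + s / k)
          1).mono_left nhdsWithin_le_nhds
      · exact eventually_nhdsWithin_of_forall fun s hs => (hmem p.1 s hs).2
  set u : Pieces k n := Pieces.mk _ (continuousOn_iff_continuous_domRestrict.1 hgc) with hu
  have hus : ∀ s (hs : s ∈ Ico (0 : ℝ) 1), u ⟨s, hs.1, hs.2.le⟩ = g s := fun s hs =>
    by
      rw [hu, Pieces.mk_apply, Set.domRestrict_apply]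
      exact Function.update_of_ne hs.2.ne _ _
  have hyu : EqOn y (glue u) (Ico (-1) 0) := by
    intro t ht
    obtain ⟨j, s, hs, rfl⟩ := exists_mesh_add (k := k) ht
    rw [glue_mesh_add u j hs, IccExtend_of_mem zero_le_one u ⟨hs.1, hs.2.le⟩, hus s hs]
  refine ⟨u, hyu, ?_⟩
  have heq : EqOn (IccExtend zero_le_one ((1 - S.mivpOp k μ z) u))
      (fun _ => v) (Ico (0 : ℝ) 1) := by
    intro s hs
    simp only [IccExtend_of_mem zero_le_one _ (⟨hs.1, hs.2.le⟩ : s ∈ Icc (0 : ℝ) 1)]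
    have e : ((1 - S.mivpOp k μ z) u) ⟨s, hs.1, hs.2.le⟩ =
      u ⟨s, hs.1, hs.2.le⟩ - S.mivpOp k μ z u ⟨s, hs.1, hs.2.le⟩ := rfl
    rw [e, sub_eq_iff_eq_add]
    ext ⟨j, a⟩
    have h1 := h.2 j _ (hmem j s hs)
    have h2 : block j (S.mivpOp k μ z u ⟨s, hs.1, hs.2.le⟩) = _ := block_mivpOp S μ z u j _
    have h3 : ∫ x in mesh k j..mesh k j + s / k, S.perRhs μ z (glue u) x =
        ∫ x in mesh k j..mesh k j + s / k,
          ((S.Ac x *ᵥ y x - μ • y x) + z • (S.Bc x *ᵥ y (modPeriod (x - S.τ)))) := by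
      refine intervalIntegral.integral_congr fun x hx => ?_
      rw [uIcc_of_le (hmem j s hs).1] at hx
      refine (perRhs_congr S μ z hyu ⟨?_, ?_⟩).symm
      · exact (mesh_mem_Icc k j.2.le).1.trans hx.1
      · exact (hx.2.trans_lt (hmem j s hs).2).trans_le (mesh_mem_Icc k j.2).2
    rw [h3] at h2
    rw [← h2] at h1
    rw [hus s hs]
    exact congr_fun h1 a
  refine Pieces.ext fun t => ?_
  -- The equation has been verified on [0,1); at the endpoint 1 it follows by continuity of both
  -- sides.
  have hcl := heq.closure (Pieces.continuous _).Icc_extend' continuous_const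
  rw [closure_Ico zero_ne_one] at hcl
  have := hcl t.2
  rwa [IccExtend_val] at this

/-! ### The characteristic matrix as an operator on initial values -/

/-- The operator that maps the block with number `j` to the block with number `j + 1`, and the last
block to the first one. -/
def cycleBlocks (k n : ℕ) [NeZero k] : (Fin k × Fin n → ℂ) →L[ℂ] (Fin k × Fin n → ℂ) :=
  LinearMap.toContinuousLinearMap
    (LinearMap.funLeft ℂ ℂ fun p => (residue k ((p.1 : ℤ) - 1), p.2))

/-- The solution of the operator equation as a function of the initial values. -/
def mivpFlow (S : PeriodicDDE n) (k : ℕ) [NeZero k] (μ z : ℂ) :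
    (Fin k × Fin n → ℂ) →L[ℂ] Pieces k n :=
  Ring.inverse (1 - S.mivpOp k μ z) ∘L constPieces k n

/-- The characteristic matrix as an operator. -/
def charOp (S : PeriodicDDE n) (k : ℕ) [NeZero k] (μ z : ℂ) :
    (Fin k × Fin n → ℂ) →L[ℂ] (Fin k × Fin n → ℂ) :=
  1 - cycleBlocks k n ∘L Pieces.endpoint k n ∘L S.mivpFlow k μ z

/-- `Ring.inverse` is 0 at non-units, so invertibility is needed for `mivpFlow` to be the solution
operator. The total inverse makes it possible to differentiate in (μ,z). -/
theorem mivpFlow_eq_iff (S : PeriodicDDE n) {μ z : ℂ} (h : IsUnit (1 - S.mivpOp k μ z))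
    (v : Fin k × Fin n → ℂ) (u : Pieces k n) :
    S.mivpFlow k μ z v = u ↔ (1 - S.mivpOp k μ z) u = constPieces k n v := by
  have h1 := Ring.mul_inverse_cancel _ h
  have h2 := Ring.inverse_mul_cancel _ h
  constructor
  · rintro rfl
    exact DFunLike.congr_fun h1 (constPieces k n v)
  · intro hu
    rw [mivpFlow, ContinuousLinearMap.comp_apply, ← hu]
    exact DFunLike.congr_fun h2 u

/-- The solution in `charMatrix` is an arbitrary choice, but any solution is a glued function on
[-1,0) with uniquely determined pieces, and the left limits see no other points. -/
theorem charMatrix_eq (S : PeriodicDDE n) {μ z : ℂ} (h : IsUnit (1 - S.mivpOp k μ z)) :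
    S.charMatrix k μ z = LinearMap.toMatrix' (S.charOp k μ z).toLinearMap := by
  ext p q
  set v : Fin k × Fin n → ℂ := Pi.single q 1 with hv
  have hex : ∃ y, S.IsMIVPSolution k μ z v y :=
    ⟨_, isMIVPSolution_glue S ((mivpFlow_eq_iff S h v _).1 rfl)⟩
  have hsol : S.IsMIVPSolution k μ z v (S.mivpSol k μ z v) := by
    rw [mivpSol, dif_pos hex]
    exact hex.choose_spec
  obtain ⟨u, hu, hu'⟩ := hsol.exists_pieces
  have hflow := (mivpFlow_eq_iff S h v u).2 hu'
  have hlim : ∀ j : Fin k,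
      Function.leftLim (S.mivpSol k μ z v) (mesh k (j + 1)) = block j (Pieces.endpoint k n u) := fun j => by
    refine leftLim_eq_of_tendsto ((tendsto_glue_left u j).congr' ?_)
    have hlt : (-1 : ℝ) < mesh k (j + 1) := by
      rw [mesh_succ]
      have h1 : 0 < 1 / (k : ℝ) := one_div_pos.2 (by exact_mod_cast NeZero.pos k)
      linarith [(mesh_mem_Icc k j.2.le).1]
    filter_upwards [Ico_mem_nhdsLT hlt] with t ht
    exact (hu ⟨ht.1, ht.2.trans_le (mesh_mem_Icc k j.2).2⟩).symm
  -- The left limit for block p is the right end of the preceding piece. For block 0 this is the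
  -- piece k - 1, which ends at 0, in agreement with the cyclic shift in `cycleBlocks`.
  have hend : (if p.1.val = 0 then 0 else mesh k p.1) =
      mesh k ((residue k ((p.1 : ℤ) - 1) : ℕ) + 1) := by
    split_ifs with h0
    · have : residue k ((p.1 : ℤ) - 1) = residue k ((k - 1 : ℕ) : ℤ) := by
        rw [h0, ← residue_add_self]
        congr 1
        have := NeZero.pos k
        omega
      rw [this, residue_natCast (by have := NeZero.pos k; omega)]
      have h1 : (k - 1) + 1 = k := Nat.sub_add_cancel (NeZero.pos k)
      simp only [h1, mesh_self]
    · have h1 : (p.1 : ℤ) - 1 = ((p.1 - 1 : ℕ) : ℤ) := by omega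
      rw [h1, residue_natCast (by omega)]
      simp only
      congr 1
      omega
  rw [LinearMap.toMatrix'_apply, charMatrix, Matrix.of_apply, ← hv, hend, hlim]
  have e : (S.charOp k μ z).toLinearMap v = v - cycleBlocks k n (Pieces.endpoint k n (S.mivpFlow k μ z v)) := rfl
  rw [e, hflow]
  rfl

theorem charFun_eq_det (S : PeriodicDDE n) {μ z : ℂ} (h : IsUnit (1 - S.mivpOp k μ z)) :
    S.charFun k μ z = (LinearMap.toMatrix' (S.charOp k μ z).toLinearMap).det := by
  rw [charFun, charMatrix_eq S h]

/-! ### Smoothness of the characteristic function -/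

theorem contDiff_one_sub_mivpOp (S : PeriodicDDE n) {m : WithTop ℕ∞} :
    ContDiff ℂ m fun p : ℂ × ℂ => 1 - S.mivpOp k p.1 p.2 :=
  contDiff_const.sub ((contDiff_const.sub (contDiff_fst.smul contDiff_const)).add
    (contDiff_snd.smul contDiff_const))

/-- Inversion is analytic at invertible operators, `mivpOp` is affine in (μ,z), and the remaining
factors are constant. -/
theorem contDiffAt_charOp (S : PeriodicDDE n) {m : WithTop ℕ∞} {p : ℂ × ℂ}
    (h : IsUnit (1 - S.mivpOp k p.1 p.2)) :
    ContDiffAt ℂ m (fun p : ℂ × ℂ => S.charOp k p.1 p.2) p := by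
  have h1 : ContDiffAt ℂ m (fun p : ℂ × ℂ => Ring.inverse (1 - S.mivpOp k p.1 p.2)) p := by
    obtain ⟨x, hx⟩ := h
    have h2 := contDiffAt_ringInverse ℂ (n := m) x
    rw [hx] at h2
    exact h2.comp p S.contDiff_one_sub_mivpOp.contDiffAt
  exact contDiffAt_const.sub (contDiffAt_const.clm_comp
    (contDiffAt_const.clm_comp (h1.clm_comp contDiffAt_const)))

/-- The region in which the characteristic function is well defined. -/
def admissible (R : ℝ) : Set (ℂ × ℂ) := {p | -R < p.1.re ∧ ‖p.2‖ < Real.exp R}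

theorem isOpen_admissible (R : ℝ) : IsOpen (admissible R) :=
  (isOpen_lt continuous_const (Complex.continuous_re.comp continuous_fst)).inter
    (isOpen_lt continuous_snd.norm continuous_const)

theorem isUnit_of_mem_admissible (S : PeriodicDDE n) {R : ℝ} (hR : 0 ≤ R)
    (hk : S.charBound R < k) {p : ℂ × ℂ} (hp : p ∈ admissible R) :
    IsUnit (1 - S.mivpOp k p.1 p.2) :=
  S.isUnit_one_sub_mivpOp hR hk hp.1.le hp.2.le

theorem contDiffAt_matrix_det {ι E : Type*} [Fintype ι] [DecidableEq ι] [NormedAddCommGroup E]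
    [NormedSpace ℂ E] {m : WithTop ℕ∞} {D : E → Matrix ι ι ℂ} {x : E}
    (hD : ∀ i j, ContDiffAt ℂ m (fun s => D s i j) x) :
    ContDiffAt ℂ m (fun s => (D s).det) x := by
  simp only [Matrix.det_apply, Units.smul_def, zsmul_eq_mul]
  exact ContDiffAt.sum fun σ _ => contDiffAt_const.mul (contDiffAt_prod fun i _ => hD _ _)

theorem contDiffAt_charFun (S : PeriodicDDE n) {R : ℝ} (hR : 0 ≤ R) (hk : S.charBound R < k)
    {m : WithTop ℕ∞} {p : ℂ × ℂ} (hp : p ∈ admissible R) :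
    ContDiffAt ℂ m (fun p : ℂ × ℂ => S.charFun k p.1 p.2) p := by
  have h : (fun p : ℂ × ℂ => (LinearMap.toMatrix' (S.charOp k p.1 p.2).toLinearMap).det) =ᶠ[𝓝 p]
      fun p => S.charFun k p.1 p.2 := by
    filter_upwards [(isOpen_admissible R).mem_nhds hp] with q hq
    rw [S.charFun_eq_det (S.isUnit_of_mem_admissible hR hk hq)]
  refine ContDiffAt.congr_of_eventuallyEq ?_ h.symm
  refine contDiffAt_matrix_det fun i j => ?_
  have h1 : ContDiffAt ℂ m (fun p : ℂ × ℂ => S.charOp k p.1 p.2 (Pi.single j 1)) p :=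
    (S.contDiffAt_charOp (S.isUnit_of_mem_admissible hR hk hp)).clm_apply contDiffAt_const
  simp only [LinearMap.toMatrix'_apply]
  exact contDiffAt_pi.1 h1 i

/-! ### Zeros of determinants -/

section Det

variable {ι : Type*} [Fintype ι] [DecidableEq ι]

theorem differentiableAt_adjugate {D : ℂ → Matrix ι ι ℂ} {s : ℂ}
    (hD : ∀ i j, DifferentiableAt ℂ (fun s => D s i j) s) (i j : ι) :
    DifferentiableAt ℂ (fun s => (D s).adjugate i j) s := by
  simp only [Matrix.adjugate_apply, Matrix.det_apply, Units.smul_def, zsmul_eq_mul]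
  refine DifferentiableAt.fun_sum fun σ _ => (differentiableAt_const _).mul ?_
  refine DifferentiableAt.fun_finsetProd fun l _ => ?_
  simp only [Matrix.updateRow_apply]
  split_ifs
  · exact differentiableAt_const _
  · exact hD _ _

/-- The determinant of a matrix function has a multiple zero if the derivative maps a vector of the
kernel into the kernel of the adjugate matrix. -/
theorem deriv_det_eq_zero {D : ℂ → Matrix ι ι ℂ} {D' : Matrix ι ι ℂ} {s : ℂ}
    (hD : ∀ i j, HasDerivAt (fun s => D s i j) (D' i j) s) {v : ι → ℂ} (hv : v ≠ 0)
    (h0 : D s *ᵥ v = 0) (h1 : (D s).adjugate *ᵥ (D' *ᵥ v) = 0) :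
    deriv (fun s => (D s).det) s = 0 := by
  obtain ⟨i, hi⟩ := Function.ne_iff.1 hv
  have hw : ∀ j, HasDerivAt (fun t => (D t *ᵥ v) j) ((D' *ᵥ v) j) s := fun j => by
    simp only [Matrix.mulVec, dotProduct]
    exact HasDerivAt.fun_sum fun l _ => (hD j l).mul_const _
  have ha := fun j => (differentiableAt_adjugate (fun i j => (hD i j).differentiableAt) i j).hasDerivAt
  -- The identity adj(D) D v = det(D) v is differentiated in a component with v i ≠ 0. One term of
  -- the product rule vanishes because D v = 0 at s, the other by the hypothesis on adj(D) D' v.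
  have hs : HasDerivAt (fun t => ∑ j, (D t).adjugate i j * (D t *ᵥ v) j)
      (∑ j, (deriv (fun t => (D t).adjugate i j) s * (D s *ᵥ v) j +
        (D s).adjugate i j * (D' *ᵥ v) j)) s :=
    HasDerivAt.fun_sum fun j _ => (ha j).mul (hw j)
  have e1 : (fun t => ∑ j, (D t).adjugate i j * (D t *ᵥ v) j) = fun t => (D t).det * v i := by
    ext t
    have : ((D t).adjugate *ᵥ (D t *ᵥ v)) i = (D t).det * v i := by
      rw [Matrix.mulVec_mulVec, Matrix.adjugate_mul, Matrix.smul_mulVec, Matrix.one_mulVec]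
      rfl
    exact this
  have e2 : ∑ j, (deriv (fun t => (D t).adjugate i j) s * (D s *ᵥ v) j +
        (D s).adjugate i j * (D' *ᵥ v) j) = 0 := by
    have := congr_fun h1 i
    rw [Matrix.mulVec, dotProduct] at this
    simpa [h0] using this
  rw [e1, e2] at hs
  have hdet : DifferentiableAt ℂ (fun t => (D t).det) s := by
    have h := hs.differentiableAt.mul_const (v i)⁻¹
    refine h.congr_of_eventuallyEq (.of_forall fun t => ?_)
    simp only
    rw [mul_assoc, mul_inv_cancel₀ hi, mul_one]
  have h3 := (hdet.hasDerivAt.mul_const (v i)).unique hs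
  exact (mul_eq_zero.1 h3).resolve_right hi

/-- A kernel of dimension at least two contains, for each i, a nonzero vector whose i-th entry is 0.
It remains in the kernel after row j is replaced by the i-th unit row, so every cofactor vanishes.
-/
theorem adjugate_eq_zero {D : Matrix ι ι ℂ} {v w : ι → ℂ} (hv : D *ᵥ v = 0) (hv0 : v ≠ 0)
    (hw : D *ᵥ w = 0) (hvw : ∀ c : ℂ, w ≠ c • v) : D.adjugate = 0 := by
  ext i j
  rw [Matrix.adjugate_apply, Matrix.zero_apply]
  obtain ⟨x, hx0, hx, hxi⟩ : ∃ x, x ≠ 0 ∧ D *ᵥ x = 0 ∧ x i = 0 := by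
    by_cases hvi : v i = 0
    · exact ⟨v, hv0, hv, hvi⟩
    · refine ⟨w - (w i / v i) • v, sub_ne_zero.2 (hvw _), ?_, ?_⟩
      · rw [Matrix.mulVec_sub, Matrix.mulVec_smul, hv, hw, smul_zero, sub_zero]
      · simp [hvi]
  refine Matrix.exists_mulVec_eq_zero_iff.1 ⟨x, hx0, ?_⟩
  ext l
  by_cases hl : l = j
  · subst hl
    simp [Matrix.mulVec, hxi]
  · have := congr_fun hx l
    simpa [Matrix.mulVec, Matrix.updateRow_ne hl] using this

end Det

/-! ### Floquet exponents and the characteristic matrix -/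

theorem one_le_delay (S : PeriodicDDE n) {N : ℕ} (hN : 1 ≤ N) : 1 ≤ S.delay N := by
  have : (1 : ℝ) ≤ N := by exact_mod_cast hN
  linarith [S.τ_mem.1, show S.delay N = N + S.τ from rfl]

theorem Ac_add_one (S : PeriodicDDE n) (t : ℝ) : S.Ac (t + 1) = S.Ac t := by
  rw [Ac, Ac, S.periodic_A t]

theorem Bc_add_one (S : PeriodicDDE n) (t : ℝ) : S.Bc (t + 1) = S.Bc t := by
  rw [Bc, Bc, S.periodic_B t]

/-- This is where the integer part of the delay disappears from the periodic problem. -/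
theorem glue_sub_delay (S : PeriodicDDE n) (N : ℕ) (u : Pieces k n) (t : ℝ) :
    glue u (t - S.delay N) = glue u (t - S.τ) := by
  have := (glue_periodic u).sub_nat_mul_eq (x := t - S.τ) N
  rw [← this, delay]
  congr 1
  ring

/-- A function on `[-r,1]` with `y(t+1) = y(t)` for `t ∈ [-r,0]`, cut into pieces. -/
theorem exists_pieces_of_periodic {r : ℝ} (hr : 1 ≤ r) {y : ℝ → Fin n → ℂ}
    (hc : ContinuousOn y (Icc (-r) 1)) (hper : ∀ t ∈ Icc (-r) 0, y (t + 1) = y t) :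
    ∃ u : Pieces k n, (∀ t ∈ Icc (-r) 1, glue u t = y t) ∧
      (∀ (j : Fin k) (t : Icc (0 : ℝ) 1), block j (u t) = y (mesh k j + t / k)) ∧
      cycleBlocks k n (Pieces.endpoint k n u) = u ⟨0, left_mem_Icc.2 zero_le_one⟩ := by
  have hk : (k : ℝ) ≠ 0 := NeZero.ne _
  have hcont : Continuous fun (t : Icc (0 : ℝ) 1) (p : Fin k × Fin n) =>
      y (mesh k p.1 + t / k) p.2 := by
    refine continuous_pi fun p => (continuous_apply p.2).comp ?_
    refine hc.comp_continuous (by fun_prop) fun t => ?_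
    have := mesh_add_mem p.1 t.2
    exact ⟨by linarith [this.1], by linarith [this.2]⟩
  set u : Pieces k n := Pieces.mk _ hcont with hu
  have h1 : ∀ t ∈ Ico (-1 : ℝ) 0, glue u t = y t := fun t ht => by
    obtain ⟨j, s, hs, rfl⟩ := exists_mesh_add (k := k) ht
    rw [glue_mesh_add u j hs, IccExtend_of_mem zero_le_one u ⟨hs.1, hs.2.le⟩]
    rfl
  -- Agreement is propagated to the left one period at a time, starting from [-1,0).
  have h2 : ∀ m : ℕ, ∀ t ∈ Icc (-r) 0, -(m : ℝ) - 1 ≤ t → t < -m → glue u t = y t := by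
    intro m
    induction m with
    | zero =>
      intro t _ h3 h4
      exact h1 t ⟨by simpa using h3, by simpa using h4⟩
    | succ m ih =>
      intro t ht h3 h4
      push_cast at h3 h4
      rw [← hper t ht, ← glue_periodic u t]
      refine ih (t + 1) ⟨by linarith [ht.1], ?_⟩ (by linarith) (by linarith)
      have : (0 : ℝ) ≤ m := m.cast_nonneg
      linarith
  have h3 : ∀ t ∈ Ico (-r) 0, glue u t = y t := by
    intro t ht
    have h0 : 0 ≤ -t := by linarith [ht.2]
    rcases eq_or_lt_of_le (Nat.floor_le h0) with h | h
    -- If -t is an integer, t is the left end of its half-open period [-(m+1), -m), so m = -t - 1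
    -- rather than the floor of -t.
    · have hm : 1 ≤ ⌊-t⌋₊ := by
        by_contra hlt
        have : ⌊-t⌋₊ = 0 := by omega
        rw [this] at h
        simp at h
        linarith [ht.2]
      have hcast : (((⌊-t⌋₊ - 1 : ℕ) : ℝ)) = -t - 1 := by
        rw [Nat.cast_sub hm, h]
        simp
      refine h2 (⌊-t⌋₊ - 1) t ⟨ht.1, ht.2.le⟩ ?_ ?_ <;> rw [hcast] <;> linarith
    · exact h2 ⌊-t⌋₊ t ⟨ht.1, ht.2.le⟩ (by linarith [Nat.lt_floor_add_one (-t)]) (by linarith)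
  have h4 : ∀ t ∈ Ico (-r) 1, glue u t = y t := by
    intro t ht
    rcases lt_or_ge t 0 with h | h
    · exact h3 t ⟨ht.1, h⟩
    · have e : t - 1 + 1 = t := by ring
      have := hper (t - 1) ⟨by linarith, by linarith [ht.2]⟩
      rw [← e, this, glue_periodic u]
      exact h3 _ ⟨by linarith, by linarith [ht.2]⟩
  refine ⟨u, fun t ht => ?_, fun _ _ => rfl, ?_⟩
  · rcases lt_or_eq_of_le ht.2 with h | rfl
    · exact h4 t ⟨ht.1, h⟩
    · have h5 := hper 0 ⟨by linarith, le_rfl⟩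
      have h6 := glue_periodic u 0
      rw [zero_add] at h5 h6
      rw [h5, h6]
      exact h4 0 ⟨by linarith, one_pos⟩
  · ext ⟨j, a⟩
    have e1 : cycleBlocks k n (Pieces.endpoint k n u) (j, a) =
        y (mesh k (residue k ((j : ℤ) - 1)) + 1 / k) a := rfl
    have e2 : u ⟨0, left_mem_Icc.2 zero_le_one⟩ (j, a) = y (mesh k j + 0 / k) a := rfl
    rw [e1, e2, zero_div, add_zero, ← mesh_succ]
    rcases Nat.eq_zero_or_pos (j : ℕ) with h0 | h0
    · have : residue k ((j : ℤ) - 1) = residue k ((k - 1 : ℕ) : ℤ) := by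
        rw [h0, ← residue_add_self]
        congr 1
        have := NeZero.pos k
        omega
      rw [this, residue_natCast (by have := NeZero.pos k; omega)]
      have h1 : (k - 1) + 1 = k := Nat.sub_add_cancel (NeZero.pos k)
      simp only [h1, mesh_self, h0, mesh_zero]
      have := hper (-1) ⟨by linarith, by norm_num⟩
      rw [← this]
      norm_num
    · have h1 : (j : ℤ) - 1 = ((j - 1 : ℕ) : ℤ) := by omega
      rw [h1, residue_natCast (by omega)]
      simp only
      have h2 : (j - 1 : ℕ) + 1 = (j : ℕ) := by omega
      rw [h2]

/-- Integration of the derivative over a subinterval of the mesh, shifted by one period. -/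
theorem eq_add_integral_of_hasDerivWithinAt {r : ℝ} (hr : 1 ≤ r) {y G F : ℝ → Fin n → ℂ}
    (hc : ContinuousOn y (Icc (-r) 1)) (hper : ∀ t ∈ Icc (-r) 0, y (t + 1) = y t)
    (hd : ∀ t ∈ Icc (0 : ℝ) 1, HasDerivWithinAt y (G t) (Icc 0 1) t)
    (hF : ∀ t ∈ Icc (-1 : ℝ) 0, G (t + 1) = F t)
    (hFi : ∀ a b, IntervalIntegrable F MeasureTheory.volume a b) {a b : ℝ}
    (ha : -1 ≤ a) (hab : a ≤ b) (hb : b ≤ 0) : y b = y a + ∫ x in a..b, F x := by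
  rw [← hper a ⟨by linarith, by linarith⟩, ← hper b ⟨by linarith, by linarith⟩,
    ← sub_eq_iff_eq_add']
  symm
  have hint := intervalIntegral.integral_eq_sub_of_hasDerivAt_of_le (f := fun t => y (t + 1))
    (f' := F) hab ?_ (fun t ht => ?_) (hFi a b)
  · exact hint
  · exact hc.comp (f := fun t : ℝ => t + 1) (continuous_add_const 1).continuousOn
      fun t ht => ⟨by linarith [ht.1], by linarith [ht.2]⟩
  · have h1 : t + 1 ∈ Ioo (0 : ℝ) 1 := ⟨by linarith [ht.1], by linarith [ht.2]⟩
    have h2 := (hd (t + 1) ⟨h1.1.le, h1.2.le⟩).hasDerivAt (Icc_mem_nhds h1.1 h1.2)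
    rw [hF t ⟨by linarith [ht.1], by linarith [ht.2]⟩] at h2
    exact h2.comp_add_const t 1

/-- The values of `exp(-μt) φ(t)` at the mesh points. -/
def meshValues (S : PeriodicDDE n) (N k : ℕ) (μ : ℂ) (φ : State n (S.delay N)) :
    Fin k × Fin n → ℂ :=
  fun p => Complex.exp (-(μ * mesh k p.1)) *
    IccExtend (neg_nonpos.2 (S.delay_nonneg N)) φ (mesh k p.1) p.2

theorem meshValues_smul (S : PeriodicDDE n) (N k : ℕ) (μ c : ℂ) (φ : State n (S.delay N)) :
    S.meshValues N k μ (c • φ) = c • S.meshValues N k μ φ := by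
  ext p
  change _ * (c * _) = c * (_ * _)
  simp only [IccExtend, Function.comp]
  ring

/-- The solution with a given history, in the coordinates that remove the factor `exp(μt)`. -/
def scaledSol (S : PeriodicDDE n) (N : ℕ) (μ : ℂ) (φ : State n (S.delay N)) (t : ℝ) :
    Fin n → ℂ :=
  Complex.exp (-(μ * t)) • S.sol N φ t

theorem continuousOn_scaledSol (S : PeriodicDDE n) (N : ℕ) (μ : ℂ) (φ : State n (S.delay N)) :
    ContinuousOn (S.scaledSol N μ φ) (Icc (-S.delay N) 1) :=
  have h : Continuous fun t : ℝ => Complex.exp (-(μ * t)) := by fun_prop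
  h.continuousOn.smul (S.sol_spec N φ).1

/-- Removing e^{μt} contributes -μ through the product rule, and the mismatch of the exponential at
t and at t - (N+τ) is the factor z = e^{-(N+τ)μ}. -/
theorem hasDerivWithinAt_scaledSol (S : PeriodicDDE n) (N : ℕ) (μ : ℂ)
    (φ : State n (S.delay N)) {t : ℝ} (ht : t ∈ Icc (0 : ℝ) 1) :
    HasDerivWithinAt (S.scaledSol N μ φ)
      ((S.Ac t *ᵥ S.scaledSol N μ φ t - μ • S.scaledSol N μ φ t) +
        Complex.exp (-(μ * S.delay N)) • (S.Bc t *ᵥ S.scaledSol N μ φ (t - S.delay N)))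
      (Icc 0 1) t := by
  have h1 : HasDerivAt (fun t : ℝ => Complex.exp (-(μ * t))) (-μ * Complex.exp (-(μ * t))) t := by
    have h := ((Complex.ofRealCLM.hasDerivAt (x := t)).const_mul μ).neg.cexp
    simpa [mul_comm] using h
  refine (h1.hasDerivWithinAt.smul ((S.sol_spec N φ).2.2 t ht)).congr_deriv ?_
  have e : Complex.exp (-(μ * S.delay N)) * Complex.exp (-(μ * ((t - S.delay N : ℝ) : ℂ))) =
      Complex.exp (-(μ * t)) := by
    rw [← Complex.exp_add]
    congr 1
    push_cast
    ring
  simp only [scaledSol, Matrix.mulVec_smul, smul_smul, e]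
  module

theorem sol_add_one (S : PeriodicDDE n) (N : ℕ) {φ : State n (S.delay N)} {t : ℝ}
    (ht : t ∈ Icc (-S.delay N) 0) : S.sol N φ (t + 1) = S.timeOneMap N φ ⟨t, ht⟩ := rfl

theorem sol_eq (S : PeriodicDDE n) (N : ℕ) {φ : State n (S.delay N)} {t : ℝ}
    (ht : t ∈ Icc (-S.delay N) 0) : S.sol N φ t = φ ⟨t, ht⟩ :=
  (S.sol_spec N φ).2.1 ⟨t, ht⟩

theorem scaledSol_add_one (S : PeriodicDDE n) {N : ℕ} {μ : ℂ} {φ : State n (S.delay N)}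
    (h : S.timeOneMap N φ = Complex.exp μ • φ) {t : ℝ} (ht : t ∈ Icc (-S.delay N) 0) :
    S.scaledSol N μ φ (t + 1) = S.scaledSol N μ φ t := by
  rw [scaledSol, scaledSol, S.sol_add_one N ht, S.sol_eq N ht, h]
  change _ • (Complex.exp μ • φ ⟨t, ht⟩) = _
  rw [smul_smul, ← Complex.exp_add]
  congr 2
  push_cast
  ring

/-- An eigenvector of the time-1 map gives a solution of the operator equation. -/
theorem exists_pieces_of_eigenvector (S : PeriodicDDE n) {N : ℕ} (hN : 1 ≤ N) {μ : ℂ}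
    {φ : State n (S.delay N)} (h : S.timeOneMap N φ = Complex.exp μ • φ) :
    ∃ u : Pieces k n, (∀ t ∈ Icc (-S.delay N) 1, glue u t = S.scaledSol N μ φ t) ∧
      (1 - S.mivpOp k μ (Complex.exp (-(μ * S.delay N)))) u =
        constPieces k n (S.meshValues N k μ φ) ∧
      cycleBlocks k n (Pieces.endpoint k n u) = S.meshValues N k μ φ := by
  have hr := S.one_le_delay hN
  have hper := fun t ht => S.scaledSol_add_one h (t := t) ht
  obtain ⟨u, hu1, hu2, hu3⟩ := exists_pieces_of_periodic (k := k) hr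
    (S.continuousOn_scaledSol N μ φ) hper
  have hu0 : u ⟨0, left_mem_Icc.2 zero_le_one⟩ = S.meshValues N k μ φ := by
    ext ⟨j, a⟩
    have h1 := congr_fun (hu2 j ⟨0, left_mem_Icc.2 zero_le_one⟩) a
    have hm := mesh_mem_Icc k j.2.le
    have hm' : mesh k j ∈ Icc (-S.delay N) 0 := ⟨by linarith [hm.1], hm.2⟩
    simp only [zero_div, add_zero] at h1
    refine h1.trans ?_
    rw [scaledSol, S.sol_eq N hm', meshValues, IccExtend_of_mem _ _ hm']
    rfl
  refine ⟨u, hu1, (one_sub_mivpOp_apply_eq_iff S _ _ _ _).2 fun j t => ?_, hu3.trans hu0⟩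
  have hm := mesh_add_mem j t.2
  have hm0 := mesh_mem_Icc k j.2.le
  have hle : mesh k j ≤ mesh k j + t / k :=
    le_add_of_nonneg_right (div_nonneg t.2.1 (Nat.cast_nonneg k))
  rw [hu2 j t, ← hu0, hu2, eq_add_integral_of_hasDerivWithinAt hr (S.continuousOn_scaledSol N μ φ)
    hper (fun t ht => S.hasDerivWithinAt_scaledSol N μ φ ht) (fun x hx => ?_)
    (S.intervalIntegrable_perRhs_glue μ (Complex.exp (-(μ * S.delay N))) u) hm0.1 hle hm.2]
  · simp
  · rw [Ac_add_one, Bc_add_one, ← hu1 _ ⟨by linarith [hx.1], by linarith [hx.2]⟩,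
      ← hu1 _ ⟨by linarith [hx.1], by linarith [hx.2]⟩, glue_periodic u, add_sub_right_comm,
      glue_periodic u, S.glue_sub_delay, perRhs]

theorem charOp_meshValues (S : PeriodicDDE n) {N : ℕ} (hN : 1 ≤ N) {μ : ℂ}
    (hU : IsUnit (1 - S.mivpOp k μ (Complex.exp (-(μ * S.delay N)))))
    {φ : State n (S.delay N)} (h : S.timeOneMap N φ = Complex.exp μ • φ) :
    S.charOp k μ (Complex.exp (-(μ * S.delay N))) (S.meshValues N k μ φ) = 0 := by
  obtain ⟨u, -, hu1, hu2⟩ := S.exists_pieces_of_eigenvector (k := k) hN h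
  have e := (S.mivpFlow_eq_iff hU _ _).2 hu1
  have e1 : S.charOp k μ (Complex.exp (-(μ * S.delay N))) (S.meshValues N k μ φ) =
    S.meshValues N k μ φ - cycleBlocks k n (Pieces.endpoint k n
      (S.mivpFlow k μ (Complex.exp (-(μ * S.delay N))) (S.meshValues N k μ φ))) := rfl
  rw [e1, e, hu2, sub_self]

/-- Passing from eigenfunctions to kernel vectors loses nothing: the mesh values determine the
pieces, and their periodic extension determines the whole history. -/
theorem eq_zero_of_meshValues_eq_zero (S : PeriodicDDE n) {N : ℕ} (hN : 1 ≤ N) {μ : ℂ}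
    (hU : IsUnit (1 - S.mivpOp k μ (Complex.exp (-(μ * S.delay N)))))
    {φ : State n (S.delay N)} (h : S.timeOneMap N φ = Complex.exp μ • φ)
    (h0 : S.meshValues N k μ φ = 0) : φ = 0 := by
  obtain ⟨u, hu, hu1, -⟩ := S.exists_pieces_of_eigenvector (k := k) hN h
  have e := (S.mivpFlow_eq_iff hU _ _).2 hu1
  rw [h0, map_zero] at e
  ext1 t
  have h1 := hu t ⟨t.2.1, by linarith [t.2.2]⟩
  rw [← e, scaledSol, S.sol_eq N t.2] at h1
  have h2 : glue (0 : Pieces k n) t = 0 := rfl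
  rw [h2] at h1
  exact (smul_eq_zero.1 h1.symm).resolve_left (Complex.exp_ne_zero _)

/-! ### Derivatives along the exponential curve and Jordan chains -/

/-- The derivative of the operator of the multiple initial value problem along the curve
`z = exp(-(N+τ)μ)`. -/
def mivpOpDeriv (S : PeriodicDDE n) (N k : ℕ) [NeZero k] (μ : ℂ) :
    Pieces k n →L[ℂ] Pieces k n :=
  -pieceIntegral (continuous_const (y := 1)) 0 -
    (S.delay N * Complex.exp (-(μ * S.delay N))) • pieceIntegral S.continuous_Bc S.τ

theorem hasDerivAt_mivpOp (S : PeriodicDDE n) (N : ℕ) (μ : ℂ) :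
    HasDerivAt (fun s => S.mivpOp k s (Complex.exp (-(s * S.delay N))))
      (S.mivpOpDeriv N k μ) μ := by
  have h1 : HasDerivAt (fun s : ℂ => Complex.exp (-(s * S.delay N)))
      (-(S.delay N * Complex.exp (-(μ * S.delay N)))) μ := by
    have h := ((hasDerivAt_id μ).mul_const (S.delay N : ℂ)).neg.cexp
    simpa [mul_comm] using h
  refine (((hasDerivAt_const μ (pieceIntegral S.continuous_Ac 0 : Pieces k n →L[ℂ] Pieces k n)).sub
    ((hasDerivAt_id μ).smul_const (pieceIntegral (continuous_const (y := 1)) 0))).add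
    (h1.smul_const (pieceIntegral S.continuous_Bc S.τ))).congr_deriv ?_
  rw [mivpOpDeriv]
  module

/-- The derivative of the characteristic matrix along the curve `z = exp(-(N+τ)μ)`. -/
def charOpDeriv (S : PeriodicDDE n) (N k : ℕ) [NeZero k] (μ : ℂ) :
    (Fin k × Fin n → ℂ) →L[ℂ] (Fin k × Fin n → ℂ) :=
  -(cycleBlocks k n ∘L Pieces.endpoint k n ∘L
    Ring.inverse (1 - S.mivpOp k μ (Complex.exp (-(μ * S.delay N)))) ∘L S.mivpOpDeriv N k μ ∘L
      S.mivpFlow k μ (Complex.exp (-(μ * S.delay N))))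

theorem charOpDeriv_apply (S : PeriodicDDE n) (N : ℕ) (μ : ℂ) (v : Fin k × Fin n → ℂ) :
    S.charOpDeriv N k μ v = -cycleBlocks k n (Pieces.endpoint k n
      (Ring.inverse (1 - S.mivpOp k μ (Complex.exp (-(μ * S.delay N))))
        (S.mivpOpDeriv N k μ (S.mivpFlow k μ (Complex.exp (-(μ * S.delay N))) v)))) := rfl

/-- With X = 1 - `mivpOp`, the rule (X⁻¹)' = -X⁻¹X'X⁻¹ and X' = -`mivpOpDeriv` give two signs that
cancel; the remaining sign is the one in front of `cycleBlocks` in `charOp`. -/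
theorem hasDerivAt_charOp (S : PeriodicDDE n) (N : ℕ) {μ : ℂ}
    (hU : IsUnit (1 - S.mivpOp k μ (Complex.exp (-(μ * S.delay N))))) (v : Fin k × Fin n → ℂ) :
    HasDerivAt (fun s => S.charOp k s (Complex.exp (-(s * S.delay N))) v)
      (S.charOpDeriv N k μ v) μ := by
  obtain ⟨x, hx⟩ := hU
  have h1 : HasDerivAt (fun s => 1 - S.mivpOp k s (Complex.exp (-(s * S.delay N))))
      (-S.mivpOpDeriv N k μ) μ := (S.hasDerivAt_mivpOp N μ).const_sub _
  have h2 := hasFDerivAt_ringInverse (𝕜 := ℂ) x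
  rw [hx] at h2
  have h3 := h2.comp_hasDerivAt μ h1
  have h4 := ((cycleBlocks k n ∘L Pieces.endpoint k n).hasFDerivAt.comp_hasDerivAt μ
    (h3.clm_apply (hasDerivAt_const μ (constPieces k n v)))).const_sub v
  refine h4.congr_deriv ?_
  have e : (↑x⁻¹ : Pieces k n →L[ℂ] Pieces k n) =
      Ring.inverse (1 - S.mivpOp k μ (Complex.exp (-(μ * S.delay N)))) := by
    rw [← hx, Ring.inverse_unit]
  simp [e, mivpFlow, charOpDeriv]

/-- A generalized eigenvector of the time-1 map gives a solution of the differentiated operator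
equation. -/
theorem exists_pieces_of_chain (S : PeriodicDDE n) {N : ℕ} (hN : 1 ≤ N) {μ : ℂ}
    {φ ψ : State n (S.delay N)} (h : S.timeOneMap N φ = Complex.exp μ • φ)
    (h' : S.timeOneMap N ψ = Complex.exp μ • (ψ + φ)) :
    ∃ (u₀ u₁ : Pieces k n) (v : Fin k × Fin n → ℂ),
      (1 - S.mivpOp k μ (Complex.exp (-(μ * S.delay N)))) u₀ =
        constPieces k n (S.meshValues N k μ φ) ∧
      (1 - S.mivpOp k μ (Complex.exp (-(μ * S.delay N)))) u₁ =
        constPieces k n v + S.mivpOpDeriv N k μ u₀ ∧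
      cycleBlocks k n (Pieces.endpoint k n u₁) = v := by
  have hr := S.one_le_delay hN
  set z := Complex.exp (-(μ * S.delay N)) with hz
  obtain ⟨u₀, hu₀, hu₀', -⟩ := S.exists_pieces_of_eigenvector (k := k) hN h
  -- Over one period the scaled solution of ψ increases by exactly that of φ, thanks to the
  -- normalisation M ψ = e^μ(ψ + φ). Subtracting t times the latter restores periodicity.
  set y : ℝ → Fin n → ℂ := fun t => S.scaledSol N μ ψ t - (t : ℂ) • S.scaledSol N μ φ t with hy
  have hc : ContinuousOn y (Icc (-S.delay N) 1) :=
    (S.continuousOn_scaledSol N μ ψ).sub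
      (Complex.continuous_ofReal.continuousOn.smul (S.continuousOn_scaledSol N μ φ))
  have hper : ∀ t ∈ Icc (-S.delay N) 0, y (t + 1) = y t := by
    intro t ht
    have e : S.scaledSol N μ ψ (t + 1) = S.scaledSol N μ ψ t + S.scaledSol N μ φ t := by
      simp only [scaledSol]
      rw [S.sol_add_one N ht, S.sol_eq N ht, S.sol_eq N ht, h', ← smul_add]
      change _ • (Complex.exp μ • (ψ ⟨t, ht⟩ + φ ⟨t, ht⟩)) = _
      rw [smul_smul, ← Complex.exp_add]
      congr 2
      push_cast
      ring
    rw [hy]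
    simp only [e, S.scaledSol_add_one h ht]
    push_cast
    module
  obtain ⟨u₁, hu₁, hu₁', hu₁''⟩ := exists_pieces_of_periodic (k := k) hr hc hper
  set w := pieceIntegral (continuous_const (y := (1 : Matrix (Fin n) (Fin n) ℂ))) 0 u₀
  refine ⟨u₀, u₁, _, hu₀', ?_, hu₁''⟩
  rw [sub_apply, one_apply_eq_self, sub_eq_iff_eq_add]
  -- The two extra terms come from the factor t: its derivative gives the undelayed one, and the
  -- difference between t and t - (N+τ) in the delayed term gives the other. Integrated, they are
  -- `mivpOpDeriv` applied to u₀.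
  set F : ℝ → Fin n → ℂ := fun x => S.perRhs μ z (glue u₁) x -
    (1 : Matrix (Fin n) (Fin n) ℂ) *ᵥ glue u₀ (x - 0) -
    (S.delay N * z) • (S.Bc x *ᵥ glue u₀ (x - S.τ)) with hF
  have i1 := S.intervalIntegrable_perRhs_glue μ z u₁
  have i2 := intervalIntegrable_mulVec_glue
    (continuous_const (y := (1 : Matrix (Fin n) (Fin n) ℂ))) u₀ 0
  have i3 := fun a b => (intervalIntegrable_mulVec_glue S.continuous_Bc u₀ S.τ a b).smul
    (S.delay N * z)
  have hd : ∀ t ∈ Icc (0 : ℝ) 1, HasDerivWithinAt y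
      ((S.Ac t *ᵥ y t - μ • y t + z • (S.Bc t *ᵥ y (t - S.delay N))) - S.scaledSol N μ φ t -
        (S.delay N * z) • (S.Bc t *ᵥ S.scaledSol N μ φ (t - S.delay N))) (Icc 0 1) t := by
    intro t ht
    have h1 := (Complex.ofRealCLM.hasDerivAt (x := t)).hasDerivWithinAt (s := Icc 0 1)
    refine ((S.hasDerivWithinAt_scaledSol N μ ψ ht).sub
      (h1.smul (S.hasDerivWithinAt_scaledSol N μ φ ht))).congr_deriv ?_
    simp only [hy, Matrix.mulVec_sub, Matrix.mulVec_smul, Complex.ofRealCLM_apply,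
      Complex.ofReal_one, Complex.ofReal_sub, ← hz]
    module
  refine Pieces.ext fun t => ?_
  ext ⟨j, a⟩
  refine congr_fun (?_ : block j (u₁ t) = block j _) a
  have hm := mesh_add_mem j t.2
  have hm0 := mesh_mem_Icc k j.2.le
  have hle : mesh k j ≤ mesh k j + t / k :=
    le_add_of_nonneg_right (div_nonneg t.2.1 (Nat.cast_nonneg k))
  have hint := eq_add_integral_of_hasDerivWithinAt (F := F) hr hc hper hd (fun x hx => ?_)
    (fun a b => ((i1 a b).sub (i2 a b)).sub (i3 a b)) hm0.1 hle hm.2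
  · have e1 := intervalIntegral.integral_sub ((i1 (mesh k j) (mesh k j + t / k)).sub (i2 _ _))
      (i3 _ _)
    have e2 := intervalIntegral.integral_sub (i1 (mesh k j) (mesh k j + t / k)) (i2 _ _)
    simp only [Pi.smul_apply] at e1
    have e0 : ∫ x in mesh k j..mesh k j + t / k, F x = _ := e1
    rw [e0, e2, intervalIntegral.integral_smul, ← block_mivpOp,
      ← block_pieceIntegral (continuous_const (y := (1 : Matrix (Fin n) (Fin n) ℂ))) 0,
      ← block_pieceIntegral S.continuous_Bc] at hint
    have e4 := hu₁' j ⟨0, left_mem_Icc.2 zero_le_one⟩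
    simp only [zero_div, add_zero] at e4
    rw [hu₁', hint, ← e4]
    change _ = block j (u₁ ⟨0, left_mem_Icc.2 zero_le_one⟩ +
      (-(w t) - (S.delay N * z) • pieceIntegral S.continuous_Bc S.τ u₀ t) + S.mivpOp k μ z u₁ t)
    rw [map_add, map_add, map_sub, map_neg, map_smul]
    abel
  · rw [Ac_add_one, Bc_add_one, ← hu₁ _ ⟨by linarith [hx.1], by linarith [hx.2]⟩,
      ← hu₁ _ ⟨by linarith [hx.1], by linarith [hx.2]⟩,
      ← hu₀ _ ⟨by linarith [hx.1], by linarith [hx.2]⟩,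
      ← hu₀ _ ⟨by linarith [hx.1], by linarith [hx.2]⟩, glue_periodic u₁, glue_periodic u₀,
      add_sub_right_comm x 1, glue_periodic u₁, glue_periodic u₀, S.glue_sub_delay,
      S.glue_sub_delay, hF]
    simp only [perRhs, sub_zero, Matrix.one_mulVec]

/-- A vector of the kernel of the characteristic matrix gives a continuous solution of the periodic
equation. -/
theorem exists_periodic_of_charOp_eq_zero (S : PeriodicDDE n) {μ z : ℂ}
    (hU : IsUnit (1 - S.mivpOp k μ z)) {v : Fin k × Fin n → ℂ} (hv : S.charOp k μ z v = 0) :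
    ∃ y : ℝ → Fin n → ℂ, Function.Periodic y 1 ∧ (∀ t, HasDerivAt y (S.perRhs μ z y t) t) ∧
      ∀ (j : Fin k) (a : Fin n), y (mesh k j) a = v (j, a) := by
  set u := S.mivpFlow k μ z v with hu
  have h1 := (one_sub_mivpOp_apply_eq_iff S μ z u v).1 ((S.mivpFlow_eq_iff hU v u).1 rfl)
  have h2 : cycleBlocks k n (Pieces.endpoint k n u) = v := (sub_eq_zero.1 hv).symm
  set f := S.perRhs μ z (glue u) with hf
  have hfi : ∀ a b, IntervalIntegrable f MeasureTheory.volume a b :=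
    S.intervalIntegrable_perRhs_glue μ z u
  have hfp : Function.Periodic f 1 := fun t => by
    rw [hf, perRhs, perRhs, Ac_add_one, Bc_add_one, glue_periodic u, add_sub_right_comm,
      glue_periodic u]
  have hcyc : ∀ i j : Fin k, residue k ((j : ℤ) - 1) = i →
      block j v = block i v + ∫ x in mesh k i..mesh k (i + 1), f x := by
    intro i j hij
    rw [mesh_succ]
    have := h1 i ⟨1, right_mem_Icc.2 zero_le_one⟩
    rw [← this]
    conv_lhs => rw [← h2]
    ext a
    change u _ (residue k ((j : ℤ) - 1), a) = _
    rw [hij]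
    rfl
  have h0 : (0 : ℕ) < k := NeZero.pos k
  set v₀ := block (⟨0, h0⟩ : Fin k) v with hv₀
  set F : ℝ → Fin n → ℂ := fun t => v₀ + ∫ x in (-1 : ℝ)..t, f x with hF
  have hadd : ∀ a b, F b = F a + ∫ x in a..b, f x := fun a b => by
    simp only [hF]
    rw [add_assoc, intervalIntegral.integral_add_adjacent_intervals (hfi _ _) (hfi _ _)]
  have hmesh : ∀ (j : ℕ) (hj : j < k), block ⟨j, hj⟩ v = F (mesh k j) := by
    intro j
    induction j with
    | zero =>
      intro hj
      simp [hF, mesh_zero, hv₀]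
    | succ j ih =>
      intro hj
      rw [hadd (mesh k j), ← ih (by omega)]
      refine hcyc ⟨j, by omega⟩ ⟨j + 1, hj⟩ ?_
      have : (((j + 1 : ℕ) : ℤ)) - 1 = (j : ℤ) := by omega
      simp only [this]
      exact residue_natCast (by omega)
  have hIco : ∀ t ∈ Ico (-1 : ℝ) 0, glue u t = F t := by
    intro t ht
    obtain ⟨j, s, hs, rfl⟩ := exists_mesh_add (k := k) ht
    rw [glue_mesh_add u j hs, IccExtend_of_mem zero_le_one u ⟨hs.1, hs.2.le⟩, hadd (mesh k j),
      ← hmesh j j.2]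
    exact h1 j ⟨s, hs.1, hs.2.le⟩
  -- The matching condition from the last block back to the first says that F(0) equals the initial
  -- value v₀ = F(-1).
  have hzero : ∫ x in (-1 : ℝ)..0, f x = 0 := by
    have e1 := hcyc ⟨k - 1, by omega⟩ ⟨0, h0⟩ (by
      have : residue k (((⟨0, h0⟩ : Fin k) : ℤ) - 1) = residue k ((k - 1 : ℕ) : ℤ) := by
        rw [← residue_add_self]
        congr 1
        simp only
        omega
      rw [this, residue_natCast (by omega)])
    rw [hmesh (k - 1) (by omega), ← hadd] at e1
    simp only [Nat.sub_add_cancel h0, mesh_self, hF] at e1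
    exact left_eq_add.1 e1
  have hFp : Function.Periodic F 1 := fun t => by
    rw [hadd t, hfp.intervalIntegral_add_eq t (-1), neg_add_cancel, hzero, add_zero]
  have hglue : glue u = F := by
    ext1 t
    rw [← (glue_periodic u).sub_int_mul_eq (x := t) (⌊t⌋ + 1),
      ← hFp.sub_int_mul_eq (x := t) (⌊t⌋ + 1)]
    refine hIco _ ⟨?_, ?_⟩ <;> push_cast <;> linarith [Int.floor_le t, Int.lt_floor_add_one t]
  -- Bootstrap: F is continuous as an integral of a locally integrable function; since `glue u`
  -- equals F, the integrand is continuous as well, and so F is differentiable everywhere.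
  have hFc : Continuous F :=
    continuous_const.add (intervalIntegral.continuous_primitive hfi (-1))
  have hfc : Continuous f := by
    rw [hf, hglue]
    exact ((S.continuous_Ac.matrix_mulVec hFc).sub (hFc.const_smul μ)).add
      ((S.continuous_Bc.matrix_mulVec (hFc.comp (continuous_sub_right S.τ))).const_smul z)
  refine ⟨F, hFp, fun t => ?_, fun j a => ?_⟩
  · have e : S.perRhs μ z F t = f t := by rw [hf, hglue]
    rw [e]
    exact ((hfc.integral_hasStrictDerivAt (-1) t).hasDerivAt).const_add v₀
  · rw [← hmesh j j.2]
    rfl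

/-- Floquet exponents are the zeros of `det Δ(μ, exp(-(N+τ)μ))`. -/
theorem isFloquetExponent_iff (S : PeriodicDDE n) {N : ℕ} (hN : 1 ≤ N) {μ : ℂ}
    (hU : IsUnit (1 - S.mivpOp k μ (Complex.exp (-(μ * S.delay N))))) :
    S.IsFloquetExponent N μ ↔ S.charFun k μ (Complex.exp (-(μ * S.delay N))) = 0 := by
  have hr := S.one_le_delay hN
  set z := Complex.exp (-(μ * S.delay N)) with hz
  rw [S.charFun_eq_det hU, ← Matrix.exists_mulVec_eq_zero_iff]
  simp only [LinearMap.toMatrix'_mulVec]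
  constructor
  · intro h
    obtain ⟨φ, hφ⟩ := h.exists_hasEigenvector
    refine ⟨S.meshValues N k μ φ, fun h0 => hφ.2 ?_, S.charOp_meshValues hN hU hφ.apply_eq_smul⟩
    exact S.eq_zero_of_meshValues_eq_zero hN hU hφ.apply_eq_smul h0
  · rintro ⟨v, hv0, hv⟩
    obtain ⟨y, hy, hyd, hyv⟩ := S.exists_periodic_of_charOp_eq_zero hU hv
    have hyc : Continuous y := continuous_iff_continuousAt.2 fun t => (hyd t).continuousAt
    have hyr : ∀ t, y (t - S.delay N) = y (t - S.τ) := fun t => by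
      have := hy.sub_nat_mul_eq (x := t - S.τ) N
      rw [← this, delay]
      congr 1
      ring
    set x : ℝ → Fin n → ℂ := fun t => Complex.exp (μ * t) • y t with hx
    have hec : Continuous fun t : ℝ => Complex.exp (μ * t) := by fun_prop
    have hxc : Continuous x := hec.smul hyc
    set φ : State n (S.delay N) := ⟨fun s => x s, hxc.comp continuous_subtype_val⟩ with hφ
    have hsol : S.IsSolution (S.delay N) φ x := by
      refine ⟨hxc.continuousOn, fun s => rfl, fun t _ => HasDerivAt.hasDerivWithinAt ?_⟩
      have h1 : HasDerivAt (fun t : ℝ => Complex.exp (μ * t)) (μ * Complex.exp (μ * t)) t := by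
        have h := ((Complex.ofRealCLM.hasDerivAt (x := t)).const_mul μ).cexp
        simpa [mul_comm] using h
      refine (h1.smul (hyd t)).congr_deriv ?_
      have e : Complex.exp (μ * ((t - S.delay N : ℝ) : ℂ)) = Complex.exp (μ * t) * z := by
        rw [hz, ← Complex.exp_add]
        congr 1
        push_cast
        ring
      simp only [hx, perRhs, Matrix.mulVec_smul, e, hyr]
      module
    have heig : S.timeOneMap N φ = Complex.exp μ • φ := by
      ext1 s
      have h1 : S.timeOneMap N φ s = S.sol N φ (s + 1) := rfl
      rw [h1, (S.sol_spec N φ).eqOn (S.delay_nonneg N) hsol (S.shift_mem N s)]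
      change Complex.exp (μ * ((s + 1 : ℝ) : ℂ)) • y (s + 1) =
        Complex.exp μ • Complex.exp (μ * (s : ℝ)) • y s
      rw [hy, smul_smul, ← Complex.exp_add]
      congr 2
      push_cast
      ring
    refine Module.End.hasEigenvalue_of_hasEigenvector (x := φ)
      (Module.End.hasEigenvector_iff.2 ⟨Module.End.mem_eigenspace_iff.2 heig, fun h0 => hv0 ?_⟩)
    ext ⟨j, a⟩
    have hm := mesh_mem_Icc k j.2.le
    have h1 := DFunLike.congr_fun h0 (⟨mesh k j, by linarith [hm.1], hm.2⟩ : Icc (-S.delay N) (0 : ℝ))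
    have h2 : Complex.exp (μ * (mesh k j : ℝ)) • y (mesh k j) = 0 := h1
    rw [← hyv, (smul_eq_zero.1 h2).resolve_left (Complex.exp_ne_zero _)]
    rfl

/-! ### Algebraic simplicity from simple zeros -/

/-- If no eigenvector starts a Jordan chain, then all generalized eigenvectors are eigenvectors. -/
theorem apply_eq_smul_of_mem_maxGenEigenspace {V : Type*} [AddCommGroup V] [Module ℂ V]
    {M : Module.End ℂ V} {l : ℂ} (hl : l ≠ 0)
    (h : ∀ φ ψ, M φ = l • φ → M ψ = l • (ψ + φ) → φ = 0) {ψ : V}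
    (hψ : ψ ∈ M.maxGenEigenspace l) : M ψ = l • ψ := by
  have hsub : ∀ χ, (M - l • 1) χ = M χ - l • χ := fun χ => rfl
  have hsq : ∀ χ, (M - l • 1) ((M - l • 1) χ) = 0 → (M - l • 1) χ = 0 := by
    intro ψ hψ
    set χ := (M - l • 1) ψ with hχ
    have h1 : M χ = l • χ := sub_eq_zero.1 hψ
    -- Scaling by l⁻¹ brings the chain into the multiplicative form of the hypothesis. Thus the
    -- kernel of (M - l)² is the kernel of M - l, and all higher powers collapse.
    have h2 : M ψ = l • (ψ + l⁻¹ • χ) := by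
      rw [smul_add, smul_inv_smul₀ hl, hχ, hsub]
      abel
    have h3 := h (l⁻¹ • χ) ψ (by rw [map_smul, h1, smul_comm]) h2
    exact (smul_eq_zero.1 h3).resolve_left (inv_ne_zero hl)
  obtain ⟨m, hm⟩ := (Module.End.mem_maxGenEigenspace M l ψ).1 hψ
  have hmem : ∀ m : ℕ, ((M - l • 1) ^ m) ψ = 0 → (M - l • 1) ψ = 0 := by
    intro m
    induction m with
    | zero =>
      intro h
      have : ψ = 0 := by simpa using h
      rw [this, map_zero]
    | succ m ih =>
      intro h
      rcases m with _ | m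
      · rwa [zero_add, pow_one] at h
      · refine ih ?_
        rw [pow_succ', Module.End.mul_apply] at h ⊢
        rw [pow_succ', Module.End.mul_apply] at h
        exact hsq _ h
  exact sub_eq_zero.1 (hmem m hm)

/-- A generalized eigenspace without Jordan chains that is spanned by one eigenvector has
dimension one. -/
theorem finrank_maxGenEigenspace_of_span {V : Type*} [AddCommGroup V] [Module ℂ V]
    {M : Module.End ℂ V} {l : ℂ} (hl : l ≠ 0)
    (h : ∀ φ ψ, M φ = l • φ → M ψ = l • (ψ + φ) → φ = 0) {φ : V} (hφ : M φ = l • φ) (hφ0 : φ ≠ 0)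
    (hspan : ∀ ψ, M ψ = l • ψ → ∃ c : ℂ, c • φ - ψ = 0) :
    Module.finrank ℂ (M.maxGenEigenspace l) = 1 := by
  have hφm : φ ∈ M.maxGenEigenspace l :=
    (Module.End.mem_maxGenEigenspace M l φ).2 ⟨1, by rw [pow_one]; exact sub_eq_zero.2 hφ⟩
  refine (finrank_eq_one_iff_of_nonzero' (⟨φ, hφm⟩ : M.maxGenEigenspace l)
    (fun h => hφ0 (congr_arg Subtype.val h))).2 fun ψ => ?_
  obtain ⟨c, hc⟩ := hspan ψ (apply_eq_smul_of_mem_maxGenEigenspace hl h ψ.2)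
  exact ⟨c, Subtype.ext (sub_eq_zero.1 hc)⟩

theorem eigen_sub_smul {V : Type*} [AddCommGroup V] [Module ℂ V]
    {M : Module.End ℂ V} {l : ℂ} {φ ψ : V} (hφ : M φ = l • φ) (hψ : M ψ = l • ψ) (c : ℂ) :
    M (c • φ - ψ) = l • (c • φ - ψ) := by
  rw [map_sub, map_smul, hφ, hψ, smul_sub, smul_comm]

/-- The matrix of `charOp` along `z = exp(-(N+τ)μ)`. -/
def charMat (S : PeriodicDDE n) (N k : ℕ) [NeZero k] (s : ℂ) :
    Matrix (Fin k × Fin n) (Fin k × Fin n) ℂ :=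
  LinearMap.toMatrix' (S.charOp k s (Complex.exp (-(s * S.delay N)))).toLinearMap

theorem charMat_mulVec (S : PeriodicDDE n) (N : ℕ) (s : ℂ) (v : Fin k × Fin n → ℂ) :
    S.charMat N k s *ᵥ v = S.charOp k s (Complex.exp (-(s * S.delay N))) v :=
  LinearMap.toMatrix'_mulVec (S.charOp k s (Complex.exp (-(s * S.delay N)))).toLinearMap v

theorem deriv_det_charMat_ne_zero (S : PeriodicDDE n) {R : ℝ} (hR : 0 ≤ R)
    (hk : S.charBound R < k) {N : ℕ} {μ : ℂ}
    (hadm : (μ, Complex.exp (-(μ * S.delay N))) ∈ admissible R)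
    (hd : deriv (fun s => S.charFun k s (Complex.exp (-(s * S.delay N)))) μ ≠ 0) :
    deriv (fun s => (S.charMat N k s).det) μ ≠ 0 := by
  have hdet : (fun s => S.charFun k s (Complex.exp (-(s * S.delay N)))) =ᶠ[𝓝 μ]
      fun s => (S.charMat N k s).det := by
    have hc : Continuous fun s : ℂ => (s, Complex.exp (-(s * S.delay N))) := by fun_prop
    filter_upwards [hc.continuousAt.preimage_mem_nhds ((isOpen_admissible R).mem_nhds hadm)]
      with s hs
    have h : IsUnit (1 - S.mivpOp k s (Complex.exp (-(s * S.delay N)))) :=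
      S.isUnit_of_mem_admissible hR hk (p := (s, Complex.exp (-(s * S.delay N)))) hs
    exact S.charFun_eq_det h
  rwa [hdet.deriv_eq] at hd

theorem hasDerivAt_charMat (S : PeriodicDDE n) (N : ℕ) {μ : ℂ}
    (hU : IsUnit (1 - S.mivpOp k μ (Complex.exp (-(μ * S.delay N))))) (i j : Fin k × Fin n) :
    HasDerivAt (fun s => S.charMat N k s i j)
      (LinearMap.toMatrix' (S.charOpDeriv N k μ).toLinearMap i j) μ :=
  hasDerivAt_pi.1 (S.hasDerivAt_charOp N hU (Pi.single j 1)) i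

/-- At a simple zero the kernel of the characteristic matrix is one-dimensional. -/
theorem exists_eq_smul_of_simple (S : PeriodicDDE n) {R : ℝ} (hR : 0 ≤ R)
    (hk : S.charBound R < k) {N : ℕ} {μ : ℂ}
    (hadm : (μ, Complex.exp (-(μ * S.delay N))) ∈ admissible R)
    (hd : deriv (fun s => S.charFun k s (Complex.exp (-(s * S.delay N)))) μ ≠ 0)
    {v w : Fin k × Fin n → ℂ} (hv : S.charOp k μ (Complex.exp (-(μ * S.delay N))) v = 0)
    (hv0 : v ≠ 0) (hw : S.charOp k μ (Complex.exp (-(μ * S.delay N))) w = 0) :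
    ∃ c : ℂ, w = c • v := by
  have hU : IsUnit (1 - S.mivpOp k μ (Complex.exp (-(μ * S.delay N)))) :=
    S.isUnit_of_mem_admissible hR hk (p := (μ, Complex.exp (-(μ * S.delay N)))) hadm
  by_contra! hvw
  rw [← charMat_mulVec] at hv hw
  refine S.deriv_det_charMat_ne_zero hR hk hadm hd
    (deriv_det_eq_zero (S.hasDerivAt_charMat N hU) hv0 hv ?_)
  rw [adjugate_eq_zero hv hv0 hw hvw, Matrix.zero_mulVec]

/-- At a simple zero the derivative of the characteristic matrix maps no kernel vector into the
range. -/
theorem charOpDeriv_ne_of_simple (S : PeriodicDDE n) {R : ℝ} (hR : 0 ≤ R)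
    (hk : S.charBound R < k) {N : ℕ} {μ : ℂ}
    (hadm : (μ, Complex.exp (-(μ * S.delay N))) ∈ admissible R)
    (hd : deriv (fun s => S.charFun k s (Complex.exp (-(s * S.delay N)))) μ ≠ 0)
    {v w : Fin k × Fin n → ℂ} (hv : S.charOp k μ (Complex.exp (-(μ * S.delay N))) v = 0)
    (hv0 : v ≠ 0) :
    S.charOpDeriv N k μ v ≠ -S.charOp k μ (Complex.exp (-(μ * S.delay N))) w := by
  have hU : IsUnit (1 - S.mivpOp k μ (Complex.exp (-(μ * S.delay N)))) :=
    S.isUnit_of_mem_admissible hR hk (p := (μ, Complex.exp (-(μ * S.delay N)))) hadm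
  intro hvw
  rw [← charMat_mulVec] at hv hvw
  refine S.deriv_det_charMat_ne_zero hR hk hadm hd
    (deriv_det_eq_zero (S.hasDerivAt_charMat N hU) hv0 hv ?_)
  -- If D'v = -Dw, then adj(D)D'v = -det(D)w = 0, so the zero of the determinant would be multiple.
  have hdet0 : (S.charMat N k μ).det = 0 := Matrix.exists_mulVec_eq_zero_iff.1 ⟨_, hv0, hv⟩
  have e : LinearMap.toMatrix' (S.charOpDeriv N k μ).toLinearMap *ᵥ v =
      -(S.charMat N k μ *ᵥ w) :=
    (LinearMap.toMatrix'_mulVec (S.charOpDeriv N k μ).toLinearMap v).trans hvw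
  rw [e, Matrix.mulVec_neg, Matrix.mulVec_mulVec, Matrix.adjugate_mul, hdet0, zero_smul,
    Matrix.zero_mulVec, neg_zero]

/-- A simple zero of `μ ↦ det Δ(μ, exp(-(N+τ)μ))` admits no Jordan chain. -/
theorem eq_zero_of_chain_of_simple (S : PeriodicDDE n) {R : ℝ} (hR : 0 ≤ R)
    (hk : S.charBound R < k) {N : ℕ} {μ : ℂ}
    (hadm : (μ, Complex.exp (-(μ * S.delay N))) ∈ admissible R)
    (hd : deriv (fun s => S.charFun k s (Complex.exp (-(s * S.delay N)))) μ ≠ 0) (hN : 1 ≤ N)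
    {φ ψ : State n (S.delay N)} (h : S.timeOneMap N φ = Complex.exp μ • φ)
    (h' : S.timeOneMap N ψ = Complex.exp μ • (ψ + φ)) : φ = 0 := by
  have hU : IsUnit (1 - S.mivpOp k μ (Complex.exp (-(μ * S.delay N)))) :=
    S.isUnit_of_mem_admissible hR hk (p := (μ, Complex.exp (-(μ * S.delay N)))) hadm
  by_contra h0
  have hv0 : S.meshValues N k μ φ ≠ 0 := fun h1 =>
    h0 (S.eq_zero_of_meshValues_eq_zero hN hU h h1)
  obtain ⟨u₀, u₁, v, e1, e2, e3⟩ := S.exists_pieces_of_chain (k := k) hN h h'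
  refine S.charOpDeriv_ne_of_simple hR hk hadm hd (S.charOp_meshValues hN hU h) hv0 (w := v) ?_
  set z := Complex.exp (-(μ * S.delay N)) with hz
  have e4 := (S.mivpFlow_eq_iff hU _ _).2 e1
  have e5 : Ring.inverse (1 - S.mivpOp k μ z) (S.mivpOpDeriv N k μ u₀) =
      u₁ - S.mivpFlow k μ z v := by
    have h1 : Ring.inverse (1 - S.mivpOp k μ z) ((1 - S.mivpOp k μ z) u₁) = u₁ :=
      DFunLike.congr_fun (Ring.inverse_mul_cancel _ hU) u₁
    rw [e2, map_add] at h1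
    exact eq_sub_of_add_eq' h1
  have e7 : S.charOp k μ z v =
    v - cycleBlocks k n (Pieces.endpoint k n (S.mivpFlow k μ z v)) := rfl
  rw [charOpDeriv_apply, ← hz, e4, e5, map_sub, map_sub, e3, e7]

theorem meshValues_sub (S : PeriodicDDE n) (N k : ℕ) (μ : ℂ) (φ ψ : State n (S.delay N)) :
    S.meshValues N k μ (φ - ψ) = S.meshValues N k μ φ - S.meshValues N k μ ψ := by
  ext p
  exact mul_sub _ _ _

/-- A simple zero of `μ ↦ det Δ(μ, exp(-(N+τ)μ))` is an algebraically simple Floquet exponent. -/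
theorem finrank_maxGenEigenspace_eq_one (S : PeriodicDDE n) {R : ℝ} (hR : 0 ≤ R)
    (hk : S.charBound R < k) {N : ℕ} {μ : ℂ}
    (hadm : (μ, Complex.exp (-(μ * S.delay N))) ∈ admissible R)
    (hd : deriv (fun s => S.charFun k s (Complex.exp (-(s * S.delay N)))) μ ≠ 0) (hN : 1 ≤ N)
    (hμ : S.IsFloquetExponent N μ) :
    Module.finrank ℂ ((S.timeOneMap N).maxGenEigenspace (Complex.exp μ)) = 1 := by
  have hU : IsUnit (1 - S.mivpOp k μ (Complex.exp (-(μ * S.delay N)))) :=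
    S.isUnit_of_mem_admissible hR hk (p := (μ, Complex.exp (-(μ * S.delay N)))) hadm
  obtain ⟨φ, hφ⟩ := hμ.exists_hasEigenvector
  have hφ1 := hφ.apply_eq_smul
  refine finrank_maxGenEigenspace_of_span (Complex.exp_ne_zero μ)
    (fun φ ψ h h' => S.eq_zero_of_chain_of_simple hR hk hadm hd hN h h') hφ1 hφ.2 fun ψ hψ => ?_
  obtain ⟨c, hc⟩ := S.exists_eq_smul_of_simple hR hk hadm hd (S.charOp_meshValues hN hU hφ1)
    (fun h1 => hφ.2 (S.eq_zero_of_meshValues_eq_zero hN hU hφ1 h1)) (S.charOp_meshValues hN hU hψ)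
  refine ⟨c, S.eq_zero_of_meshValues_eq_zero hN hU (eigen_sub_smul hφ1 hψ c) ?_⟩
  rw [meshValues_sub, S.meshValues_smul, hc, sub_self]

/-! ### Divided differences of analytic functions -/

/-- The upper triangular operator on `ℂ²` with diagonal `a, b` and off-diagonal entry `t`. -/
def triOp (t : ℂ) (p : ℂ × ℂ) : (ℂ × ℂ) →L[ℂ] (ℂ × ℂ) :=
  (p.1 • ContinuousLinearMap.fst ℂ ℂ ℂ + t • ContinuousLinearMap.snd ℂ ℂ ℂ).prod
    (p.2 • ContinuousLinearMap.snd ℂ ℂ ℂ)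

theorem triOp_apply (t : ℂ) (p v : ℂ × ℂ) :
    triOp t p v = (p.1 * v.1 + t * v.2, p.2 * v.2) := by
  simp [triOp]

theorem triOp_pow_fst (t : ℂ) (p : ℂ × ℂ) (m : ℕ) :
    (triOp t p ^ m) (1, 0) = (p.1 ^ m, 0) := by
  induction m with
  | zero => simp
  | succ m ih => rw [pow_succ', mul_apply_eq_comp, ih, triOp_apply]; simp [pow_succ']

theorem triOp_pow_snd (t : ℂ) (p : ℂ × ℂ) (m : ℕ) :
    ((triOp t p ^ m) (0, 1)).2 = p.2 ^ m := by
  induction m with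
  | zero => simp
  | succ m ih => rw [pow_succ', mul_apply_eq_comp, triOp_apply, ih, pow_succ']

theorem contDiff_triOp (t : ℂ) : ContDiff ℂ ⊤ (triOp t) := by
  have : triOp t = fun p : ℂ × ℂ =>
      p.1 • (ContinuousLinearMap.fst ℂ ℂ ℂ).prod (0 : ℂ × ℂ →L[ℂ] ℂ) +
      p.2 • (0 : ℂ × ℂ →L[ℂ] ℂ).prod (ContinuousLinearMap.snd ℂ ℂ ℂ) +
      t • (ContinuousLinearMap.snd ℂ ℂ ℂ).prod (0 : ℂ × ℂ →L[ℂ] ℂ) := by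
    ext p <;> simp [triOp]
  rw [this]
  exact ((contDiff_fst.smul contDiff_const).add (contDiff_snd.smul contDiff_const)).add
    contDiff_const

/-- Applying f to the upper triangular matrix with diagonal a, b and off-diagonal t produces the
off-diagonal entry t(f(b) - f(a))/(b - a). The divided difference is thus read off from one power
series in a Banach algebra of operators, which is analytic in (a,b) across the diagonal as well. -/
theorem exists_contDiffAt_slope_zero {f : ℂ → ℂ} (hf : AnalyticAt ℂ f 0) :
    ∃ Q : ℂ × ℂ → ℂ, ContDiffAt ℂ ⊤ Q (0, 0) ∧
      ∀ᶠ p in 𝓝 ((0, 0) : ℂ × ℂ), f p.2 - f p.1 = (p.2 - p.1) * Q p := by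
  obtain ⟨q, hq⟩ := hf
  obtain ⟨C, r, hC, hr, hCr⟩ := q.le_mul_pow_of_radius_pos hq.radius_pos
  set c : ℕ → ℂ := fun m => q.coeff m with hc
  set F := FormalMultilinearSeries.ofScalars ((ℂ × ℂ) →L[ℂ] (ℂ × ℂ)) c with hF
  have hFr : 0 < F.radius := by
    have h : ENNReal.ofNNReal r⁻¹.toNNReal ≤ F.radius := by
      refine F.le_radius_of_bound C fun m => ?_
      rw [hF, FormalMultilinearSeries.ofScalars_norm, hc, Real.coe_toNNReal _ (inv_pos.2 hr).le, ← q.norm_apply_eq_norm_coef]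
      calc ‖q m‖ * r⁻¹ ^ m ≤ C * r ^ m * r⁻¹ ^ m := by gcongr; exact hCr m
        _ = C := by rw [mul_assoc, ← mul_pow, mul_inv_cancel₀ hr.ne', one_pow, mul_one]
    refine lt_of_lt_of_le ?_ h
    rw [ENNReal.coe_pos, Real.toNNReal_pos]
    exact inv_pos.2 hr
  have hFs := F.hasFPowerSeriesOnBall hFr
  obtain ⟨r', hr'0, hr'⟩ := Metric.eventually_nhds_iff.1
    (hFs.eventually_hasSum.and (hFs.analyticAt.contDiffAt (n := ⊤)
      |>.eventually (by simp)))
  obtain ⟨s, hs0, hs⟩ := Metric.eventually_nhds_iff.1 hq.eventually_hasSum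
  simp only [dist_zero_right, zero_add, FormalMultilinearSeries.apply_eq_pow_smul_coeff,
    smul_eq_mul] at hr' hs
  -- Nonzero, so that t can be divided out, yet small enough for the operators near (0,0) to lie in
  -- the ball where the series converges.
  set t : ℂ := ((r' / 2 : ℝ) : ℂ) with ht
  have ht0 : t ≠ 0 := by
    rw [ht, Complex.ofReal_ne_zero]
    positivity
  have htri0 : ‖triOp t (0, 0)‖ < r' := by
    have h : ‖triOp t (0, 0)‖ ≤ r' / 2 := by
      refine ContinuousLinearMap.opNorm_le_bound _ (by positivity) fun v => ?_
      rw [triOp_apply, zero_mul, zero_mul, zero_add, Prod.norm_mk, norm_zero, norm_mul, ht,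
        Complex.norm_of_nonneg (by positivity), max_eq_left (by positivity)]
      gcongr
      exact norm_snd_le v
    linarith
  have hnear : ∀ᶠ p in 𝓝 ((0, 0) : ℂ × ℂ), ‖triOp t p‖ < r' :=
    (contDiff_triOp t).continuous.norm.continuousAt.eventually_lt continuousAt_const htri0
  refine ⟨fun p => t⁻¹ * (F.sum (triOp t p) (0, 1)).1, ?_, ?_⟩
  · have h := (hr' htri0).2.comp (0, 0) (contDiff_triOp t).contDiffAt
    exact contDiffAt_const.mul (h.clm_apply contDiffAt_const).fst
  · have h1 : ∀ᶠ p in 𝓝 ((0, 0) : ℂ × ℂ), ‖p.1‖ < s :=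
      continuous_fst.norm.continuousAt.eventually_lt continuousAt_const (by simpa)
    have h2 : ∀ᶠ p in 𝓝 ((0, 0) : ℂ × ℂ), ‖p.2‖ < s :=
      continuous_snd.norm.continuousAt.eventually_lt continuousAt_const (by simpa)
    filter_upwards [hnear, h1, h2] with p hp hp1 hp2
    set X := triOp t p with hX
    have hsum : HasSum (fun m => c m • X ^ m) (F.sum X) := by
      have h := (hr' hp).1
      simp only [hF, FormalMultilinearSeries.ofScalars_apply_eq] at h
      exact h
    have e1 : F.sum X (1, 0) = (f p.1, 0) := by
      have h := hsum.mapL (ContinuousLinearMap.apply ℂ (ℂ × ℂ) ((1, 0) : ℂ × ℂ))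
      have h' := (hs hp1).mapL (ContinuousLinearMap.inl ℂ ℂ ℂ)
      have hm : ∀ m, ContinuousLinearMap.apply ℂ (ℂ × ℂ) ((1, 0) : ℂ × ℂ) (c m • X ^ m) =
          ContinuousLinearMap.inl ℂ ℂ ℂ (p.1 ^ m * q.coeff m) := fun m => by
        change c m • (X ^ m) (1, 0) = (p.1 ^ m * q.coeff m, 0)
        rw [hX, triOp_pow_fst, hc, Prod.smul_mk, smul_eq_mul, mul_comm, smul_zero]
      simp only [hm] at h
      exact h.unique h'
    have e2 : (F.sum X (0, 1)).2 = f p.2 := by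
      set P := ContinuousLinearMap.snd ℂ ℂ ℂ ∘L
        ContinuousLinearMap.apply ℂ (ℂ × ℂ) ((0, 1) : ℂ × ℂ) with hP
      have h := hsum.mapL P
      have hm : ∀ m, P (c m • X ^ m) = p.2 ^ m * q.coeff m := fun m => by
        change c m * ((X ^ m) (0, 1)).2 = p.2 ^ m * q.coeff m
        rw [hX, triOp_pow_snd, hc, mul_comm]
      simp only [hm] at h
      exact h.unique (hs hp2)
    -- The off-diagonal entry of this commutation relation is the divided difference identity; no
    -- case distinction for equal arguments is needed.
    have e3 : F.sum X * X = X * F.sum X := by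
      have hm : ∀ m, c m • X ^ m * X = X * c m • X ^ m := fun m => by
        refine ContinuousLinearMap.ext fun v => ?_
        change c m • (X ^ m) (X v) = X (c m • (X ^ m) v)
        rw [map_smul, ← mul_apply_eq_comp, ← mul_apply_eq_comp, ← pow_succ, ← pow_succ']
      have h := hsum.mul_right X
      simp only [hm] at h
      exact h.unique (hsum.mul_left X)
    have e4 := congr_arg Prod.fst (DFunLike.congr_fun e3 ((0, 1) : ℂ × ℂ))
    have e5 : X (0, 1) = t • ((1, 0) : ℂ × ℂ) + p.2 • ((0, 1) : ℂ × ℂ) := by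
      simp [hX, triOp_apply]
    rw [mul_apply_eq_comp, mul_apply_eq_comp, e5, map_add, map_smul, map_smul, e1, hX,
      triOp_apply, ← hX, e2] at e4
    simp only [Prod.fst_add, Prod.smul_fst, smul_eq_mul] at e4
    field_simp
    linear_combination -e4

theorem exists_contDiffAt_slope {f : ℂ → ℂ} {a : ℂ} (hf : AnalyticAt ℂ f a) :
    ∃ Q : ℂ × ℂ → ℂ, ContDiffAt ℂ ⊤ Q (a, a) ∧
      ∀ᶠ p in 𝓝 ((a, a) : ℂ × ℂ), f p.2 - f p.1 = (p.2 - p.1) * Q p := by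
  have hs : ContDiff ℂ ⊤ fun p : ℂ × ℂ => p - (a, a) := contDiff_id.sub contDiff_const
  have h0 : ((a, a) : ℂ × ℂ) - (a, a) = (0, 0) := sub_self _
  obtain ⟨Q, hQ, he⟩ := exists_contDiffAt_slope_zero (f := fun z => f (z + a))
    (AnalyticAt.fun_comp (by simpa using hf) (by fun_prop))
  refine ⟨fun p => Q (p - (a, a)), ?_, ?_⟩
  · rw [← h0] at hQ
    exact ContDiffAt.comp (a, a) (f := fun p : ℂ × ℂ => p - (a, a)) hQ hs.contDiffAt
  · have hc : Tendsto (fun p : ℂ × ℂ => p - (a, a)) (𝓝 (a, a)) (𝓝 (0, 0)) := by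
      have := hs.continuous.tendsto (a, a)
      rwa [h0] at this
    filter_upwards [hc.eventually he] with p hp
    simpa using hp

/-! ### The root curve and its perturbation -/

theorem exists_implicit_curve {H : ℂ × ℂ → ℂ} {a b : ℂ} (hH : ContDiffAt ℂ ⊤ H (a, b))
    (h0 : H (a, b) = 0) (hd : deriv (fun m => H (a, m)) b ≠ 0) :
    ∃ l : ℂ → ℂ, ContDiffAt ℂ ⊤ l a ∧ l a = b ∧ ∀ᶠ v in 𝓝 (a, b), H v = 0 ↔ v.2 = l v.1 := by
  have hinv : (fderiv ℂ H (a, b) ∘L ContinuousLinearMap.inr ℂ ℂ ℂ).IsInvertible := by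
    set L := fderiv ℂ H (a, b) ∘L ContinuousLinearMap.inr ℂ ℂ ℂ with hL
    have h1 : HasFDerivAt (fun m => H (a, m)) L b :=
      (hH.differentiableAt (by simp)).hasFDerivAt.comp b (hasFDerivAt_prodMk_right a b)
    have h2 : L 1 ≠ 0 := by rwa [← h1.hasDerivAt.deriv]
    have h3 : ∀ x, L x = x * L 1 := fun x => by
      rw [← smul_eq_mul, ← map_smul, smul_eq_mul, mul_one]
    refine ContinuousLinearMap.IsInvertible.of_inverse (g := (L 1)⁻¹ • .id ℂ ℂ) ?_ ?_
    · ext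
      simp [h2]
    · ext
      simp [h2]
  have hne : (⊤ : WithTop ℕ∞) ≠ 0 := by simp
  refine ⟨hH.implicitFunction hne hinv, hH.contDiffAt_implicitFunction hne hinv,
    hH.implicitFunction_apply_self hne hinv, ?_⟩
  filter_upwards [hH.eventually_apply_eq_iff_implicitFunction hne hinv] with v hv
  rw [← h0, hv, eq_comm]

/-- The perturbed curve `μ̃(ω) + ε g(ω,ε) Re μ̃(ω)`. -/
def pert (μt : ℝ → ℂ) (g : ℝ → ℝ → ℂ) (ε ω : ℝ) : ℂ := μt ω + ε * g ω ε * (μt ω).re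

theorem pert_re (μt : ℝ → ℂ) (g : ℝ → ℝ → ℂ) (ε ω : ℝ) :
    (pert μt g ε ω).re = pertRe μt g ε ω := by
  simp [pert, pertRe]
  ring

theorem pert_im (μt : ℝ → ℂ) (g : ℝ → ℝ → ℂ) (ε ω : ℝ) :
    (pert μt g ε ω).im = pertIm μt g ε ω := by
  simp [pert, pertIm]

theorem pert_zero (μt : ℝ → ℂ) (g : ℝ → ℝ → ℂ) (ω : ℝ) : pert μt g 0 ω = μt ω := by
  simp [pert]

theorem contDiff_ofReal_complex : ContDiff ℝ ⊤ (fun x : ℝ => (x : ℂ)) :=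
  Complex.ofRealCLM.contDiff

theorem contDiff_re_complex : ContDiff ℝ ⊤ (fun x : ℂ => x.re) :=
  Complex.reCLM.contDiff

theorem contDiffAt_curve {l : ℂ → ℂ} {ωs : ℝ} (hl : ContDiffAt ℂ ⊤ l (ωs * Complex.I)) :
    ContDiffAt ℝ ⊤ (fun ω : ℝ => l (ω * Complex.I)) ωs :=
  (hl.restrict_scalars ℝ).comp ωs
    (f := fun ω : ℝ => (ω : ℂ) * Complex.I) (contDiff_ofReal_complex.mul contDiff_const).contDiffAt

/-- For m = μ̃ + εgγ̃ one has Re m = (1 + ε Re g)γ̃, so m = l(iω + ε Re m) reads εgγ̃ = ε(1 + ε Re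
g)γ̃ Q with Q the divided difference of l. It suffices to solve g = (1 + ε Re g)Q after cancelling
εγ̃, which is legitimate even where γ̃ = 0. At ε = 0 the partial derivative in g is the identity.
The implicit function theorem is the real one, since Re m is not holomorphic. -/
theorem exists_pert {l : ℂ → ℂ} {ωs : ℝ} (hl : ContDiffAt ℂ ⊤ l (ωs * Complex.I)) :
    ∃ g : ℝ → ℝ → ℂ, ContDiffAt ℝ ⊤ (fun p : ℝ × ℝ => g p.1 p.2) (ωs, 0) ∧
      ∀ᶠ p in 𝓝 ((ωs, 0) : ℝ × ℝ), pert (fun ω => l (ω * Complex.I)) g p.2 p.1 =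
        l (p.1 * Complex.I + p.2 * (pert (fun ω => l (ω * Complex.I)) g p.2 p.1).re) := by
  obtain ⟨Q, hQ, hlQ⟩ := exists_contDiffAt_slope (f := l) (a := ωs * Complex.I)
    (by simpa using hl.analyticAt)
  set a : ℂ := ωs * Complex.I with ha
  set μt : ℝ → ℂ := fun ω => l (ω * Complex.I) with hμt
  set g₀ : ℂ := Q (a, a) with hg₀
  set T : (ℝ × ℝ) × ℂ → ℂ × ℂ := fun v => (v.1.1 * Complex.I, v.1.1 * Complex.I +
    ((v.1.2 * (1 + v.1.2 * v.2.re) * (μt v.1.1).re : ℝ) : ℂ)) with hT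
  have hTs : ContDiffAt ℝ ⊤ T ((ωs, 0), g₀) := by
    have h1 : ContDiffAt ℝ ⊤ (fun v : (ℝ × ℝ) × ℂ => (v.1.1 : ℂ) * Complex.I) ((ωs, 0), g₀) :=
      ((contDiff_ofReal_complex.comp (contDiff_fst.comp contDiff_fst)).mul
        contDiff_const).contDiffAt
    have h2 : ContDiffAt ℝ ⊤ (fun v : (ℝ × ℝ) × ℂ => (μt v.1.1).re) ((ωs, 0), g₀) := by
      refine contDiff_re_complex.contDiffAt.comp _ ?_
      exact ContDiffAt.comp (g := μt) (f := fun v : (ℝ × ℝ) × ℂ => v.1.1) _ (contDiffAt_curve hl)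
        (contDiff_fst.comp contDiff_fst).contDiffAt
    have h3 : ContDiff ℝ ⊤ (fun v : (ℝ × ℝ) × ℂ => v.1.2 * (1 + v.1.2 * v.2.re)) :=
      (contDiff_snd.comp contDiff_fst).mul (contDiff_const.add
        ((contDiff_snd.comp contDiff_fst).mul (contDiff_re_complex.comp contDiff_snd)))
    exact h1.prodMk (h1.add (contDiff_ofReal_complex.contDiffAt.comp _ (h3.contDiffAt.mul h2)))
  have hT0 : ∀ x, T ((ωs, 0), x) = (a, a) := fun x => by simp [hT, ha]
  set G : (ℝ × ℝ) × ℂ → ℂ := fun v => v.2 - ((1 + v.1.2 * v.2.re : ℝ) : ℂ) * Q (T v) with hG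
  have hGs : ContDiffAt ℝ ⊤ G ((ωs, 0), g₀) := by
    have h1 : ContDiffAt ℝ ⊤ (fun v => Q (T v)) ((ωs, 0), g₀) := by
      refine ContDiffAt.comp _ (g := Q) ?_ hTs
      rw [hT0]
      exact hQ.restrict_scalars ℝ
    have h2 : ContDiff ℝ ⊤ (fun v : (ℝ × ℝ) × ℂ => ((1 + v.1.2 * v.2.re : ℝ) : ℂ)) :=
      contDiff_ofReal_complex.comp (contDiff_const.add
        ((contDiff_snd.comp contDiff_fst).mul (contDiff_re_complex.comp contDiff_snd)))
    exact contDiff_snd.contDiffAt.sub (h2.contDiffAt.mul h1)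
  have hG0 : G ((ωs, 0), g₀) = 0 := by
    simp only [hG, hT0, ← hg₀]
    simp
  have hne : (⊤ : WithTop ℕ∞) ≠ 0 := by simp
  have hinv : (fderiv ℝ G ((ωs, 0), g₀) ∘L ContinuousLinearMap.inr ℝ (ℝ × ℝ) ℂ).IsInvertible := by
    have h1 : HasFDerivAt (fun x => G ((ωs, 0), x))
        (fderiv ℝ G ((ωs, 0), g₀) ∘L ContinuousLinearMap.inr ℝ (ℝ × ℝ) ℂ) g₀ :=
      (hGs.differentiableAt hne).hasFDerivAt.comp g₀ (hasFDerivAt_prodMk_right (ωs, (0 : ℝ)) g₀)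
    have h2 : (fun x => G ((ωs, 0), x)) = fun x => x - g₀ := by
      ext1 x
      simp only [hG, hT0, ← hg₀]
      simp
    rw [h2] at h1
    rw [h1.unique ((hasFDerivAt_id g₀).sub_const g₀)]
    exact ContinuousLinearMap.isInvertible_equiv (f := ContinuousLinearEquiv.refl ℝ ℂ)
  set ψ := hGs.implicitFunction hne hinv with hψ
  have hψs : ContDiffAt ℝ ⊤ ψ (ωs, 0) := hGs.contDiffAt_implicitFunction hne hinv
  have hψ0 : ψ (ωs, 0) = g₀ := hGs.implicitFunction_apply_self hne hinv
  refine ⟨fun x e => ψ (x, e), hψs, ?_⟩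
  have hTt : Tendsto (fun p : ℝ × ℝ => T (p, ψ p)) (𝓝 (ωs, 0)) (𝓝 (a, a)) := by
    have h1 : Tendsto (fun p : ℝ × ℝ => (p, ψ p)) (𝓝 (ωs, 0)) (𝓝 ((ωs, 0), g₀)) := by
      have h := hψs.continuousAt.tendsto
      rw [hψ0] at h
      exact tendsto_id.prodMk_nhds h
    have h2 := hTs.continuousAt.tendsto
    rw [hT0] at h2
    exact h2.comp h1
  have hev := hGs.eventually_apply_implicitFunction hne hinv
  filter_upwards [hTt.eventually hlQ, hev] with p hp hp'
  rw [hG0, ← hψ] at hp'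
  have e1 : ψ p = ((1 + p.2 * (ψ p).re : ℝ) : ℂ) * Q (T (p, ψ p)) := sub_eq_zero.1 hp'
  have e2 : (pert μt (fun x e => ψ (x, e)) p.2 p.1).re =
      (1 + p.2 * (ψ p).re) * (μt p.1).re := pert_re _ _ _ _
  have e3 : (p.1 : ℂ) * Complex.I + p.2 * ((pert μt (fun x e => ψ (x, e)) p.2 p.1).re : ℝ) =
      (T (p, ψ p)).2 := by
    rw [e2, hT]
    push_cast
    ring
  have e4 : (T (p, ψ p)).2 - (T (p, ψ p)).1 =
    ((p.2 * (1 + p.2 * (ψ p).re) * (μt p.1).re : ℝ) : ℂ) := add_sub_cancel_left _ _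
  have e5 : pert μt (fun x e => ψ (x, e)) p.2 p.1 = μt p.1 + p.2 * ψ p * (μt p.1).re := rfl
  have e6 : l (T (p, ψ p)).1 = μt p.1 := rfl
  rw [e4, e6] at hp
  rw [e3, e5]
  push_cast at e1 hp
  linear_combination (p.2 * (μt p.1).re : ℂ) * e1 - hp

/-- A regular root curve and its perturbation: near the base point, the solutions `m` of
`H(iω + ε Re m, m) = 0` are given by the perturbed curve. -/
theorem exists_perturbed_curve {H : ℂ × ℂ → ℂ} {ωs : ℝ} {ms : ℂ}
    (hH : ContDiffAt ℂ ⊤ H (ωs * Complex.I, ms)) (h0 : H (ωs * Complex.I, ms) = 0)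
    (hd : deriv (fun m => H (ωs * Complex.I, m)) ms ≠ 0) {E : ℂ × ℂ → Prop}
    (hE : ∀ᶠ v in 𝓝 ((ωs * Complex.I, ms) : ℂ × ℂ), E v) :
    ∃ (a ε₀ ρ L : ℝ) (μt : ℝ → ℂ) (g : ℝ → ℝ → ℂ), 0 < a ∧ 0 < ε₀ ∧ 0 < ρ ∧ 0 ≤ L ∧
      μt ωs = ms ∧ ∀ x ∈ Ioo (ωs - a) (ωs + a), ContDiffAt ℝ ⊤ μt x ∧ ∀ e ∈ Ico 0 ε₀,
        ContDiffAt ℝ ⊤ (fun p : ℝ × ℝ => g p.1 p.2) (x, e) ∧ ‖g x e‖ ≤ L ∧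
        ‖pert μt g e x - ms‖ < ρ ∧
        (∀ m : ℂ, ‖m - ms‖ < ρ → (H (x * Complex.I + e * m.re, m) = 0 ↔ m = pert μt g e x) ∧
          E (x * Complex.I + e * m.re, m)) ∧
        ∀ x' ∈ Ioo (ωs - a) (ωs + a), ∀ e' ∈ Ico 0 ε₀,
          ‖pert μt g e x - pert μt g e' x'‖ ≤ L * (|x - x'| + |e - e'|) := by
  obtain ⟨l, hl, hl0, hlH⟩ := exists_implicit_curve hH h0 hd
  obtain ⟨g, hg, hgl⟩ := exists_pert hl
  set b : ℂ := ωs * Complex.I with hb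
  set μt : ℝ → ℂ := fun ω => l (ω * Complex.I) with hμt
  have hμs : μt ωs = ms := hl0
  -- The order `⊤` means analyticity, which spreads from a point to a neighbourhood; infinite
  -- differentiability at a point would not.
  have hne : (⊤ : WithTop ℕ∞) ≠ ((⊤ : ℕ∞) : WithTop ℕ∞) := by simp
  obtain ⟨K, t, ht, hK⟩ := (hl.of_le le_top).exists_lipschitzOnWith (𝕂 := ℂ)
  obtain ⟨s₁, hs₁, hs₁t⟩ := Metric.mem_nhds_iff.1 ht
  obtain ⟨ρ, hρ, hρE⟩ := Metric.eventually_nhds_iff.1 (hlH.and hE)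
  have hμts : ContDiffAt ℝ ⊤ μt ωs := contDiffAt_curve hl
  set P : ℝ × ℝ → ℂ := fun p => pert μt g p.2 p.1 with hP
  have hP0 : P (ωs, 0) = ms := (pert_zero μt g ωs).trans hμs
  have hμf : ContDiffAt ℝ ⊤ (fun p : ℝ × ℝ => μt p.1) (ωs, 0) :=
    ContDiffAt.comp (g := μt) (f := fun p : ℝ × ℝ => p.1) _ hμts contDiff_fst.contDiffAt
  have hPs : ContDiffAt ℝ ⊤ P (ωs, 0) :=
    hμf.add (((contDiff_ofReal_complex.comp contDiff_snd).contDiffAt.mul hg).mul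
      (contDiff_ofReal_complex.contDiffAt.comp _ (contDiff_re_complex.contDiffAt.comp _ hμf)))
  obtain ⟨K', t', ht', hK'⟩ := (hPs.of_le le_top).exists_lipschitzOnWith (𝕂 := ℝ)
  have c1 : ∀ᶠ p : ℝ × ℝ in 𝓝 (ωs, 0), ContDiffAt ℝ ⊤ μt p.1 :=
    continuous_fst.continuousAt.eventually (hμts.eventually hne)
  have c2 : ∀ᶠ p : ℝ × ℝ in 𝓝 (ωs, 0), ‖g p.1 p.2‖ < ‖g ωs 0‖ + 1 :=
    hg.continuousAt.norm.eventually_lt continuousAt_const (by simp)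
  have c3 : ∀ᶠ p : ℝ × ℝ in 𝓝 (ωs, 0), ‖P p - ms‖ < ρ :=
    (hPs.continuousAt.sub continuousAt_const).norm.eventually_lt continuousAt_const
      (by simpa [hP0] using hρ)
  -- Since |Re m| ≤ ‖ms‖ + ρ on the disc, this keeps iω + ε Re m near the base point uniformly in m.
  have c4 : ∀ᶠ p : ℝ × ℝ in 𝓝 (ωs, 0), |p.1 - ωs| + |p.2| * (‖ms‖ + ρ) < min ρ s₁ := by
    have h : Continuous fun p : ℝ × ℝ => |p.1 - ωs| + |p.2| * (‖ms‖ + ρ) := by fun_prop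
    exact h.continuousAt.eventually_lt continuousAt_const (by simpa using ⟨hρ, hs₁⟩)
  -- This makes m ↦ l(iω + ε Re m) a contraction on the disc, so that the perturbed curve is its
  -- only fixed point there.
  have c5 : ∀ᶠ p : ℝ × ℝ in 𝓝 (ωs, 0), K * |p.2| < 1 := by
    have h : Continuous fun p : ℝ × ℝ => K * |p.2| := by fun_prop
    exact h.continuousAt.eventually_lt continuousAt_const (by simp)
  obtain ⟨r, hr, hr'⟩ := Metric.eventually_nhds_iff.1
    (c1.and <| c2.and <| c3.and <| c4.and <| c5.and <| hgl.and <|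
      (hg.eventually hne).and <| eventually_mem_set.2 ht')
  have hdist : ∀ x ∈ Ioo (ωs - r) (ωs + r), ∀ e ∈ Ico 0 r, dist (x, e) (ωs, (0 : ℝ)) < r := by
    intro x hx e he
    rw [Prod.dist_eq, max_lt_iff, Real.dist_eq, Real.dist_eq, sub_zero, abs_of_nonneg he.1, abs_lt]
    exact ⟨⟨by linarith [hx.1], by linarith [hx.2]⟩, he.2⟩
  refine ⟨r, r, ρ, max K' (‖g ωs 0‖ + 1), μt, g, hr, hr, hρ, le_max_of_le_left K'.2, hμs,
    fun x hx => ⟨(hr' (hdist x hx 0 ⟨le_rfl, hr⟩)).1, fun e he => ?_⟩⟩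
  obtain ⟨-, d2, d3, d4, d5, d6, d7, d8⟩ := hr' (hdist x hx e he)
  simp only at d2 d3 d4 d5 d6
  have hclose : ∀ m : ℂ, ‖m - ms‖ < ρ → ‖(x * Complex.I + e * m.re : ℂ) - b‖ < min ρ s₁ := by
    intro m hm
    refine lt_of_le_of_lt ?_ d4
    have h1 : (x * Complex.I + e * m.re : ℂ) - b =
        ((x - ωs : ℝ) : ℂ) * Complex.I + ((e * m.re : ℝ) : ℂ) := by
      rw [hb]
      push_cast
      ring
    rw [h1]
    refine (norm_add_le _ _).trans (add_le_add ?_ ?_)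
    · rw [norm_mul, Complex.norm_I, mul_one, Complex.norm_real, Real.norm_eq_abs]
    · rw [Complex.norm_real, Real.norm_eq_abs, abs_mul]
      have h2 : ‖m‖ ≤ ‖ms‖ + ρ := by linarith [norm_le_norm_add_norm_sub' m ms]
      gcongr
      exact (Complex.abs_re_le_norm m).trans h2
  have hpair : ∀ m : ℂ, ‖m - ms‖ < ρ →
      dist ((x * Complex.I + e * m.re, m) : ℂ × ℂ) (b, ms) < ρ := by
    intro m hm
    rw [Prod.dist_eq, max_lt_iff, dist_eq_norm, dist_eq_norm]
    exact ⟨(hclose m hm).trans_le (min_le_left _ _), hm⟩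
  refine ⟨d7, d2.le.trans (le_max_right _ _), d3, fun m hm => ⟨?_, (hρE (hpair m hm)).2⟩,
    fun x' hx' e' he' => ?_⟩
  · rw [(hρE (hpair m hm)).1]
    simp only
    constructor
    · intro h
      set p := pert μt g e x with hp
      have h1 : dist (l (x * Complex.I + e * m.re)) (l (x * Complex.I + e * p.re)) ≤
          K * dist (x * Complex.I + e * m.re : ℂ) (x * Complex.I + e * p.re) :=
        hK.dist_le_mul _ (hs₁t (by
          rw [Metric.mem_ball, dist_eq_norm]
          exact (hclose m hm).trans_le (min_le_right _ _))) _ (hs₁t (by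
          rw [Metric.mem_ball, dist_eq_norm]
          exact (hclose p d3).trans_le (min_le_right _ _)))
      rw [← h, ← d6] at h1
      have h2 : dist (x * Complex.I + e * m.re : ℂ) (x * Complex.I + e * p.re) ≤
          |e| * dist m p := by
        have e1 : (x * Complex.I + e * m.re : ℂ) - (x * Complex.I + e * p.re) =
            ((e * (m - p).re : ℝ) : ℂ) := by
          rw [Complex.sub_re]
          push_cast
          ring
        rw [dist_eq_norm, dist_eq_norm, e1, Complex.norm_real, Real.norm_eq_abs, abs_mul]
        gcongr
        exact Complex.abs_re_le_norm _
      by_contra hmp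
      have h3 : 0 < dist m p := dist_pos.2 hmp
      have h4 : dist m p ≤ K * (|e| * dist m p) :=
        h1.trans (mul_le_mul_of_nonneg_left h2 K.2)
      nlinarith
    · rintro rfl
      exact d6
  · have d8' := (hr' (hdist x' hx' e' he')).2.2.2.2.2.2.2
    have h := hK'.dist_le_mul _ d8 _ d8'
    rw [dist_eq_norm, Prod.dist_eq, Real.dist_eq, Real.dist_eq] at h
    refine h.trans ?_
    gcongr
    · exact le_max_left _ _
    · exact max_le_add_of_nonneg (abs_nonneg _) (abs_nonneg _)

/-! ### Regular points of the characteristic function -/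

theorem hasDerivAt_charFun_snd (S : PeriodicDDE n) {R : ℝ} (hR : 0 ≤ R) (hk : S.charBound R < k)
    {μ z : ℂ} (h : (μ, z) ∈ admissible R) :
    HasDerivAt (fun w => S.charFun k μ w)
      (fderiv ℂ (fun p : ℂ × ℂ => S.charFun k p.1 p.2) (μ, z) (0, 1)) z := by
  have h1 := ((S.contDiffAt_charFun hR hk (m := 1) h).differentiableAt (by simp)).hasFDerivAt
  exact h1.comp_hasDerivAt z ((hasDerivAt_const z μ).prodMk (hasDerivAt_id z))

theorem charFunDeriv₂_eq (S : PeriodicDDE n) {R : ℝ} (hR : 0 ≤ R) (hk : S.charBound R < k)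
    {μ z : ℂ} (h : (μ, z) ∈ admissible R) : S.charFunDeriv₂ k μ z =
      fderiv ℂ (fun p : ℂ × ℂ => S.charFun k p.1 p.2) (μ, z) (0, 1) :=
  (S.hasDerivAt_charFun_snd hR hk h).deriv

/-- The chain rule gives ∂₁h - (N+τ)z ∂₂h, whose nonvanishing is the simplicity of the zero. -/
theorem deriv_charFun_exp (S : PeriodicDDE n) {R : ℝ} (hR : 0 ≤ R) (hk : S.charBound R < k)
    {N : ℕ} {μ : ℂ} (h : (μ, Complex.exp (-(μ * S.delay N))) ∈ admissible R) :
    deriv (fun s => S.charFun k s (Complex.exp (-(s * S.delay N)))) μ =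
      fderiv ℂ (fun p : ℂ × ℂ => S.charFun k p.1 p.2) (μ, Complex.exp (-(μ * S.delay N)))
        (1, -S.delay N * Complex.exp (-(μ * S.delay N))) := by
  have h1 := ((S.contDiffAt_charFun hR hk (m := 1) h).differentiableAt (by simp)).hasFDerivAt
  have h2 : HasDerivAt (fun s : ℂ => Complex.exp (-(s * S.delay N)))
      (-S.delay N * Complex.exp (-(μ * S.delay N))) μ := by
    have := (((hasDerivAt_id μ).mul_const (S.delay N : ℂ)).neg).cexp
    simpa [mul_comm] using this
  exact (h1.comp_hasDerivAt μ ((hasDerivAt_id μ).prodMk h2)).deriv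

/-- The points `(μ, m)` at which `z = exp(-m)` is a regular root parameter and the scaled
characteristic equation is nondegenerate for all delays `r ≥ r₀`. -/
def IsRegular (S : PeriodicDDE n) (k : ℕ) (R r₀ : ℝ) (v : ℂ × ℂ) : Prop :=
  (v.1, Complex.exp (-v.2)) ∈ admissible R ∧ S.charFunDeriv₂ k v.1 (Complex.exp (-v.2)) ≠ 0 ∧
    ∀ r : ℝ, r₀ ≤ r → fderiv ℂ (fun p : ℂ × ℂ => S.charFun k p.1 p.2)
      (v.1, Complex.exp (-v.2)) (1, -r * Complex.exp (-v.2)) ≠ 0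

theorem continuous_exp_neg_snd :
    Continuous fun v : ℂ × ℂ => ((v.1, Complex.exp (-v.2)) : ℂ × ℂ) := by
  fun_prop

/-- With A = ∂₁h and B = z∂₂h the quantity in question is A - rB. Near the base point ‖A‖ stays
below ‖A v₀‖ + 1 and ‖B‖ above ‖B v₀‖/2, so one threshold for r serves a whole neighbourhood. -/
theorem exists_eventually_isRegular (S : PeriodicDDE n) {R : ℝ} (hR : 0 ≤ R)
    (hk : S.charBound R < k) {v₀ : ℂ × ℂ} (hadm : (v₀.1, Complex.exp (-v₀.2)) ∈ admissible R)
    (hreg : S.charFunDeriv₂ k v₀.1 (Complex.exp (-v₀.2)) ≠ 0) :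
    ∃ r₀ : ℝ, ∀ᶠ v in 𝓝 v₀, S.IsRegular k R r₀ v := by
  set F := fun p : ℂ × ℂ => fderiv ℂ (fun p : ℂ × ℂ => S.charFun k p.1 p.2) p with hF
  have hFc : ContinuousAt (fun v : ℂ × ℂ => F (v.1, Complex.exp (-v.2))) v₀ := by
    have h1 : ContinuousAt F (v₀.1, Complex.exp (-v₀.2)) :=
      ((S.contDiffAt_charFun hR hk (m := 1) hadm).fderiv_right (m := 0) le_rfl).continuousAt
    exact ContinuousAt.comp (f := fun v : ℂ × ℂ => ((v.1, Complex.exp (-v.2)) : ℂ × ℂ)) h1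
      continuous_exp_neg_snd.continuousAt
  have hA : ContinuousAt (fun v : ℂ × ℂ => F (v.1, Complex.exp (-v.2)) (1, 0)) v₀ :=
    hFc.clm_apply continuousAt_const
  have hB : ContinuousAt (fun v : ℂ × ℂ => F (v.1, Complex.exp (-v.2)) (0, 1)) v₀ :=
    hFc.clm_apply continuousAt_const
  have hz : ContinuousAt (fun v : ℂ × ℂ => Complex.exp (-v.2)) v₀ := by fun_prop
  set A : ℂ × ℂ → ℂ := fun v => F (v.1, Complex.exp (-v.2)) (1, 0)
  set B : ℂ × ℂ → ℂ := fun v => Complex.exp (-v.2) * F (v.1, Complex.exp (-v.2)) (0, 1) with hBd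
  have hB0 : 0 < ‖B v₀‖ := by
    rw [norm_pos_iff, hBd]
    refine mul_ne_zero (Complex.exp_ne_zero _) ?_
    rwa [S.charFunDeriv₂_eq hR hk hadm] at hreg
  have hadm' : ∀ᶠ v : ℂ × ℂ in 𝓝 v₀, (v.1, Complex.exp (-v.2)) ∈ admissible R :=
    continuous_exp_neg_snd.continuousAt.eventually ((isOpen_admissible R).mem_nhds hadm)
  refine ⟨2 * (‖A v₀‖ + 1) / ‖B v₀‖, ?_⟩
  have hBc : ContinuousAt B v₀ := hz.mul hB
  filter_upwards [hadm', hA.norm.eventually_lt (continuousAt_const (y := ‖A v₀‖ + 1)) (by simp [A]),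
    (continuousAt_const (y := ‖B v₀‖ / 2)).eventually_lt hBc.norm (by linarith)]
    with v h1 h2 h3
  have h3' : 0 < ‖B v‖ := by linarith
  refine ⟨h1, ?_, fun r hr h0 => ?_⟩
  · rw [S.charFunDeriv₂_eq hR hk h1]
    exact right_ne_zero_of_mul (norm_pos_iff.1 h3')
  · have e : ((1, -r * Complex.exp (-v.2)) : ℂ × ℂ) =
        (1, 0) - ((r : ℂ) * Complex.exp (-v.2)) • ((0, 1) : ℂ × ℂ) := by simp
    rw [e, map_sub, map_smul, smul_eq_mul, sub_eq_zero, mul_assoc] at h0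
    have h4 := congr_arg norm h0
    rw [norm_mul, Complex.norm_real, Real.norm_eq_abs] at h4
    rw [div_le_iff₀ hB0] at hr
    have h5 : 0 < r := by
      by_contra hr0
      nlinarith [norm_nonneg (A v₀)]
    rw [abs_of_pos h5] at h4
    have h6 : r * (‖B v₀‖ / 2) < ‖A v₀‖ + 1 := by
      calc r * (‖B v₀‖ / 2) ≤ r * ‖B v‖ := by
            gcongr
        _ = _ := h4.symm
        _ < _ := h2
    linarith

/-! ### Scaled exponents near the perturbed curve -/

/-- The point `γ + i((N+τ)ω - 2jπ)` of the spectral surface over the scaled exponent `γ + iω`. -/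
def phasePoint (S : PeriodicDDE n) (N : ℕ) (γ ω : ℝ) (j : ℤ) : ℂ :=
  ⟨γ, S.delay N * ω - 2 * j * Real.pi⟩

/-- The real part of `phasePoint` does not involve j. Together with `exp_neg_unscale_mul_delay` this
puts the characteristic equation into the form h(iω + ε Re m, e^{-m}) = 0. -/
theorem unscale_eq (S : PeriodicDDE n) (N : ℕ) (γ ω : ℝ) (j : ℤ) :
    S.unscale N γ ω =
      ω * Complex.I + ((1 / S.delay N : ℝ) : ℂ) * (S.phasePoint N γ ω j).re := by
  rw [unscale, phasePoint]
  push_cast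
  ring

theorem exp_neg_unscale_mul_delay (S : PeriodicDDE n) {N : ℕ} (hN : 1 ≤ N) (γ ω : ℝ) (j : ℤ) :
    Complex.exp (-(S.unscale N γ ω * S.delay N)) = Complex.exp (-S.phasePoint N γ ω j) := by
  have hr : (S.delay N : ℂ) ≠ 0 := by
    have := S.one_le_delay hN
    rw [Complex.ofReal_ne_zero]
    positivity
  refine Complex.exp_eq_exp_iff_exists_int.2 ⟨-j, ?_⟩
  rw [unscale, phasePoint, Complex.mk_eq_add_mul_I]
  push_cast
  field_simp
  ring

/-- Near a regular point, a scaled exponent is algebraically simple if the delay is large. -/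
theorem IsScaledFloquetExponent.simple {S : PeriodicDDE n} {R : ℝ} (hR : 0 ≤ R)
    (hk : S.charBound R < k) {N : ℕ} (hN : 1 ≤ N) {r₀ γ ω : ℝ} (j : ℤ) (hr : r₀ ≤ S.delay N)
    (hreg : S.IsRegular k R r₀ (S.unscale N γ ω, S.phasePoint N γ ω j))
    (h : S.IsScaledFloquetExponent N γ ω) : S.IsSimpleScaledFloquetExponent N γ ω := by
  obtain ⟨hadm, -, h2⟩ := hreg
  have e := S.exp_neg_unscale_mul_delay hN γ ω j
  have h3 := h2 _ hr
  simp only at hadm h3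
  rw [← e] at hadm h3
  refine ⟨h, S.finrank_maxGenEigenspace_eq_one hR hk hadm ?_ hN h⟩
  rwa [S.deriv_charFun_exp hR hk hadm]

theorem isScaledFloquetExponent_iff (S : PeriodicDDE n) {R : ℝ} (hR : 0 ≤ R)
    (hk : S.charBound R < k) {N : ℕ} (hN : 1 ≤ N) {γ ω : ℝ} (j : ℤ)
    (hadm : (S.unscale N γ ω, Complex.exp (-S.phasePoint N γ ω j)) ∈ admissible R) :
    S.IsScaledFloquetExponent N γ ω ↔
      S.charFun k (S.unscale N γ ω) (Complex.exp (-S.phasePoint N γ ω j)) = 0 := by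
  rw [← S.exp_neg_unscale_mul_delay hN γ ω j] at hadm ⊢
  exact S.isFloquetExponent_iff hN (S.isUnit_of_mem_admissible hR hk
    (p := (S.unscale N γ ω, Complex.exp (-(S.unscale N γ ω * S.delay N)))) hadm)

/-! ### The phase equation along the perturbed curve -/

/-- `μt` and `g` describe the solutions `m` of `h(iω + ε Re m, exp(-m)) = 0` near `ms`. -/
structure IsPertCurve (S : PeriodicDDE n) (k : ℕ) (R r₀ ωs : ℝ) (ms : ℂ) (a ε₀ ρ L : ℝ)
    (μt : ℝ → ℂ) (g : ℝ → ℝ → ℂ) : Prop where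
  a_pos : 0 < a
  ε₀_pos : 0 < ε₀
  ρ_pos : 0 < ρ
  L_nonneg : 0 ≤ L
  base : μt ωs = ms
  norm_lt : ∀ x ∈ Ioo (ωs - a) (ωs + a), ∀ e ∈ Ico 0 ε₀, ‖pert μt g e x - ms‖ < ρ
  root_iff : ∀ x ∈ Ioo (ωs - a) (ωs + a), ∀ e ∈ Ico 0 ε₀, ∀ m : ℂ, ‖m - ms‖ < ρ →
    (S.charFun k (x * Complex.I + e * m.re) (Complex.exp (-m)) = 0 ↔ m = pert μt g e x)
  regular : ∀ x ∈ Ioo (ωs - a) (ωs + a), ∀ e ∈ Ico 0 ε₀, ∀ m : ℂ, ‖m - ms‖ < ρ →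
    S.IsRegular k R r₀ (x * Complex.I + e * m.re, m)
  lipschitz : ∀ x ∈ Ioo (ωs - a) (ωs + a), ∀ e ∈ Ico 0 ε₀, ∀ x' ∈ Ioo (ωs - a) (ωs + a),
    ∀ e' ∈ Ico 0 ε₀, ‖pert μt g e x - pert μt g e' x'‖ ≤ L * (|x - x'| + |e - e'|)

section PertCurve

variable {S : PeriodicDDE n} {R r₀ ωs : ℝ} {ms : ℂ} {a ε₀ ρ L : ℝ}
  {μt : ℝ → ℂ} {g : ℝ → ℝ → ℂ}

theorem solvesPhaseEq_iff {N : ℕ} (hN : 1 ≤ N) {j : ℤ} {ω : ℝ} : S.SolvesPhaseEq N μt g j ω ↔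
    S.delay N * ω - 2 * j * Real.pi = pertIm μt g (1 / S.delay N) ω := by
  have hr : 0 < S.delay N := zero_lt_one.trans_le (S.one_le_delay hN)
  rw [SolvesPhaseEq, freq, ← add_div, eq_div_iff hr.ne']
  constructor <;> intro h <;> linarith

theorem inv_delay_mem {N : ℕ} (hε : 1 / S.delay N < ε₀) : 1 / S.delay N ∈ Ico 0 ε₀ :=
  ⟨one_div_nonneg.2 (S.delay_nonneg N), hε⟩

namespace IsPertCurve

theorem regular_unscale {k : ℕ} (h : IsPertCurve S k R r₀ ωs ms a ε₀ ρ L μt g) {N : ℕ}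
    (hε : 1 / S.delay N < ε₀) {ω γ : ℝ} (hω : ω ∈ Ioo (ωs - a) (ωs + a)) {j : ℤ}
    (hm : ‖S.phasePoint N γ ω j - ms‖ < ρ) :
    S.IsRegular k R r₀ (S.unscale N γ ω, S.phasePoint N γ ω j) := by
  rw [S.unscale_eq N γ ω j]
  exact h.regular ω hω _ (inv_delay_mem hε) _ hm

/-- The complex equation m = μ̃ + εgγ̃ splits: its imaginary part is the phase equation and its real
part determines γ. -/
theorem isScaled_iff (h : IsPertCurve S k R r₀ ωs ms a ε₀ ρ L μt g) (hR : 0 ≤ R)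
    (hk : S.charBound R < k) {N : ℕ} (hN : 1 ≤ N) (hε : 1 / S.delay N < ε₀) {ω γ : ℝ}
    (hω : ω ∈ Ioo (ωs - a) (ωs + a)) {j : ℤ} (hm : ‖S.phasePoint N γ ω j - ms‖ < ρ) :
    S.IsScaledFloquetExponent N γ ω ↔
      S.SolvesPhaseEq N μt g j ω ∧ γ = pertRe μt g (1 / S.delay N) ω := by
  rw [S.isScaledFloquetExponent_iff hR hk hN j (h.regular_unscale hε hω hm).1,
    S.unscale_eq N γ ω j, h.root_iff ω hω _ (inv_delay_mem hε) _ hm, Complex.ext_iff, pert_re,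
    pert_im, solvesPhaseEq_iff hN, and_comm]
  rfl

theorem isSimple (h : IsPertCurve S k R r₀ ωs ms a ε₀ ρ L μt g) (hR : 0 ≤ R)
    (hk : S.charBound R < k) {N : ℕ} (hN : 1 ≤ N) (hε : 1 / S.delay N < ε₀)
    (hr : r₀ ≤ S.delay N) {ω : ℝ}
    (hω : ω ∈ Ioo (ωs - a) (ωs + a)) {j : ℤ} (hs : S.SolvesPhaseEq N μt g j ω) :
    S.IsSimpleScaledFloquetExponent N (pertRe μt g (1 / S.delay N) ω) ω := by
  have e : S.phasePoint N (pertRe μt g (1 / S.delay N) ω) ω j = pert μt g (1 / S.delay N) ω := by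
    rw [phasePoint, (solvesPhaseEq_iff hN).1 hs, ← pert_re, ← pert_im]
  have hm : ‖S.phasePoint N (pertRe μt g (1 / S.delay N) ω) ω j - ms‖ < ρ := by
    rw [e]
    exact h.norm_lt ω hω _ (inv_delay_mem hε)
  exact ((h.isScaled_iff hR hk hN hε hω hm).2 ⟨hs, rfl⟩).simple hR hk hN j hr
    (h.regular_unscale hε hω hm)

theorem abs_pertIm_le {k : ℕ} (h : IsPertCurve S k R r₀ ωs ms a ε₀ ρ L μt g) {x e : ℝ}
    (hx : x ∈ Ioo (ωs - a) (ωs + a)) (he : e ∈ Ico 0 ε₀) :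
    |pertIm μt g e x| ≤ ‖ms‖ + ρ := by
  rw [← pert_im]
  refine (Complex.abs_im_le_norm _).trans ?_
  linarith [norm_le_norm_add_norm_sub' (pert μt g e x) ms, h.norm_lt x hx e he]

theorem abs_pertIm_sub_le {k : ℕ} (h : IsPertCurve S k R r₀ ωs ms a ε₀ ρ L μt g) {x e x' e' : ℝ}
    (hx : x ∈ Ioo (ωs - a) (ωs + a)) (he : e ∈ Ico 0 ε₀) (hx' : x' ∈ Ioo (ωs - a) (ωs + a))
    (he' : e' ∈ Ico 0 ε₀) :
    |pertIm μt g e x - pertIm μt g e' x'| ≤ L * (|x - x'| + |e - e'|) := by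
  rw [← pert_im, ← pert_im, ← Complex.sub_im]
  exact (Complex.abs_im_le_norm _).trans (h.lipschitz x hx e he x' hx' e' he')

theorem continuousOn_pertIm {k : ℕ} (h : IsPertCurve S k R r₀ ωs ms a ε₀ ρ L μt g) {e : ℝ}
    (he : e ∈ Ico 0 ε₀) : ContinuousOn (pertIm μt g e) (Ioo (ωs - a) (ωs + a)) := by
  refine LipschitzOnWith.continuousOn (K := L.toNNReal)
    (LipschitzOnWith.of_dist_le_mul fun x hx y hy => ?_)
  rw [Real.dist_eq, Real.dist_eq, Real.coe_toNNReal _ h.L_nonneg]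
  simpa using h.abs_pertIm_sub_le hx he hy he

/-- Solutions of the phase equation lie close to the frequencies. -/
theorem abs_sub_freq_le {k : ℕ} (h : IsPertCurve S k R r₀ ωs ms a ε₀ ρ L μt g) {N : ℕ}
    (hε : 1 / S.delay N < ε₀) {ω : ℝ} (hω : ω ∈ Ioo (ωs - a) (ωs + a))
    {j : ℤ} (hs : S.SolvesPhaseEq N μt g j ω) :
    |ω - S.freq N j| ≤ (‖ms‖ + ρ) / S.delay N := by
  have e : ω - S.freq N j = pertIm μt g (1 / S.delay N) ω / S.delay N := sub_eq_of_eq_add hs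
  rw [e, abs_div, abs_of_nonneg (S.delay_nonneg N)]
  exact div_le_div_of_nonneg_right (h.abs_pertIm_le hω (inv_delay_mem hε)) (S.delay_nonneg N)

/-- Subtracting the two equations gives (N+τ)|ω - ω'| ≤ L|ω - ω'|, which is impossible for distinct
points once L < N + τ. -/
theorem phaseEq_unique {k : ℕ} (h : IsPertCurve S k R r₀ ωs ms a ε₀ ρ L μt g) {N : ℕ} (hN : 1 ≤ N)
    (hε : 1 / S.delay N < ε₀) (hL : L < S.delay N) {ω ω' : ℝ} (hω : ω ∈ Ioo (ωs - a) (ωs + a))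
    (hω' : ω' ∈ Ioo (ωs - a) (ωs + a)) {j : ℤ} (hs : S.SolvesPhaseEq N μt g j ω)
    (hs' : S.SolvesPhaseEq N μt g j ω') : ω = ω' := by
  have h1 := h.abs_pertIm_sub_le hω (inv_delay_mem hε) hω' (inv_delay_mem hε)
  rw [← (solvesPhaseEq_iff hN).1 hs, ← (solvesPhaseEq_iff hN).1 hs', sub_sub_sub_cancel_right,
    ← mul_sub, abs_mul, abs_of_nonneg (S.delay_nonneg N), sub_self, abs_zero, add_zero] at h1
  by_contra hne
  have := abs_pos.2 (sub_ne_zero.2 hne)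
  nlinarith

/-- The frequency is within δ of ωs and the phase shifts it by less than δ/2. Hence the difference
of the two sides changes sign on [ωs - 3δ/2, ωs + 3δ/2], and the zero lies well inside the
2δ-interval. -/
theorem exists_phaseEq {k : ℕ} (h : IsPertCurve S k R r₀ ωs ms a ε₀ ρ L μt g) {N : ℕ} (hN : 1 ≤ N)
    (hε : 1 / S.delay N < ε₀) {δ : ℝ} (hδ : 0 < δ) (hδa : 2 * δ ≤ a)
    (hF : 2 * (‖ms‖ + ρ) < δ * S.delay N) {j : ℤ} (hj : S.freq N j ∈ Ioo (ωs - δ) (ωs + δ)) :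
    ∃ ω ∈ Ioo (ωs - 2 * δ) (ωs + 2 * δ), S.SolvesPhaseEq N μt g j ω := by
  have hr : 0 < S.delay N := zero_lt_one.trans_le (S.one_le_delay hN)
  have hsub : Icc (ωs - 3 / 2 * δ) (ωs + 3 / 2 * δ) ⊆ Ioo (ωs - a) (ωs + a) := fun x hx =>
    ⟨by linarith [hx.1], by linarith [hx.2]⟩
  have hb : ∀ x ∈ Icc (ωs - 3 / 2 * δ) (ωs + 3 / 2 * δ),
      |pertIm μt g (1 / S.delay N) x / S.delay N| < δ / 2 := by
    intro x hx
    rw [abs_div, abs_of_pos hr, div_lt_iff₀ hr]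
    linarith [h.abs_pertIm_le (hsub hx) (inv_delay_mem hε)]
  have hc : ContinuousOn (fun x => x - (pertIm μt g (1 / S.delay N) x / S.delay N + S.freq N j))
      (Icc (ωs - 3 / 2 * δ) (ωs + 3 / 2 * δ)) :=
    continuousOn_id.sub ((((h.continuousOn_pertIm (inv_delay_mem hε)).mono hsub).div_const _).add
      continuousOn_const)
  have hle : ωs - 3 / 2 * δ ≤ ωs + 3 / 2 * δ := by linarith
  have h1 := abs_lt.1 (hb _ (left_mem_Icc.2 hle))
  have h2 := abs_lt.1 (hb _ (right_mem_Icc.2 hle))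
  obtain ⟨ω, hω, hω0⟩ := intermediate_value_Icc hle hc
    (show (0 : ℝ) ∈ Icc _ _ from ⟨by linarith [hj.1], by linarith [hj.2]⟩)
  exact ⟨ω, ⟨by linarith [hω.1], by linarith [hω.2]⟩, sub_eq_zero.1 hω0⟩

/-- The phase at (ω, 1/(N+τ)) is compared with the unperturbed phase at the frequency. Both
arguments move by O(1/(N+τ)), and the phase equation divides the Lipschitz error by N + τ once more.
-/
theorem abs_sub_asymptotic_le {k : ℕ} (h : IsPertCurve S k R r₀ ωs ms a ε₀ ρ L μt g) {N : ℕ} (hN : 1 ≤ N)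
    (hε : 1 / S.delay N < ε₀) {ω : ℝ} (hω : ω ∈ Ioo (ωs - a) (ωs + a)) {j : ℤ}
    (hj : S.freq N j ∈ Ioo (ωs - a) (ωs + a)) (hs : S.SolvesPhaseEq N μt g j ω) :
    |ω - (S.freq N j + (μt (S.freq N j)).im / S.delay N)| ≤
      L * (‖ms‖ + ρ + 1) / S.delay N ^ 2 := by
  have hr : 0 < S.delay N := zero_lt_one.trans_le (S.one_le_delay hN)
  have h1 := h.abs_pertIm_sub_le hω (inv_delay_mem hε) hj ⟨le_rfl, h.ε₀_pos⟩
  rw [← pert_im _ _ 0, pert_zero, sub_zero, abs_of_nonneg (one_div_nonneg.2 hr.le)] at h1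
  have e : ω - (S.freq N j + (μt (S.freq N j)).im / S.delay N) =
      (pertIm μt g (1 / S.delay N) ω - (μt (S.freq N j)).im) / S.delay N := by
    have hs' : ω = pertIm μt g (1 / S.delay N) ω / S.delay N + S.freq N j := hs
    rw [sub_div, ← sub_eq_of_eq_add hs']
    ring
  rw [e, abs_div, abs_of_pos hr, pow_two, ← div_div]
  refine div_le_div_of_nonneg_right (h1.trans ?_) hr.le
  rw [mul_div_assoc]
  refine mul_le_mul_of_nonneg_left ?_ h.L_nonneg
  rw [add_div]
  exact add_le_add_left (h.abs_sub_freq_le hε hω hs) _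

/-- Consecutive frequencies account for 2π/(N+τ) exactly; what remains is a phase difference over a
gap of size O(1/(N+τ)), divided by N + τ. -/
theorem abs_spacing_le {k : ℕ} (h : IsPertCurve S k R r₀ ωs ms a ε₀ ρ L μt g) {N : ℕ} (hN : 1 ≤ N)
    (hε : 1 / S.delay N < ε₀) {ω ω' : ℝ} (hω : ω ∈ Ioo (ωs - a) (ωs + a))
    (hω' : ω' ∈ Ioo (ωs - a) (ωs + a)) {j : ℤ}
    (hs : S.SolvesPhaseEq N μt g j ω) (hs' : S.SolvesPhaseEq N μt g (j + 1) ω') :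
    |ω' - ω - 2 * Real.pi / S.delay N| ≤
      L * (2 * (‖ms‖ + ρ) + 2 * Real.pi) / S.delay N ^ 2 := by
  have hr : 0 < S.delay N := zero_lt_one.trans_le (S.one_le_delay hN)
  have h1 := h.abs_pertIm_sub_le hω' (inv_delay_mem hε) hω (inv_delay_mem hε)
  rw [sub_self, abs_zero, add_zero] at h1
  have hf : S.freq N (j + 1) = S.freq N j + 2 * Real.pi / S.delay N := by
    rw [freq, freq]
    push_cast
    ring
  have h2 := abs_le.1 (h.abs_sub_freq_le hε hω hs)
  have h3 := abs_le.1 (h.abs_sub_freq_le hε hω' hs')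
  have h4 : 0 ≤ 2 * Real.pi / S.delay N := by positivity
  have h5 : |ω' - ω| ≤ (2 * (‖ms‖ + ρ) + 2 * Real.pi) / S.delay N := by
    rw [add_div, mul_div_assoc, abs_le]
    constructor <;> linarith [h2.1, h2.2, h3.1, h3.2]
  have e : ω' - ω - 2 * Real.pi / S.delay N =
      (pertIm μt g (1 / S.delay N) ω' - pertIm μt g (1 / S.delay N) ω) / S.delay N := by
    have e1 : ω = pertIm μt g (1 / S.delay N) ω / S.delay N + S.freq N j := hs
    have e2 : ω' = pertIm μt g (1 / S.delay N) ω' / S.delay N + S.freq N (j + 1) := hs'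
    rw [sub_div, ← sub_eq_of_eq_add e1, ← sub_eq_of_eq_add e2, hf]
    ring
  rw [e, abs_div, abs_of_pos hr, pow_two, ← div_div]
  refine div_le_div_of_nonneg_right (h1.trans ?_) hr.le
  rw [mul_div_assoc]
  exact mul_le_mul_of_nonneg_left h5 h.L_nonneg

/-- Scaled exponents near the base point whose phase is close to the base phase. -/
theorem of_phase_close (h : IsPertCurve S k R r₀ ωs ms a ε₀ ρ L μt g) (hR : 0 ≤ R)
    (hk : S.charBound R < k) {N : ℕ} (hN : 1 ≤ N) (hε : 1 / S.delay N < ε₀)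
    (hr : r₀ ≤ S.delay N) {δ : ℝ} (hδ : 0 < δ) (hδa : 2 * δ ≤ a)
    (hF : 2 * (‖ms‖ + ρ) < δ * S.delay N) {γ ω : ℝ} {j : ℤ}
    (hs : S.IsScaledFloquetExponent N γ ω) (hγ : |γ - ms.re| < ρ / 2) (hω : |ω - ωs| < δ / 2)
    (hφ : |S.delay N * ω - 2 * j * Real.pi - ms.im| < ρ / 2) :
    S.IsSimpleScaledFloquetExponent N γ ω ∧ S.freq N j ∈ Ioo (ωs - δ) (ωs + δ) ∧
      ω ∈ Ioo (ωs - 2 * δ) (ωs + 2 * δ) ∧ S.SolvesPhaseEq N μt g j ω ∧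
      γ = pertRe μt g (1 / S.delay N) ω := by
  have hr0 : 0 < S.delay N := zero_lt_one.trans_le (S.one_le_delay hN)
  rw [abs_lt] at hω
  have hω2 : ω ∈ Ioo (ωs - 2 * δ) (ωs + 2 * δ) := ⟨by linarith, by linarith⟩
  have hωa : ω ∈ Ioo (ωs - a) (ωs + a) := ⟨by linarith [hω2.1], by linarith [hω2.2]⟩
  have hm : ‖S.phasePoint N γ ω j - ms‖ < ρ := by
    refine (Complex.norm_le_abs_re_add_abs_im _).trans_lt ?_
    rw [Complex.sub_re, Complex.sub_im]
    change |γ - ms.re| + |S.delay N * ω - 2 * j * Real.pi - ms.im| < ρ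
    linarith
  obtain ⟨h1, h2⟩ := (h.isScaled_iff hR hk hN hε hωa hm).1 hs
  refine ⟨hs.simple hR hk hN j hr (h.regular_unscale hε hωa hm), ?_, hω2, h1, h2⟩
  -- The frequency is less than δ/2 away from ω, which is itself less than δ/2 away from ωs.
  have h3 := abs_le.1 (h.abs_sub_freq_le hε hωa h1)
  have h4 : (‖ms‖ + ρ) / S.delay N < δ / 2 := by
    rw [div_lt_iff₀ hr0]
    linarith
  exact ⟨by linarith [h3.1, h3.2], by linarith [h3.1, h3.2]⟩

end IsPertCurve

end PertCurve

/-! ### Existence of the perturbed curve and the phases near the base point -/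

theorem eventually_lt_delay (S : PeriodicDDE n) (T : ℝ) : ∀ᶠ N : ℕ in atTop, T < S.delay N := by
  filter_upwards [(tendsto_natCast_atTop_atTop (R := ℝ)).eventually_gt_atTop T] with N hN
  linarith [S.τ_mem.1, show S.delay N = N + S.τ from rfl]

theorem mem_admissible_base {R γs : ℝ} (hR : 0 < R) (hγs : -R < γs) (ωs φs : ℝ) :
    ((ωs * Complex.I, Complex.exp (-(γs + φs * Complex.I))) : ℂ × ℂ) ∈ admissible R := by
  refine ⟨by simpa using hR, ?_⟩
  rw [Complex.norm_exp]
  simpa using (by linarith : -γs < R)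

theorem exists_isPertCurve (S : PeriodicDDE n) {R : ℝ} (hR : 0 ≤ R) (hk : S.charBound R < k)
    {ωs : ℝ} {ms : ℂ} (hadm : ((ωs * Complex.I, Complex.exp (-ms)) : ℂ × ℂ) ∈ admissible R)
    (hroot : S.charFun k (ωs * Complex.I) (Complex.exp (-ms)) = 0)
    (hreg : S.charFunDeriv₂ k (ωs * Complex.I) (Complex.exp (-ms)) ≠ 0) :
    ∃ (r₀ a ε₀ ρ L : ℝ) (μt : ℝ → ℂ) (g : ℝ → ℝ → ℂ),
      IsPertCurve S k R r₀ ωs ms a ε₀ ρ L μt g ∧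
      ∀ x ∈ Ioo (ωs - a) (ωs + a), ContDiffAt ℝ ⊤ μt x ∧ ∀ e ∈ Ico 0 ε₀,
        ContDiffAt ℝ ⊤ (fun p : ℝ × ℝ => g p.1 p.2) (x, e) ∧ ‖g x e‖ ≤ L := by
  obtain ⟨r₀, hr₀⟩ := S.exists_eventually_isRegular hR hk (v₀ := (ωs * Complex.I, ms)) hadm hreg
  set H : ℂ × ℂ → ℂ := fun v => S.charFun k v.1 (Complex.exp (-v.2)) with hH
  have hHs : ContDiffAt ℂ ⊤ H (ωs * Complex.I, ms) := by
    have h1 : ContDiff ℂ ⊤ fun v : ℂ × ℂ => ((v.1, Complex.exp (-v.2)) : ℂ × ℂ) :=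
      contDiff_fst.prodMk (Complex.contDiff_exp.comp contDiff_snd.neg)
    exact ContDiffAt.comp (g := fun p : ℂ × ℂ => S.charFun k p.1 p.2)
      (f := fun v : ℂ × ℂ => ((v.1, Complex.exp (-v.2)) : ℂ × ℂ)) _
      (S.contDiffAt_charFun hR hk hadm) h1.contDiffAt
  -- The derivative in m is -z∂₂h, and z is an exponential, hence nonzero.
  have hHd : deriv (fun m => H (ωs * Complex.I, m)) ms ≠ 0 := by
    have h1 : HasDerivAt (fun m : ℂ => Complex.exp (-m)) (Complex.exp (-ms) * -1) ms :=
      (hasDerivAt_id ms).neg.cexp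
    have h2 := (S.hasDerivAt_charFun_snd hR hk hadm).comp ms h1
    rw [← S.charFunDeriv₂_eq hR hk hadm] at h2
    rw [show (fun m => H (ωs * Complex.I, m)) =
      (fun w => S.charFun k (ωs * Complex.I) w) ∘ fun m : ℂ => Complex.exp (-m) from rfl, h2.deriv]
    exact mul_ne_zero hreg (mul_ne_zero (Complex.exp_ne_zero _) (by norm_num))
  obtain ⟨a, ε₀, ρ, L, μt, g, ha, hε₀, hρ, hL, hbase, hall⟩ :=
    exists_perturbed_curve hHs hroot hHd hr₀
  refine ⟨r₀, a, ε₀, ρ, L, μt, g, ⟨ha, hε₀, hρ, hL, hbase, ?_, ?_, ?_, ?_⟩, ?_⟩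
  · exact fun x hx e he => ((hall x hx).2 e he).2.2.1
  · exact fun x hx e he m hm => (((hall x hx).2 e he).2.2.2.1 m hm).1
  · exact fun x hx e he m hm => (((hall x hx).2 e he).2.2.2.1 m hm).2
  · exact fun x hx e he => ((hall x hx).2 e he).2.2.2.2
  · exact fun x hx => ⟨(hall x hx).1, fun e he =>
      ⟨((hall x hx).2 e he).1, ((hall x hx).2 e he).2.1⟩⟩

/-- If `φs` is the only phase over the base point, then all scaled exponents near the base point
have a phase close to `φs`. -/
theorem exists_phase_close (S : PeriodicDDE n) {R : ℝ} (hR : 0 < R) (hk : S.charBound R < k)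
    {ωs γs φs : ℝ} (hγs : -R < γs)
    (huniq : ∀ φ : ℝ, S.charFun k (ωs * Complex.I) (Complex.exp (-(γs + φ * Complex.I))) = 0 →
      ∃ l : ℤ, φ = φs + 2 * l * Real.pi) {s : ℝ} (hs : 0 < s) :
    ∃ r > 0, ∀ᶠ N : ℕ in atTop, ∀ γ ω : ℝ, S.IsScaledFloquetExponent N γ ω → |γ - γs| < r →
      |ω - ωs| < r → ∃ j : ℤ, |S.delay N * ω - 2 * j * Real.pi - φs| < s := by
  -- One full period of phases around φs with an s-neighbourhood of φs removed. Here h has no zero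
  -- over the base point, and by compactness this remains true for all nearby γ and μ at once.
  set K : Set ℝ := Icc (φs - Real.pi) (φs + Real.pi) ∩ {φ | s ≤ |φ - φs|} with hK
  have hKc : IsCompact K := isCompact_Icc.inter_right
    (isClosed_le continuous_const (by fun_prop))
  set Q : ℝ × ℂ → ℝ → ℂ × ℂ := fun x φ => (x.2, Complex.exp (-(x.1 + φ * Complex.I))) with hQ
  have hQc : Continuous fun y : (ℝ × ℂ) × ℝ => Q y.1 y.2 := by fun_prop
  have hloc : ∀ φ ∈ K, ∀ᶠ y : (ℝ × ℂ) × ℝ in 𝓝 ((γs, (ωs * Complex.I : ℂ)), φ),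
      Q y.1 y.2 ∈ admissible R ∧ S.charFun k (Q y.1 y.2).1 (Q y.1 y.2).2 ≠ 0 := by
    intro φ hφ
    have hadm : Q (γs, (ωs * Complex.I : ℂ)) φ ∈ admissible R := mem_admissible_base hR hγs ωs φ
    have h1 := (hQc.continuousAt (x := ((γs, (ωs * Complex.I : ℂ)), φ))).eventually
      ((isOpen_admissible R).mem_nhds hadm)
    have h2 : ContinuousAt (fun y : (ℝ × ℂ) × ℝ => S.charFun k (Q y.1 y.2).1 (Q y.1 y.2).2)
        ((γs, (ωs * Complex.I : ℂ)), φ) :=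
      ContinuousAt.comp (g := fun p : ℂ × ℂ => S.charFun k p.1 p.2)
        (f := fun y : (ℝ × ℂ) × ℝ => Q y.1 y.2)
        (S.contDiffAt_charFun hR.le hk (m := 1) hadm).continuousAt hQc.continuousAt
    refine h1.and (h2.eventually_ne fun h0 => ?_)
    obtain ⟨l, hl⟩ := huniq φ h0
    have h3 : |φ - φs| ≤ Real.pi :=
      abs_le.2 ⟨by linarith [hφ.1.1], by linarith [hφ.1.2]⟩
    have h4 := hφ.2
    change s ≤ |φ - φs| at h4
    rw [hl, add_sub_cancel_left] at h3 h4
    rw [abs_mul, abs_mul, abs_of_pos Real.pi_pos, abs_two] at h3 h4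
    rcases eq_or_ne l 0 with rfl | hl0
    · simp at h4
      linarith
    · have h5 : (1 : ℝ) ≤ |(l : ℝ)| := by exact_mod_cast Int.one_le_abs hl0
      nlinarith [Real.pi_pos]
  obtain ⟨t, ht, htE⟩ := Metric.eventually_nhds_iff.1
    (hKc.eventually_forall_of_forall_eventually (P := fun x φ => Q x φ ∈ admissible R ∧
      S.charFun k (Q x φ).1 (Q x φ).2 ≠ 0) hloc)
  -- The entry 1 bounds |γ| by |γs| + 1, so that γ/(N+τ) is small for large N; t/2 leaves room for
  -- that term beside |ω - ωs|.
  refine ⟨min (t / 2) 1, by positivity, ?_⟩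
  filter_upwards [S.eventually_lt_delay (2 * (|γs| + 1) / t), eventually_ge_atTop 1]
    with N hNt hN γ ω hsc hγ hω
  have hr : 0 < S.delay N := zero_lt_one.trans_le (S.one_le_delay hN)
  -- Rounding selects the multiple of 2π that brings the phase into the period centred at φs; if it
  -- were not s-close to φs, it would lie in K.
  set x : ℝ := (S.delay N * ω - φs) / (2 * Real.pi) with hx
  refine ⟨round x, ?_⟩
  by_contra! hcon
  have h2pi : 0 < 2 * Real.pi := by positivity
  have hφ : |S.delay N * ω - 2 * round x * Real.pi - φs| ≤ Real.pi := by
    have h1 := abs_sub_round x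
    have e : S.delay N * ω - 2 * round x * Real.pi - φs = 2 * Real.pi * (x - round x) := by
      rw [hx]
      field_simp
      ring
    rw [e, abs_mul, abs_of_pos h2pi]
    nlinarith
  have hmem : S.delay N * ω - 2 * round x * Real.pi ∈ K :=
    ⟨⟨by linarith [(abs_le.1 hφ).1], by linarith [(abs_le.1 hφ).2]⟩, hcon⟩
  have hdist : dist ((γ, S.unscale N γ ω) : ℝ × ℂ) (γs, (ωs * Complex.I : ℂ)) < t := by
    have h1 := hγ.trans_le (min_le_left _ _)
    have h2 := hω.trans_le (min_le_left _ _)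
    have h3 := hγ.trans_le (min_le_right _ _)
    rw [Prod.dist_eq, max_lt_iff, Real.dist_eq, dist_eq_norm]
    refine ⟨by linarith, ?_⟩
    have e : S.unscale N γ ω - ωs * Complex.I =
        ((γ / S.delay N : ℝ) : ℂ) + ((ω - ωs : ℝ) : ℂ) * Complex.I := by
      rw [unscale]
      push_cast
      ring
    rw [e]
    refine (norm_add_le _ _).trans_lt ?_
    rw [norm_mul, Complex.norm_I, mul_one, Complex.norm_real, Complex.norm_real, Real.norm_eq_abs,
      Real.norm_eq_abs, abs_div, abs_of_pos hr]
    have h4 : |γ| / S.delay N < t / 2 := by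
      rw [div_lt_iff₀ ht] at hNt
      rw [div_lt_iff₀ hr]
      have h5 := abs_sub_abs_le_abs_sub γ γs
      nlinarith
    linarith
  obtain ⟨h1, h2⟩ := htE hdist _ hmem
  have e : Q (γ, S.unscale N γ ω) (S.delay N * ω - 2 * round x * Real.pi) =
      (S.unscale N γ ω, Complex.exp (-S.phasePoint N γ ω (round x))) := by
    rw [hQ, phasePoint, Complex.mk_eq_add_mul_I]
  rw [e] at h1 h2
  exact h2 ((S.isScaledFloquetExponent_iff hR.le hk hN _ h1).1 hsc)

/-- There are scaled exponents arbitrarily close to the base point. -/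
theorem IsPertCurve.exists_near {S : PeriodicDDE n} {R r₀ ωs : ℝ} {ms : ℂ} {a ε₀ ρ L : ℝ}
    {μt : ℝ → ℂ} {g : ℝ → ℝ → ℂ} (h : IsPertCurve S k R r₀ ωs ms a ε₀ ρ L μt g) (hR : 0 ≤ R)
    (hk : S.charBound R < k) {η : ℝ} (hη : 0 < η) :
    ∀ᶠ N : ℕ in atTop, ∃ (γ ω : ℝ) (j : ℤ), S.IsScaledFloquetExponent N γ ω ∧
      |γ - ms.re| < η ∧ |ω - ωs| < η ∧ |S.delay N * ω - 2 * j * Real.pi - ms.im| < η := by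
  have ha := h.a_pos
  have hF : 0 ≤ ‖ms‖ + ρ := add_nonneg (norm_nonneg _) h.ρ_pos.le
  set b : ℝ := ‖ms‖ + ρ + 2 * Real.pi with hb
  have hbpos : 0 < b := by positivity
  filter_upwards [eventually_ge_atTop 1, S.eventually_lt_delay (1 / ε₀),
    S.eventually_lt_delay r₀, S.eventually_lt_delay (2 * b / (a / 2)),
    S.eventually_lt_delay (b / η), S.eventually_lt_delay (L * (b + 1) / η)]
    with N hN hε hr₀ h3 h4 h5
  have hr : 0 < S.delay N := zero_lt_one.trans_le (S.one_le_delay hN)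
  replace hε : 1 / S.delay N < ε₀ := (one_div_lt h.ε₀_pos hr).1 hε
  rw [div_lt_iff₀ (by positivity), mul_comm] at h3
  -- This is the index of the largest frequency not exceeding ωs, which is at most 2π/(N+τ) away.
  set j : ℤ := ⌊S.delay N * ωs / (2 * Real.pi)⌋ with hj
  have h2pi : 0 < 2 * Real.pi := by positivity
  have hfreq : S.freq N j = 2 * Real.pi * j / S.delay N := by
    rw [freq]
    ring
  have hf1 : S.freq N j ≤ ωs := by
    have := Int.floor_le (S.delay N * ωs / (2 * Real.pi))
    rw [← hj, le_div_iff₀ h2pi] at this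
    rw [hfreq, div_le_iff₀ hr]
    linarith
  have hf2 : ωs - S.freq N j ≤ 2 * Real.pi / S.delay N := by
    have := Int.lt_floor_add_one (S.delay N * ωs / (2 * Real.pi))
    rw [← hj, div_lt_iff₀ h2pi] at this
    rw [sub_le_iff_le_add, hfreq, ← add_div, le_div_iff₀ hr]
    linarith
  have hf3 : 2 * Real.pi / S.delay N < a / 2 := by
    rw [div_lt_iff₀ hr]
    linarith
  obtain ⟨ω, hω, hs⟩ := h.exists_phaseEq hN hε (half_pos ha) (by linarith) (by linarith)
    (j := j) ⟨by linarith, by linarith⟩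
  have hωa : ω ∈ Ioo (ωs - a) (ωs + a) := ⟨by linarith [hω.1], by linarith [hω.2]⟩
  have hsa : ωs ∈ Ioo (ωs - a) (ωs + a) := ⟨by linarith, by linarith⟩
  have hω2 : |ω - ωs| ≤ b / S.delay N := by
    have h6 := abs_le.1 (h.abs_sub_freq_le hε hωa hs)
    have h7 : 0 ≤ 2 * Real.pi / S.delay N := by positivity
    rw [hb, add_div, abs_le]
    constructor <;> linarith [h6.1, h6.2]
  have hp : ‖pert μt g (1 / S.delay N) ω - ms‖ < η := by
    have h6 := h.lipschitz ω hωa _ (inv_delay_mem hε) ωs hsa 0 ⟨le_rfl, h.ε₀_pos⟩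
    rw [pert_zero, h.base, sub_zero, abs_of_nonneg (one_div_nonneg.2 hr.le)] at h6
    refine h6.trans_lt ?_
    calc L * (|ω - ωs| + 1 / S.delay N) ≤ L * (b / S.delay N + 1 / S.delay N) := by
          have := h.L_nonneg
          gcongr
      _ = L * (b + 1) / S.delay N := by ring
      _ < η := by
          rw [div_lt_iff₀ hη] at h5
          rw [div_lt_iff₀ hr]
          linarith
  refine ⟨pertRe μt g (1 / S.delay N) ω, ω, j, (h.isSimple hR hk hN hε hr₀.le hωa hs).1, ?_, ?_, ?_⟩
  · rw [← pert_re, ← Complex.sub_re]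
    exact (Complex.abs_re_le_norm _).trans_lt hp
  · refine hω2.trans_lt ?_
    rw [div_lt_iff₀ hη] at h4
    rw [div_lt_iff₀ hr]
    linarith
  · rw [(solvesPhaseEq_iff hN).1 hs, ← pert_im, ← Complex.sub_im]
    exact (Complex.abs_im_le_norm _).trans_lt hp

theorem neZero_of_charBound_lt (S : PeriodicDDE n) {R : ℝ} (hR : 0 < R) {k : ℕ}
    (hk : S.charBound R < k) : NeZero k := by
  refine ⟨fun h0 => ?_⟩
  have h1 : 0 ≤ matrixSupNorm S.A := Real.iSup_nonneg fun t => Real.iSup_nonneg fun i =>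
    Finset.sum_nonneg fun j _ => abs_nonneg _
  have h2 : matrixSupNorm S.A + R ≤ S.charBound R := le_max_left _ _
  rw [h0, Nat.cast_zero] at hk
  linarith

end PeriodicDDE

end

/-! ### The main theorem -/

open Set Filter Topology
open scoped Matrix
theorem mainTheorem4 {n : ℕ} (S : PeriodicDDE n) (R : ℝ) (hR : 0 < R) (k : ℕ)
    (hk : S.charBound R < k) (ωs γs φs : ℝ) (hγs : -R < γs)
    (hroot : S.charFun k (ωs * Complex.I) (Complex.exp (-(γs + φs * Complex.I))) = 0)
    (hreg : S.charFunDeriv₂ k (ωs * Complex.I) (Complex.exp (-(γs + φs * Complex.I))) ≠ 0) :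
    ∃ (δ₀ ε₀ ρ C : ℝ) (μt : ℝ → ℂ) (g : ℝ → ℝ → ℂ), 0 < δ₀ ∧ 0 < ε₀ ∧ 0 < ρ ∧
      -- the unique regular root curve through `γs + i φs`
      ContDiffOn ℝ (⊤ : ℕ∞) μt (Ioo (ωs - 2 * δ₀) (ωs + 2 * δ₀)) ∧
      μt ωs = γs + φs * Complex.I ∧
      (∀ ω ∈ Ioo (ωs - 2 * δ₀) (ωs + 2 * δ₀),
        ‖μt ω - (γs + φs * Complex.I)‖ < ρ ∧
        S.charFunDeriv₂ k (ω * Complex.I) (Complex.exp (-μt ω)) ≠ 0 ∧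
        ∀ m : ℂ, ‖m - (γs + φs * Complex.I)‖ < ρ →
          (S.charFun k (ω * Complex.I) (Complex.exp (-m)) = 0 ↔ m = μt ω)) ∧
      -- the function `g` in the perturbation terms is smooth and bounded
      ContDiffOn ℝ (⊤ : ℕ∞) (fun p : ℝ × ℝ => g p.1 p.2)
        (Ioo (ωs - 2 * δ₀) (ωs + 2 * δ₀) ×ˢ Ico 0 ε₀) ∧
      (∀ ω ∈ Ioo (ωs - 2 * δ₀) (ωs + 2 * δ₀), ∀ ε ∈ Ico 0 ε₀, ‖g ω ε‖ ≤ C) ∧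
      (∀ δ : ℝ, 0 < δ → δ ≤ δ₀ → ∃ r : ℝ, 0 < r ∧ ∃ N₀ : ℕ, 1 ≤ N₀ ∧ ∀ N : ℕ, N₀ ≤ N →
        1 / S.delay N < ε₀ ∧
        -- unique solvability of the fixed point problem
        (∀ j : ℤ, S.freq N j ∈ Ioo (ωs - δ) (ωs + δ) →
          ∃! ω : ℝ, ω ∈ Ioo (ωs - 2 * δ) (ωs + 2 * δ) ∧ S.SolvesPhaseEq N μt g j ω) ∧
        -- its solutions give algebraically simple scaled Floquet exponents, with asymptotics
        (∀ j : ℤ, S.freq N j ∈ Ioo (ωs - δ) (ωs + δ) →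
          ∀ ω ∈ Ioo (ωs - 2 * δ) (ωs + 2 * δ), S.SolvesPhaseEq N μt g j ω →
            S.IsSimpleScaledFloquetExponent N
              (PeriodicDDE.pertRe μt g (1 / S.delay N) ω) ω ∧
            |ω - (S.freq N j + (μt (S.freq N j)).im / S.delay N)| ≤ C / S.delay N ^ 2) ∧
        -- spacing along the band
        (∀ j : ℤ, S.freq N j ∈ Ioo (ωs - δ) (ωs + δ) →
          S.freq N (j + 1) ∈ Ioo (ωs - δ) (ωs + δ) →
          ∀ ω ∈ Ioo (ωs - 2 * δ) (ωs + 2 * δ), ∀ ω' ∈ Ioo (ωs - 2 * δ) (ωs + 2 * δ),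
            S.SolvesPhaseEq N μt g j ω → S.SolvesPhaseEq N μt g (j + 1) ω' →
            |ω' - ω - 2 * Real.pi / S.delay N| ≤ C / S.delay N ^ 2) ∧
        -- all scaled Floquet exponents near `γs + i ωs` with phase near `φs` arise in this way
        (∀ (γ ω : ℝ) (j : ℤ), S.IsScaledFloquetExponent N γ ω → |γ - γs| < r → |ω - ωs| < r →
          |S.delay N * ω - 2 * j * Real.pi - φs| < r →
            S.IsSimpleScaledFloquetExponent N γ ω ∧
            S.freq N j ∈ Ioo (ωs - δ) (ωs + δ) ∧
            ω ∈ Ioo (ωs - 2 * δ) (ωs + 2 * δ) ∧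
            S.SolvesPhaseEq N μt g j ω ∧
            γ = PeriodicDDE.pertRe μt g (1 / S.delay N) ω) ∧
        -- no condition on the phase is needed if `φs` is the only phase of `γs + i ωs`
        ((∀ φ : ℝ, S.charFun k (ωs * Complex.I) (Complex.exp (-(γs + φ * Complex.I))) = 0 →
            ∃ l : ℤ, φ = φs + 2 * l * Real.pi) →
          ∀ γ ω : ℝ, S.IsScaledFloquetExponent N γ ω → |γ - γs| < r → |ω - ωs| < r →
            S.IsSimpleScaledFloquetExponent N γ ω ∧
            ∃ j : ℤ, S.freq N j ∈ Ioo (ωs - δ) (ωs + δ) ∧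
              ω ∈ Ioo (ωs - 2 * δ) (ωs + 2 * δ) ∧
              S.SolvesPhaseEq N μt g j ω ∧
              γ = PeriodicDDE.pertRe μt g (1 / S.delay N) ω)) ∧
      -- there are such exponents arbitrarily close to `γs + i ωs` with phase close to `φs`
      (∀ η : ℝ, 0 < η → ∃ N₁ : ℕ, ∀ N : ℕ, N₁ ≤ N → ∃ (γ ω : ℝ) (j : ℤ),
        S.IsScaledFloquetExponent N γ ω ∧ |γ - γs| < η ∧ |ω - ωs| < η ∧
        |S.delay N * ω - 2 * j * Real.pi - φs| < η) := by
  have : NeZero k := S.neZero_of_charBound_lt hR hk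
  set ms : ℂ := γs + φs * Complex.I with hms
  have hre : ms.re = γs := by simp [hms]
  have him : ms.im = φs := by simp [hms]
  have hadm := PeriodicDDE.mem_admissible_base hR hγs ωs φs
  rw [← hms] at hadm
  obtain ⟨r₀, a, ε₀, ρ, L, μt, g, h, hsm⟩ := S.exists_isPertCurve hR.le hk hadm hroot hreg
  have ha := h.a_pos
  have hε₀ := h.ε₀_pos
  have hρ := h.ρ_pos
  have hL := h.L_nonneg
  have hF : 0 ≤ ‖ms‖ + ρ := add_nonneg (norm_nonneg _) hρ.le
  have hpi := Real.pi_pos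
  have h2a : 2 * (a / 2) = a := by ring
  have hle : ((⊤ : ℕ∞) : WithTop ℕ∞) ≤ ⊤ := le_top
  -- One constant for three purposes: the bound on g and the two second-order estimates, whose
  -- factors ‖ms‖ + ρ + 1 and 2(‖ms‖ + ρ) + 2π are both dominated.
  set C : ℝ := max L (L * (2 * (‖ms‖ + ρ) + 2 * Real.pi + 1)) with hC
  have hC1 : L * (‖ms‖ + ρ + 1) ≤ C :=
    (mul_le_mul_of_nonneg_left (by linarith) hL).trans (le_max_right _ _)
  have hC2 : L * (2 * (‖ms‖ + ρ) + 2 * Real.pi) ≤ C :=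
    (mul_le_mul_of_nonneg_left (by linarith) hL).trans (le_max_right _ _)
  refine ⟨a / 2, ε₀, ρ, C, μt, g, half_pos ha, hε₀, hρ, ?_, h.base, ?_, ?_, ?_, ?_, ?_⟩
  · rw [h2a]
    exact fun x hx => ((hsm x hx).1.of_le hle).contDiffWithinAt
  · rw [h2a]
    intro ω hω
    -- At ε = 0 the perturbed curve is μ̃ itself, so the unperturbed statements are special cases.
    have he : (0 : ℝ) ∈ Ico 0 ε₀ := ⟨le_rfl, hε₀⟩
    have h1 := h.norm_lt ω hω 0 he
    have h2 := h.regular ω hω 0 he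
    have h3 := h.root_iff ω hω 0 he
    simp only [PeriodicDDE.pert_zero, Complex.ofReal_zero, zero_mul, add_zero] at h1 h2 h3
    exact ⟨h1, (h2 _ h1).2.1, h3⟩
  · rw [h2a]
    exact fun p hp => (((hsm p.1 hp.1).2 p.2 hp.2).1.of_le hle).contDiffWithinAt
  · rw [h2a]
    exact fun ω hω ε hε => ((hsm ω hω).2 ε hε).2.trans (le_max_left _ _)
  · intro δ hδ hδa
    have hδa2 : 2 * δ ≤ a := by linarith
    have hsub : ∀ ω ∈ Ioo (ωs - 2 * δ) (ωs + 2 * δ), ω ∈ Ioo (ωs - a) (ωs + a) := fun ω hω =>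
      ⟨by linarith [hω.1], by linarith [hω.2]⟩
    have hsub' : ∀ ω ∈ Ioo (ωs - δ) (ωs + δ), ω ∈ Ioo (ωs - a) (ωs + a) := fun ω hω =>
      ⟨by linarith [hω.1], by linarith [hω.2]⟩
    -- The uniqueness of the phase is kept as a premise inside, so that one radius serves both final
    -- claims; if the premise fails, any radius will do.
    obtain ⟨r, hr, hev⟩ : ∃ r > 0, ∀ᶠ N : ℕ in atTop,
        (∀ φ : ℝ, S.charFun k (ωs * Complex.I) (Complex.exp (-(γs + φ * Complex.I))) = 0 →
          ∃ l : ℤ, φ = φs + 2 * l * Real.pi) →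
        ∀ γ ω : ℝ, S.IsScaledFloquetExponent N γ ω → |γ - γs| < r → |ω - ωs| < r →
          ∃ j : ℤ, |S.delay N * ω - 2 * j * Real.pi - φs| < ρ / 2 := by
      by_cases hu : ∀ φ : ℝ,
          S.charFun k (ωs * Complex.I) (Complex.exp (-(γs + φ * Complex.I))) = 0 →
            ∃ l : ℤ, φ = φs + 2 * l * Real.pi
      · obtain ⟨r, hr, hev⟩ := S.exists_phase_close hR hk hγs hu (half_pos hρ)
        exact ⟨r, hr, hev.mono fun N hN _ => hN⟩
      · exact ⟨1, one_pos, Eventually.of_forall fun N h' => absurd h' hu⟩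
    obtain ⟨N₀, hN₀⟩ := eventually_atTop.1 (hev.and <| (S.eventually_lt_delay (1 / ε₀)).and <|
      (S.eventually_lt_delay r₀).and <| (S.eventually_lt_delay L).and <|
      S.eventually_lt_delay (2 * (‖ms‖ + ρ) / δ))
    -- Half of ρ for each of the real and imaginary parts keeps m in the disc of uniqueness, and δ/2
    -- leaves the other half of δ for the distance between ω and its frequency.
    refine ⟨min r (min (ρ / 2) (δ / 2)), by positivity, max N₀ 1, le_max_right _ _, fun N hN => ?_⟩
    obtain ⟨hphase, hε, hr₀, hLN, hFN⟩ := hN₀ N ((le_max_left _ _).trans hN)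
    replace hN : 1 ≤ N := (le_max_right _ _).trans hN
    have hdel : 0 < S.delay N := zero_lt_one.trans_le (S.one_le_delay hN)
    replace hε : 1 / S.delay N < ε₀ := (one_div_lt hε₀ hdel).1 hε
    rw [div_lt_iff₀ hδ, mul_comm _ δ] at hFN
    have hclose : ∀ (γ ω : ℝ) (j : ℤ), S.IsScaledFloquetExponent N γ ω →
        |γ - γs| < min r (min (ρ / 2) (δ / 2)) → |ω - ωs| < min r (min (ρ / 2) (δ / 2)) →
        |S.delay N * ω - 2 * j * Real.pi - φs| < ρ / 2 →
          S.IsSimpleScaledFloquetExponent N γ ω ∧ S.freq N j ∈ Ioo (ωs - δ) (ωs + δ) ∧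
          ω ∈ Ioo (ωs - 2 * δ) (ωs + 2 * δ) ∧ S.SolvesPhaseEq N μt g j ω ∧
          γ = PeriodicDDE.pertRe μt g (1 / S.delay N) ω := by
      intro γ ω j hs hγ hω hφ
      refine h.of_phase_close hR.le hk hN hε hr₀.le hδ hδa2 hFN hs ?_ ?_ (him ▸ hφ)
      · rw [hre]
        exact hγ.trans_le ((min_le_right _ _).trans (min_le_left _ _))
      · exact hω.trans_le ((min_le_right _ _).trans (min_le_right _ _))
    refine ⟨hε, ?_, ?_, ?_, ?_, ?_⟩
    · intro j hj
      obtain ⟨ω, hω, hs⟩ := h.exists_phaseEq hN hε hδ hδa2 hFN hj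
      exact ⟨ω, ⟨hω, hs⟩, fun ω' hω' =>
        h.phaseEq_unique hN hε hLN (hsub _ hω'.1) (hsub _ hω) hω'.2 hs⟩
    · intro j hj ω hω hs
      refine ⟨h.isSimple hR.le hk hN hε hr₀.le (hsub _ hω) hs, ?_⟩
      refine (h.abs_sub_asymptotic_le hN hε (hsub _ hω) (hsub' _ hj) hs).trans ?_
      gcongr
    · intro j _ _ ω hω ω' hω' hs hs'
      refine (h.abs_spacing_le hN hε (hsub _ hω) (hsub _ hω') hs hs').trans ?_
      gcongr
    · intro γ ω j hs hγ hω hφ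
      exact hclose γ ω j hs hγ hω (hφ.trans_le ((min_le_right _ _).trans (min_le_left _ _)))
    · intro hu γ ω hs hγ hω
      obtain ⟨j, hj⟩ := hphase hu γ ω hs (hγ.trans_le (min_le_left _ _))
        (hω.trans_le (min_le_left _ _))
      obtain ⟨h1, h2⟩ := hclose γ ω j hs hγ hω hj
      exact ⟨h1, j, h2⟩
  · intro η hη
    obtain ⟨N₁, hN₁⟩ := eventually_atTop.1 (h.exists_near hR.le hk hη)
    rw [hre, him] at hN₁
    exact ⟨N₁, hN₁⟩
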